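/- **Notation.** Let $\mathcal H=\{\xi\in\mathbb C:\operatorname{Re}\xi>0\}$ and, for $T>0$, $Q_T=\{\xi: 0<\operatorname{Re}\xi<4T,\ |\operatorname{Im}\xi|<4T\}$. *Models.* A model consists of finitely many (at least one) pairwise disjoint, simply connected, unbounded domains $\Omega_1,\dots,\Omega_N\subset\mathbb C$ and conformal bijections $\tau_j:\Omega_j\to\mathcal H$ such that $\varphi_j=\tau_j^{-1}$ satisfies $|\varphi_j(\xi)|\to\infty$ as $|\xi|\to\infty$, $\xi\in\mathcal H$. Its model function is $f=e^{\tau_j}$ on $\Omega_j$. Its Julia set $\mathcal J_f$ is the set of $z$ with $|z|>1$ all of whose iterates $f^n(z)$, $n\ge1$, are defined and satisfy $|f^n(z)|>1$. *Class $\mathcal B$.* This is the class of transcendental entire functions $f$ for which the closure $S(f)$ of the set of critical values and finite asymptotic values is bounded; $\mathcal J_f$ is the usual Julia set. *Tracts.* A tract of $f$ at level $R\ge 1$ is a connected component $\Omega$ of $\{|f|>R\}$. An associated conformal map is a conformal bijection $\varphi:\mathcal H\to\Omega$ with $f(\varphi(\xi))=R e^{\xi}$; if every tract at level $R$ has one,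 the tracts at level $R$ are called logarithmic. A tract with associated map $\varphi$ is called Hölder with exponent $\alpha\in(0,1]$ if 1. there is $M\in(0,\infty)$ such that, for all large $T$, $|\varphi(\xi)|\le M|\varphi(\xi')|$ for all $\xi,\xi'\in Q_T\setminus Q_{T/8}$; and 2. there are $H$ and $T_0\ge1$ such that, for every $T\ge T_0$, the map $g(z)=\varphi(Tz)$ satisfies $|g(z_1)-g(z_2)|\le H|g'(1)||z_1-z_2|^\alpha$ for all $z_1,z_2\in Q_1$. We say that $f$ has finitely many Hölder tracts with exponent $\alpha$ if, for some $R\ge1$, $f$ has only finitely many tracts at level $R$, and all of them are Hölder with exponent $\alpha$. *Spectrum.* For a conformal map $\varphi:\mathcal H\to\Omega$ put $\varphi_T(z)=\varphi(Tz)/|\varphi(T)|$, $$\beta_{h}(r,t)=\frac{\log\int_{1\le|y|\le2}|h'(r+iy)|^t\,dy}{\log(1/r)},\qquad \beta_{\infty}(t)=\limsup_{T\to\infty}\beta_{\varphi_T}(1/T,t),$$ $b_\infty(t)=\beta_\infty(t)-t+1$ and $\Theta=\inf\{t>0:b_\infty(t)=0\}$. For $f$, let $\beta_{\infty,f}$ and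 $\Theta_f$ be the maxima of $\beta_\infty$ and $\Theta$ over its finitely many tracts, and $b_{\infty,f}(t)=\beta_{\infty,f}(t)-t+1$. For a model these are computed from $\varphi_1,\dots,\varphi_N$. For $f\in\mathcal B$ they are computed at a level $R\ge 1$ at which there are finitely many tracts, all logarithmic, from associated maps. The function $f$ has negative spectrum if $b_{\infty,f}(t)<0$ for all $t>\Theta_f$. *Hyperbolic dimension.* $\operatorname{HypDim}(f)$ is the Hausdorff dimension of $\{z\in\mathcal J_f:\liminf_{n\to\infty}|f^n(z)|<\infty\}$. **Proposition.** Let $f$ be a model function or a function of class $\mathcal B$, and suppose that $f$ has finitely many Hölder tracts with exponent $\alpha\in(0,1]$. Then $f$ has negative spectrum and $$1\le\Theta_f\le\operatorname{HypDim}(f)\le2 .$$ If moreover $\alpha>1/2$, then $\Theta_f<2$. For $f\in\mathcal B$ all this holds for every level $R\ge1$ at which there are finitely many tracts, all logarithmic, and for every choice of the associated maps. -/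

import Mathlib

noncomputable section

namespace Tract

open Filter Topology Set

/-- The right half plane `{Re ξ > 0}`. -/
def halfPlane : Set ℂ := {ξ | 0 < ξ.re}

/-- The rectangle `Q_T`. -/
def rect (T : ℝ) : Set ℂ := {ξ | 0 < ξ.re ∧ ξ.re < 4 * T ∧ -(4 * T) < ξ.im ∧ ξ.im < 4 * T}

/-! ### Tracts -/

/-- The tracts of `f` at level `R`: the connected components of `{|f| > R}`. -/
def tracts (f : ℂ → ℂ) (R : ℝ) : Set (Set ℂ) :=
  {Ω | ∃ z, R < ‖f z‖ ∧ Ω = connectedComponentIn {w | R < ‖f w‖} z}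

/-- `φ` maps the half plane conformally onto `Ω`, and `f = R exp ∘ φ⁻¹` on `Ω`. -/
structure IsTractMap (f : ℂ → ℂ) (R : ℝ) (Ω : Set ℂ) (φ : ℂ → ℂ) : Prop where
  holo : DifferentiableOn ℂ φ halfPlane
  bij : BijOn φ halfPlane Ω
  eq_exp : ∀ ξ ∈ halfPlane, f (φ ξ) = R * Complex.exp ξ

/-- `Ω₁, …, Ω_N` enumerates without repetition all tracts of `f` at level `R`, and `φ₁, …, φ_N` are
associated conformal maps of the half plane onto them. -/
structure IsTractSystem (f : ℂ → ℂ) (R : ℝ) {N : ℕ} (Ω : Fin N → Set ℂ) (φ : Fin N → ℂ → ℂ) :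
    Prop where
  inj : Function.Injective Ω
  range_eq : range Ω = tracts f R
  isTractMap : ∀ j, IsTractMap f R (Ω j) (φ j)

/-- `|φ ξ| ≤ M |φ ξ'|` for all `ξ, ξ' ∈ Q_T \ Q_{T/8}` and all large `T`. -/
def HasBoundedOscillation (φ : ℂ → ℂ) : Prop :=
  ∃ M : ℝ, 0 < M ∧ ∃ T₁ : ℝ, 1 ≤ T₁ ∧ ∀ T ≥ T₁, ∀ ξ ∈ rect T \ rect (T / 8),
    ∀ ξ' ∈ rect T \ rect (T / 8), ‖φ ξ‖ ≤ M * ‖φ ξ'‖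

/-- The map `g` on `Q_1` is `(H, α)`-Hölder, in the form that is scale invariant in the range. -/
def IsHolderOnRect (H α : ℝ) (g : ℂ → ℂ) : Prop :=
  ∀ z₁ ∈ rect 1, ∀ z₂ ∈ rect 1, ‖g z₁ - g z₂‖ ≤ H * ‖deriv g 1‖ * ‖z₁ - z₂‖ ^ α

/-- The tract with conformal map `φ` is `(H, α)`-Hölder. -/
def IsHolderTract (H α : ℝ) (φ : ℂ → ℂ) : Prop :=
  HasBoundedOscillation φ ∧
    ∃ T₀ : ℝ, 1 ≤ T₀ ∧ ∀ T ≥ T₀, IsHolderOnRect H α (fun z => φ ((T : ℂ) * z))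

/-- `f` has finitely many Hölder tracts with exponent `α`: at some level `R ≥ 1` there are finitely
many tracts, and all of them are Hölder with exponent `α`. -/
def HasHolderTracts (f : ℂ → ℂ) (α : ℝ) : Prop :=
  ∃ R : ℝ, 1 ≤ R ∧ (tracts f R).Finite ∧
    ∀ Ω ∈ tracts f R, ∃ φ : ℂ → ℂ, IsTractMap f R Ω φ ∧ ∃ H : ℝ, IsHolderTract H α φ

/-! ### Integral means spectrum at infinity -/

/-- The rescaled map `φ_T = φ(T ·) / |φ(T)|`. -/
def rescale (φ : ℂ → ℂ) (T : ℝ) : ℂ → ℂ := fun z => φ ((T : ℂ) * z) / (‖φ (T : ℂ)‖ : ℂ)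

/-- The integral means `β_h(r, t)`, taken over `[-2, -1] ∪ [1, 2]`. -/
def integralMeans (h : ℂ → ℂ) (r t : ℝ) : ℝ :=
  Real.log (∫ y in Icc (-2 : ℝ) (-1) ∪ Icc (1 : ℝ) 2, ‖deriv h (r + y * Complex.I)‖ ^ t) /
    Real.log (1 / r)

/-- `β_∞(t)` of a single tract. -/
def betaInf (φ : ℂ → ℂ) (t : ℝ) : ℝ :=
  limsup (fun T : ℝ => integralMeans (rescale φ T) (1 / T) t) atTop

/-- `b_∞(t) = β_∞(t) - t + 1` of a single tract. -/
def bInf (φ : ℂ → ℂ) (t : ℝ) : ℝ := betaInf φ t - t + 1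

/-- `Θ` of a single tract. -/
def theta (φ : ℂ → ℂ) : ℝ := sInf {t : ℝ | 0 < t ∧ bInf φ t = 0}

variable {N : ℕ}

/-- `β_∞(t)` of finitely many tracts: the maximum over the tracts. -/
def betaInfMax (φ : Fin N → ℂ → ℂ) (t : ℝ) : ℝ := ⨆ j, betaInf (φ j) t

/-- `b_∞(t) = β_∞(t) - t + 1` of finitely many tracts. -/
def bInfMax (φ : Fin N → ℂ → ℂ) (t : ℝ) : ℝ := betaInfMax φ t - t + 1

/-- `Θ` of finitely many tracts: the maximum over the tracts. -/
def thetaMax (φ : Fin N → ℂ → ℂ) : ℝ := ⨆ j, theta (φ j)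

/-- Negative spectrum: `b_∞ < 0` to the right of `Θ`. -/
def HasNegativeSpectrum (φ : Fin N → ℂ → ℂ) : Prop := ∀ t > thetaMax φ, bInfMax φ t < 0

/-! ### Models -/

/-- A model: finitely many pairwise disjoint simply connected unbounded domains `Ω_j` with conformal
maps `τ_j` onto the half plane, whose inverses extend continuously to infinity. -/
structure Model where
  N : ℕ
  N_pos : 0 < N
  Ω : Fin N → Set ℂ
  τ : Fin N → ℂ → ℂ
  isOpen : ∀ j, IsOpen (Ω j)
  simplyConnected : ∀ j, SimplyConnectedSpace (Ω j)
  unbounded : ∀ j, ¬ Bornology.IsBounded (Ω j)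
  disjoint : Pairwise fun i j => Disjoint (Ω i) (Ω j)
  holo : ∀ j, DifferentiableOn ℂ (τ j) (Ω j)
  bij : ∀ j, BijOn (τ j) (Ω j) halfPlane
  tendsto_infty : ∀ j, Tendsto (Function.invFunOn (τ j) (Ω j))
    (Bornology.cobounded ℂ ⊓ 𝓟 halfPlane) (Bornology.cobounded ℂ)

/-- The inverse `φ_j` of `τ_j`. -/
def Model.φ (m : Model) (j : Fin m.N) : ℂ → ℂ := Function.invFunOn (m.τ j) (m.Ω j)

open Classical in
/-- The model function `exp ∘ τ` on `⋃ Ω_j`. Outside its domain it has the value `0`, which lies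
neither in `{|z| > 1}` nor in any `{|z| > R}`, `R ≥ 1`, so that tracts and Julia set below are those
of the partially defined function. -/
def Model.toFun (m : Model) (z : ℂ) : ℂ :=
  if h : ∃ j, z ∈ m.Ω j then Complex.exp (m.τ h.choose z) else 0

/-- The Julia set of a model: the points of `{|z| > 1}` all of whose iterates are defined and lie in
`{|z| > 1}`. -/
def Model.julia (m : Model) : Set ℂ := {z | ∀ n : ℕ, 1 < ‖m.toFun^[n] z‖}

/-! ### Entire functions -/

/-- The set of critical values. -/
def criticalValues (f : ℂ → ℂ) : Set ℂ := f '' {z | deriv f z = 0}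

/-- The set of finite asymptotic values. -/
def asymptoticValues (f : ℂ → ℂ) : Set ℂ :=
  {a | ∃ γ : ℝ → ℂ, ContinuousOn γ (Ici 0) ∧ Tendsto γ atTop (Bornology.cobounded ℂ) ∧
    Tendsto (fun s => f (γ s)) atTop (𝓝 a)}

/-- The singular set `S(f)`. -/
def singularSet (f : ℂ → ℂ) : Set ℂ := closure (criticalValues f ∪ asymptoticValues f)

/-- The Eremenko–Lyubich class: transcendental entire functions with bounded singular set. -/
structure ClassB (f : ℂ → ℂ) : Prop where
  entire : Differentiable ℂ f
  transcendental : ¬ ∃ p : Polynomial ℂ, ∀ z, f z = p.eval z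
  bounded : Bornology.IsBounded (singularSet f)

/-- The iterates of `f` form a normal family on `U`: every sequence of iterates has a subsequence
that converges locally uniformly on `U`, to a finite function or to `∞`. -/
def IteratesNormalOn (f : ℂ → ℂ) (U : Set ℂ) : Prop :=
  ∀ u : ℕ → ℕ, StrictMono u → ∃ v : ℕ → ℕ, StrictMono v ∧
    ((∃ g : ℂ → ℂ, TendstoLocallyUniformlyOn (fun k => f^[u (v k)]) g atTop U) ∨
      ∀ K ⊆ U, IsCompact K → ∀ C : ℝ, ∀ᶠ k in atTop, ∀ z ∈ K, C < ‖f^[u (v k)] z‖)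

/-- The Julia set of an entire function: the points without a disk around them on which the
iterates form a normal family. -/
def julia (f : ℂ → ℂ) : Set ℂ := {z | ¬ ∃ ε > 0, IteratesNormalOn f (Metric.ball z ε)}

/-! ### Hyperbolic dimension -/

/-- The radial part of `J`: the points with `liminf |fⁿ(z)| < ∞`. -/
def radial (f : ℂ → ℂ) (J : Set ℂ) : Set ℂ := {z ∈ J | liminf (fun n : ℕ => ‖f^[n] z‖ₑ) atTop < ⊤}

/-- The hyperbolic dimension of a model. -/
def Model.hypDim (m : Model) : ENNReal := dimH (radial m.toFun m.julia)

/-- The hyperbolic dimension of an entire function. -/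
def hypDim (f : ℂ → ℂ) : ENNReal := dimH (radial f (julia f))

end Tract

end

/-
In the coordinate `ξ = φ⁻¹(z)` on a tract, `f` is `R exp ξ`. The Hölder condition and Koebe
distortion control `φ'` at scale `T`. They bound the integral means from above and below, so that
the convex function `b_∞` is positive on `(0, 1)` and negative on `(1/α, ∞)`. Hence `Θ` is its only
zero in `(0, ∞)`, it lies in `[1, 1/α]`, and `b_∞` changes sign there.

For `t < Θ` the inequality `b_∞(t) > 0` means that, for some `ε > 0` and arbitrarily large `T`, the
integral of `|φ'(1 + iy)|ᵗ` over `T ≤ |y| ≤ 2T` is at least `T^ε |φ(T)|ᵗ`. Put `s = log |φ(T)|`. A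
level set of `φ'` on the line `Re ξ = 1` supplies `N` points `1 + iy_k` such that the branches
`η ↦ log φ(η + iy_k - log R)` map one disk around `s` into itself and contract distances at most by
a factor `a` with `N aᵗ ≥ 1`; moving the estimates from the line to the disk costs only a power of
`s`, which `T^ε` absorbs because `s = O(log T)`. The map `exp` conjugates these branches to inverse
branches of `f`. The image of the limit set under `exp` has dimension at least `t`, its points have
bounded orbits in `{|z| > 1}`, and the expansion of `f` along these orbits excludes normality.
-/

noncomputable section

namespace Tract

open Filter Topology Set Metric MeasureTheory

/-! ### Univalent functions -/

section Univalent

variable {f g : ℂ → ℂ} {U : Set ℂ} {z : ℂ}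

lemma nhds_le_map_nhds_of_injOn (hU : IsOpen U) (hf : DifferentiableOn ℂ f U) (hi : InjOn f U)
    (hz : z ∈ U) : 𝓝 (f z) ≤ map f (𝓝 z) := by
  refine (hf.analyticAt (hU.mem_nhds hz)).eventually_constant_or_nhds_le_map_nhds.resolve_left
    fun hconst => ?_
  have hpunctured : ∀ᶠ w in 𝓝[≠] z, f w = f z ∧ w ∈ U :=
    (hconst.and (hU.mem_nhds hz)).filter_mono nhdsWithin_le_nhds
  obtain ⟨w, ⟨hw, hwU⟩, hne⟩ := (hpunctured.and self_mem_nhdsWithin).exists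
  exact hne (hi hwU hz hw)

lemma isOpen_image_of_injOn (hU : IsOpen U) (hf : DifferentiableOn ℂ f U) (hi : InjOn f U) :
    IsOpen (f '' U) := by
  refine isOpen_iff_mem_nhds.2 ?_
  rintro _ ⟨z, hz, rfl⟩
  exact nhds_le_map_nhds_of_injOn hU hf hi hz (image_mem_map (hU.mem_nhds hz))

lemma eventually_deriv_ne_zero_of_injOn (hU : IsOpen U) (hf : DifferentiableOn ℂ f U)
    (hi : InjOn f U) (hz : z ∈ U) : ∀ᶠ w in 𝓝[≠] z, deriv f w ≠ 0 := by
  have hana := (hf.analyticAt (hU.mem_nhds hz)).deriv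
  refine hana.eventually_eq_zero_or_eventually_ne_zero.resolve_left fun hzero => ?_
  obtain ⟨ε, hε, hball⟩ := Metric.eventually_nhds_iff_ball.1 (hzero.and (hU.mem_nhds hz))
  have hw : z + (ε / 2 : ℝ) ∈ ball z ε := by simp [abs_of_pos hε, hε]
  have heq : f (z + (ε / 2 : ℝ)) = f z :=
    isOpen_ball.is_const_of_deriv_eq_zero (convex_ball z ε).isPreconnected
      (hf.mono fun x hx => (hball x hx).2) (fun x hx => (hball x hx).1) hw (mem_ball_self hε)
  have := hi (hball _ hw).2 hz heq
  simp [hε.ne'] at this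

lemma continuousAt_of_leftInvOn (hU : IsOpen U) (hf : DifferentiableOn ℂ f U)
    (hg : LeftInvOn g f U) (hz : z ∈ U) : ContinuousAt g (f z) := by
  rw [ContinuousAt, hg hz]
  intro W hW
  rw [mem_map]
  have himage : f '' (W ∩ U) ∈ 𝓝 (f z) := nhds_le_map_nhds_of_injOn hU hf hg.injOn hz
    (image_mem_map (inter_mem hW (hU.mem_nhds hz)))
  refine mem_of_superset himage ?_
  rintro _ ⟨w, ⟨hw, hwU⟩, rfl⟩
  rwa [mem_preimage, hg hwU]

/- Near a possible critical point the inverse is holomorphic off one point and continuous there, so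
the singularity is removable. -/
lemma differentiableAt_of_leftInvOn (hU : IsOpen U) (hf : DifferentiableOn ℂ f U)
    (hg : LeftInvOn g f U) (hz : z ∈ U) : DifferentiableAt ℂ g (f z) := by
  refine (Complex.analyticAt_of_differentiable_on_punctured_nhds_of_continuousAt ?_
    (continuousAt_of_leftInvOn hU hf hg hz)).differentiableAt
  have hnhds : ∀ᶠ w in 𝓝 z, w ∈ U ∧ (w ≠ z → deriv f w ≠ 0) :=
    (hU.eventually_mem hz).and
      (eventually_nhdsWithin_iff.1 (eventually_deriv_ne_zero_of_injOn hU hf hg.injOn hz))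
  rw [eventually_nhdsWithin_iff]
  filter_upwards [nhds_le_map_nhds_of_injOn hU hf hg.injOn hz (image_mem_map hnhds)]
  rintro _ ⟨w, ⟨hwU, hw⟩, rfl⟩ hne
  have hderiv : HasDerivAt f (deriv f w) (g (f w)) := by
    rw [hg hwU]
    exact (hf.differentiableAt (hU.mem_nhds hwU)).hasDerivAt
  refine (hderiv.of_local_left_inverse (continuousAt_of_leftInvOn hU hf hg hwU)
    (hw fun h => hne (congrArg f h)) ?_).differentiableAt
  filter_upwards [(isOpen_image_of_injOn hU hf hg.injOn).mem_nhds (mem_image_of_mem f hwU)]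
  rintro _ ⟨x, hx, rfl⟩
  rw [hg hx]

lemma differentiableOn_of_leftInvOn (hU : IsOpen U) (hf : DifferentiableOn ℂ f U)
    (hg : LeftInvOn g f U) : DifferentiableOn ℂ g (f '' U) := by
  rintro _ ⟨z, hz, rfl⟩
  exact (differentiableAt_of_leftInvOn hU hf hg hz).differentiableWithinAt

lemma deriv_mul_deriv_of_leftInvOn (hU : IsOpen U) (hf : DifferentiableOn ℂ f U)
    (hg : LeftInvOn g f U) (hz : z ∈ U) : deriv g (f z) * deriv f z = 1 := by
  have hcomp := (differentiableAt_of_leftInvOn hU hf hg hz).hasDerivAt.comp z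
    (hf.differentiableAt (hU.mem_nhds hz)).hasDerivAt
  refine hcomp.unique ((hasDerivAt_id z).congr_of_eventuallyEq ?_)
  filter_upwards [hU.mem_nhds hz] with w hw using hg hw

lemma deriv_ne_zero_of_injOn (hU : IsOpen U) (hf : DifferentiableOn ℂ f U) (hi : InjOn f U)
    (hz : z ∈ U) : deriv f z ≠ 0 :=
  right_ne_zero_of_mul_eq_one (deriv_mul_deriv_of_leftInvOn hU hf hi.leftInvOn_invFunOn hz)

lemma not_ball_subset_image_ball {c : ℂ} {r R : ℝ} (hr : 0 < r)
    (hf : DifferentiableOn ℂ f (ball c r)) (hi : InjOn f (ball c r)) (hR : ‖deriv f c‖ * r < R) :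
    ¬ ball (f c) R ⊆ f '' ball c r := by
  intro hsub
  have hc : c ∈ ball c r := mem_ball_self hr
  have hR0 : 0 < R := hR.trans_le' (by positivity)
  have hg := hi.leftInvOn_invFunOn
  set g := Function.invFunOn f (ball c r)
  have hmaps : MapsTo g (ball (f c) R) (closedBall (g (f c)) r) := by
    intro w hw
    obtain ⟨z, hz, rfl⟩ := hsub hw
    rw [hg hc, hg hz]
    exact ball_subset_closedBall hz
  have hschwarz : ‖deriv g (f c)‖ ≤ r / R := Complex.norm_deriv_le_div_of_mapsTo_ball
    ((differentiableOn_of_leftInvOn isOpen_ball hf hg).mono hsub) hmaps hR0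
  have hchain : ‖deriv g (f c)‖ * ‖deriv f c‖ = 1 := by
    rw [← norm_mul, deriv_mul_deriv_of_leftInvOn isOpen_ball hf hg hc, norm_one]
  rw [le_div_iff₀ hR0] at hschwarz
  nlinarith [norm_nonneg (deriv g (f c)), norm_nonneg (deriv f c)]

end Univalent

lemma exists_log_on_ball {F : ℂ → ℂ} {c : ℂ} {r : ℝ} (hr : 0 < r)
    (hF : DifferentiableOn ℂ F (ball c r)) (hF0 : ∀ z ∈ ball c r, F z ≠ 0) :
    ∃ l : ℂ → ℂ, l c = Complex.log (F c) ∧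
      ∀ z ∈ ball c r, HasDerivAt l (deriv F z / F z) z ∧ Complex.exp (l z) = F z := by
  have hc : c ∈ ball c r := mem_ball_self hr
  obtain ⟨l, hlc, hl⟩ := ((hF.deriv isOpen_ball).div hF hF0).isExactOn_ball.with_val_at c
    (Complex.log (F c))
  have hderiv : ∀ z ∈ ball c r, HasDerivAt (fun z => Complex.exp (l z) / F z) 0 z := by
    intro z hz
    have hquot := (hl z hz).cexp.div (hF.differentiableAt (isOpen_ball.mem_nhds hz)).hasDerivAt
      (hF0 z hz)
    have hcancel : (deriv F / F) z * F z = deriv F z := div_mul_cancel₀ _ (hF0 z hz)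
    rwa [mul_assoc, hcancel, sub_self, zero_div] at hquot
  refine ⟨l, hlc, fun z hz => ⟨hl z hz, ?_⟩⟩
  have hconst := isOpen_ball.is_const_of_deriv_eq_zero (convex_ball c r).isPreconnected
    (fun w hw => (hderiv w hw).differentiableAt.differentiableWithinAt)
    (fun w hw => (hderiv w hw).deriv) hz hc
  rwa [hlc, Complex.exp_log (hF0 c hc), div_self (hF0 c hc), div_eq_one_iff_eq (hF0 z hz)] at hconst

section WeakGrowth

variable {h k : ℂ → ℂ} {w z : ℂ}

lemma exists_omitted_value (hd : DifferentiableOn ℂ h (ball 0 1)) (hi : InjOn h (ball 0 1))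
    (h0 : h 0 = 0) (h1 : deriv h 0 = 1) :
    ∃ w, ‖w‖ < 2 ∧ w ∉ h '' ball 0 1 ∧ ball 0 ‖w‖ ⊆ h '' ball 0 1 := by
  have hnot : ¬ ball (h 0) 2 ⊆ h '' ball 0 1 :=
    not_ball_subset_image_ball one_pos hd hi (by rw [h1]; norm_num)
  rw [h0] at hnot
  obtain ⟨w₀, hw₀, hw₀'⟩ := not_subset.1 hnot
  have hclosed : IsClosed (h '' ball 0 1)ᶜ :=
    (isOpen_image_of_injOn isOpen_ball hd hi).isClosed_compl
  obtain ⟨w, hw, hmin⟩ := hclosed.exists_infDist_eq_dist ⟨w₀, hw₀'⟩ 0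
  rw [dist_zero_left] at hmin
  refine ⟨w, ?_, hw, fun v hv => ?_⟩
  · rw [← hmin]
    exact (infDist_le_dist_of_mem hw₀').trans_lt (mem_ball'.1 hw₀)
  · by_contra hv'
    have := infDist_le_dist_of_mem (x := (0 : ℂ)) (mem_compl hv')
    rw [dist_comm, hmin] at this
    exact (mem_ball.1 hv).not_ge this

lemma exists_sqrt_one_sub_div (hd : DifferentiableOn ℂ h (ball 0 1)) (h0 : h 0 = 0)
    (hw0 : w ≠ 0) (hw : w ∉ h '' ball 0 1) :
    ∃ k : ℂ → ℂ, DifferentiableOn ℂ k (ball 0 1) ∧ k 0 = 1 ∧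
      ∀ z ∈ ball (0 : ℂ) 1, h z = w * (1 - k z ^ 2) := by
  have hne : ∀ z ∈ ball (0 : ℂ) 1, 1 - h z / w ≠ 0 := by
    intro z hz hcon
    rw [sub_eq_zero, eq_div_iff hw0, one_mul] at hcon
    exact hw ⟨z, hz, hcon.symm⟩
  obtain ⟨l, hl0, hl⟩ := exists_log_on_ball one_pos ((hd.div_const w).const_sub 1) hne
  refine ⟨fun z => Complex.exp (l z / 2), fun z hz =>
    ((hl z hz).1.div_const 2).cexp.differentiableAt.differentiableWithinAt, by simp [hl0, h0],
    fun z hz => ?_⟩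
  rw [← Complex.exp_nat_mul, Nat.cast_ofNat, mul_div_cancel₀ _ two_ne_zero, (hl z hz).2]
  field_simp
  ring

/- On the preimage of the disk `ball 0 ‖w‖`, which is connected, `k` is the principal branch. -/
lemma re_sqrt_nonneg (hd : DifferentiableOn ℂ h (ball 0 1)) (hi : InjOn h (ball 0 1))
    (h0 : h 0 = 0) (hsub : ball 0 ‖w‖ ⊆ h '' ball 0 1) (hk : DifferentiableOn ℂ k (ball 0 1))
    (hk0 : k 0 = 1) (hkh : ∀ z ∈ ball (0 : ℂ) 1, h z = w * (1 - k z ^ 2)) (hz : z ∈ ball (0 : ℂ) 1)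
    (hhz : h z ∈ ball 0 ‖w‖) : 0 ≤ (k z).re := by
  have hwpos : 0 < ‖w‖ := (norm_nonneg _).trans_lt (mem_ball_zero_iff.1 hhz)
  have hw0 : w ≠ 0 := norm_pos_iff.1 hwpos
  have hg := hi.leftInvOn_invFunOn
  set g := Function.invFunOn h (ball 0 1)
  have hgmaps : MapsTo g (ball 0 ‖w‖) (ball 0 1) := by
    intro v hv
    obtain ⟨x, hx, rfl⟩ := hsub hv
    rwa [hg hx]
  have hgcont : ContinuousOn g (ball 0 ‖w‖) :=
    ((differentiableOn_of_leftInvOn isOpen_ball hd hg).mono hsub).continuousOn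
  have hg0 : g 0 = 0 := by
    have := hg (mem_ball_self one_pos)
    rwa [h0] at this
  have hslit : ∀ v ∈ ball (0 : ℂ) ‖w‖, 1 - v / w ∈ Complex.slitPlane := by
    intro v hv
    refine Complex.ball_one_subset_slitPlane ?_
    rwa [mem_ball, dist_self_sub_left, norm_div, div_lt_one hwpos, ← mem_ball_zero_iff]
  have hsqrt : EqOn (k ∘ g) (fun v => (1 - v / w) ^ (2⁻¹ : ℂ)) (ball 0 ‖w‖) := by
    refine (convex_ball 0 ‖w‖).isPreconnected.eq_of_sq_eq (hk.continuousOn.comp hgcont hgmaps)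
      (ContinuousOn.cpow (by fun_prop) continuousOn_const hslit) (fun v hv => ?_) (fun {v} hv => ?_)
      (mem_ball_self hwpos) (by simp [hg0, hk0])
    · obtain ⟨x, hx, rfl⟩ := hsub hv
      simp only [Pi.pow_apply, Function.comp_apply, hg hx, Complex.cpow_ofNat_inv_pow]
      rw [hkh x hx, mul_div_cancel_left₀ _ hw0, sub_sub_cancel]
    · exact (Complex.cpow_ne_zero_iff_of_exponent_ne_zero (by norm_num)).2
        (Complex.slitPlane_ne_zero (hslit v hv))
  have hkz : k z = (1 - h z / w) ^ (2⁻¹ : ℂ) := by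
    simpa only [Function.comp_apply, hg hz] using hsqrt hhz
  rw [hkz, Complex.cpow_inv_two_re]
  exact Real.sqrt_nonneg _

lemma two_fifths_le_norm_add_one_of_sqrt
    (hkh : ∀ z ∈ ball (0 : ℂ) 1, h z = w * (1 - k z ^ 2)) (hw0 : w ≠ 0)
    (hre : ∀ z ∈ ball (0 : ℂ) 1, h z ∈ ball 0 ‖w‖ → 0 ≤ (k z).re) (hz : z ∈ ball (0 : ℂ) 1) :
    2 / 5 ≤ ‖k z + 1‖ := by
  by_contra! hlt
  have hsmall : ‖1 - k z ^ 2‖ < 1 :=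
    calc ‖1 - k z ^ 2‖ = ‖k z + 1‖ * ‖2 - (k z + 1)‖ := by rw [← norm_mul]; ring_nf
      _ ≤ ‖k z + 1‖ * (2 + ‖k z + 1‖) := by
        gcongr
        exact (norm_sub_le _ _).trans_eq (by simp)
      _ < 1 := by nlinarith [norm_nonneg (k z + 1)]
  have hmem : h z ∈ ball 0 ‖w‖ := by
    rw [mem_ball_zero_iff, hkh z hz, norm_mul]
    exact mul_lt_of_lt_one_right (norm_pos_iff.2 hw0) hsmall
  have hle := Complex.re_le_norm (k z + 1)
  rw [Complex.add_re, Complex.one_re] at hle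
  linarith [hre z hz hmem]

lemma norm_cayley_le {a : ℂ} (ha : 2 / 5 ≤ ‖a + 1‖) : ‖(a - 1) / (a + 1)‖ ≤ 6 := by
  have hpos : 0 < ‖a + 1‖ := by linarith
  rw [norm_div, div_le_iff₀ hpos]
  calc ‖a - 1‖ = ‖(a + 1) - 2‖ := by ring_nf
    _ ≤ ‖a + 1‖ + 2 := (norm_sub_le _ _).trans_eq (by simp)
    _ ≤ 6 * ‖a + 1‖ := by linarith

/- With the Cayley transform `m = (k - 1) / (k + 1)` the relation `h = w (1 - k ^ 2)` reads
`h = -4 w m / (1 - m) ^ 2`, so that the Schwarz lemma for `m` bounds `h`. -/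
lemma norm_le_of_univalent (hd : DifferentiableOn ℂ h (ball 0 1)) (hi : InjOn h (ball 0 1))
    (h0 : h 0 = 0) (h1 : deriv h 0 = 1) (hz : ‖z‖ ≤ 1 / 12) : ‖h z‖ ≤ 16 := by
  obtain ⟨w, hw2, hw, hsub⟩ := exists_omitted_value hd hi h0 h1
  have hw0 : w ≠ 0 := fun hcon => hw ⟨0, mem_ball_self one_pos, h0.trans hcon.symm⟩
  obtain ⟨k, hk, hk0, hkh⟩ := exists_sqrt_one_sub_div hd h0 hw0 hw
  have homit : ∀ z ∈ ball (0 : ℂ) 1, 2 / 5 ≤ ‖k z + 1‖ := fun z hz =>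
    two_fifths_le_norm_add_one_of_sqrt hkh hw0
      (fun z hz => re_sqrt_nonneg hd hi h0 hsub hk hk0 hkh hz) hz
  have hne : ∀ z ∈ ball (0 : ℂ) 1, k z + 1 ≠ 0 := fun z hz =>
    norm_pos_iff.1 (by linarith [homit z hz])
  set m : ℂ → ℂ := fun z => (k z - 1) / (k z + 1) with hm
  have hmd : DifferentiableOn ℂ m (ball 0 1) := (hk.sub_const 1).div (hk.add_const 1) hne
  have hm0 : m 0 = 0 := by simp [hm, hk0]
  have hmaps : MapsTo m (ball 0 1) (closedBall (m 0) 6) := fun z hz => by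
    rw [hm0, mem_closedBall_zero_iff]
    exact norm_cayley_le (homit z hz)
  have hz1 : z ∈ ball (0 : ℂ) 1 := mem_ball_zero_iff.2 (by linarith)
  have hmz : ‖m z‖ ≤ 1 / 2 := by
    have := Complex.dist_le_div_mul_dist_of_mapsTo_ball hmd hmaps hz1
    rw [hm0, dist_zero_right, dist_zero_right] at this
    linarith
  have hform : h z * (1 - m z) ^ 2 = -4 * w * m z := by
    have := hne z hz1
    simp only [hm, hkh z hz1]
    field_simp
    ring
  have hlow : 1 / 2 ≤ ‖1 - m z‖ := by
    have := norm_sub_norm_le (1 : ℂ) (m z)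
    rw [norm_one] at this
    linarith
  have hquarter : ‖h z‖ * (1 / 4) ≤ 4 :=
    calc ‖h z‖ * (1 / 4) ≤ ‖h z‖ * ‖1 - m z‖ ^ 2 := by gcongr; nlinarith
      _ = 4 * ‖w‖ * ‖m z‖ := by
        rw [← norm_pow, ← norm_mul, hform, norm_mul, norm_mul, norm_neg, Complex.norm_ofNat]
      _ ≤ 4 * 2 * (1 / 2) := by gcongr
      _ = 4 := by norm_num
  linarith

end WeakGrowth

/-- The constant in `norm_deriv_deriv_le_of_injOn_ball`, where the sharp constant would be `4`. The
value `2! * 16 * 12 ^ 2` comes from Cauchy's estimate on the circle of radius `1 / 12`, on which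
normalized univalent functions are bounded by `16`. -/
def koebeConst : ℝ := 4608

lemma koebeConst_pos : 0 < koebeConst := by norm_num [koebeConst]

lemma norm_deriv_deriv_zero_le_of_univalent {h : ℂ → ℂ} (hd : DifferentiableOn ℂ h (ball 0 1))
    (hi : InjOn h (ball 0 1)) (h0 : h 0 = 0) (h1 : deriv h 0 = 1) :
    ‖deriv (deriv h) 0‖ ≤ koebeConst := by
  have hbound : ∀ z ∈ sphere (0 : ℂ) (1 / 12), ‖h z‖ ≤ 16 := fun z hz =>
    norm_le_of_univalent hd hi h0 h1 (mem_sphere_zero_iff_norm.1 hz).le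
  have hcauchy := Complex.norm_iteratedDeriv_le_of_forall_mem_sphere_norm_le 2 (by norm_num)
    ((hd.mono (closedBall_subset_ball (by norm_num))).diffContOnCl_ball Subset.rfl) hbound
  rw [iteratedDeriv_succ, iteratedDeriv_one] at hcauchy
  exact hcauchy.trans_eq (by norm_num [koebeConst, Nat.factorial])

lemma norm_deriv_deriv_le_of_injOn_ball {f : ℂ → ℂ} {c : ℂ} {r : ℝ} (hr : 0 < r)
    (hd : DifferentiableOn ℂ f (ball c r)) (hi : InjOn f (ball c r)) :
    ‖deriv (deriv f) c‖ * r ≤ koebeConst * ‖deriv f c‖ := by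
  have hc : c ∈ ball c r := mem_ball_self hr
  have hne := deriv_ne_zero_of_injOn isOpen_ball hd hi hc
  have hrc : (r : ℂ) ≠ 0 := Complex.ofReal_ne_zero.2 hr.ne'
  set A : ℂ := (r * deriv f c)⁻¹ with hA
  have hA0 : A ≠ 0 := inv_ne_zero (mul_ne_zero hrc hne)
  set h : ℂ → ℂ := fun z => A * (f (c + r * z) - f c) with hh
  have hmaps : ∀ z ∈ ball (0 : ℂ) 1, c + r * z ∈ ball c r := by
    intro z hz
    rw [mem_ball_zero_iff] at hz
    rw [mem_ball, dist_self_add_left, norm_mul, Complex.norm_of_nonneg hr.le]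
    exact mul_lt_of_lt_one_right hr hz
  have haffine : ∀ z, HasDerivAt (fun z : ℂ => c + r * z) r z := fun z => by
    simpa using ((hasDerivAt_id z).const_mul (r : ℂ)).const_add c
  have hderiv : ∀ z ∈ ball (0 : ℂ) 1, HasDerivAt h (A * (deriv f (c + r * z) * r)) z := fun z hz =>
    (((hd.differentiableAt (isOpen_ball.mem_nhds (hmaps z hz))).hasDerivAt.comp z
      (haffine z)).sub_const _).const_mul A
  have hinj : InjOn h (ball 0 1) := fun z hz z' hz' heq =>
    mul_left_cancel₀ hrc (add_left_cancel (hi (hmaps z hz) (hmaps z' hz')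
      (sub_left_injective (mul_left_cancel₀ hA0 heq))))
  have h1 : deriv h 0 = 1 := by
    rw [(hderiv 0 (mem_ball_self one_pos)).deriv, hA, mul_zero, add_zero]
    field_simp
  have h2 : deriv (deriv h) 0 = A * (deriv (deriv f) c * r * r) := by
    have heq : deriv h =ᶠ[𝓝 0] fun z => A * (deriv f (c + r * z) * r) := by
      filter_upwards [ball_mem_nhds 0 one_pos] with z hz using (hderiv z hz).deriv
    have hdd : HasDerivAt (deriv f) (deriv (deriv f) c) (c + r * 0) := by
      simpa using ((hd.deriv isOpen_ball).differentiableAt (isOpen_ball.mem_nhds hc)).hasDerivAt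
    rw [heq.deriv_eq]
    exact (((hdd.comp 0 (haffine 0)).mul_const _).const_mul A).deriv
  have hle : ‖A * (deriv (deriv f) c * r * r)‖ ≤ koebeConst := h2 ▸
    norm_deriv_deriv_zero_le_of_univalent
      (fun z hz => (hderiv z hz).differentiableAt.differentiableWithinAt) hinj (by simp [hh]) h1
  have hnorm : ‖A * (deriv (deriv f) c * r * r)‖ = ‖deriv (deriv f) c‖ * r / ‖deriv f c‖ := by
    simp only [hA, norm_mul, norm_inv, Complex.norm_of_nonneg hr.le]
    field_simp
  rwa [hnorm, div_le_iff₀ (norm_pos_iff.2 hne)] at hle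

/-! ### Distortion -/

section Distortion

variable {f : ℂ → ℂ} {U : Set ℂ} {z w : ℂ} {m : ℝ}

lemma norm_deriv_le_exp_of_curve {γ γ' : ℝ → ℂ} {K : ℝ} (hU : IsOpen U)
    (hd : DifferentiableOn ℂ f U) (hγ : ∀ u ∈ Icc (0 : ℝ) 1, HasDerivAt γ (γ' u) u)
    (hγU : ∀ u ∈ Icc (0 : ℝ) 1, γ u ∈ U)
    (hK : ∀ u ∈ Icc (0 : ℝ) 1, ‖deriv (deriv f) (γ u)‖ * ‖γ' u‖ ≤ K * ‖deriv f (γ u)‖) :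
    ‖deriv f (γ 1)‖ ≤ Real.exp K * ‖deriv f (γ 0)‖ := by
  have hderiv : ∀ u ∈ Icc (0 : ℝ) 1,
      HasDerivAt (fun u => deriv f (γ u)) (deriv (deriv f) (γ u) * γ' u) u := fun u hu =>
    ((hd.deriv hU).differentiableAt (hU.mem_nhds (hγU u hu))).hasDerivAt.comp_of_eq u (hγ u hu) rfl
  have hgronwall := norm_le_gronwallBound_of_norm_deriv_right_le (K := K) (ε := 0)
    (fun u hu => (hderiv u hu).continuousAt.continuousWithinAt)
    (fun u hu => (hderiv u (Ico_subset_Icc_self hu)).hasDerivWithinAt) le_rfl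
    (fun u hu => by
      rw [norm_mul, add_zero]
      exact hK u (Ico_subset_Icc_self hu)) 1 (right_mem_Icc.2 zero_le_one)
  rwa [gronwallBound_ε0, sub_zero, mul_one, mul_comm] at hgronwall

lemma norm_deriv_deriv_le_of_ball_subset (hd : DifferentiableOn ℂ f U) (hi : InjOn f U)
    (hm : 0 < m) (hz : ball z m ⊆ U) : ‖deriv (deriv f) z‖ ≤ koebeConst / m * ‖deriv f z‖ := by
  rw [div_mul_eq_mul_div, le_div_iff₀ hm]
  exact norm_deriv_deriv_le_of_injOn_ball hm (hd.mono hz) (hi.mono hz)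

lemma norm_deriv_le_exp_mul (hU : IsOpen U) (hd : DifferentiableOn ℂ f U) (hi : InjOn f U)
    (hm : 0 < m) (h : ∀ p ∈ segment ℝ z w, ball p m ⊆ U) :
    ‖deriv f w‖ ≤ Real.exp (koebeConst / m * ‖w - z‖) * ‖deriv f z‖ := by
  have hseg : ∀ u ∈ Icc (0 : ℝ) 1, z + u * (w - z) ∈ segment ℝ z w := by
    intro u hu
    rw [segment_eq_image']
    exact ⟨u, hu, by simp only [Complex.real_smul]⟩
  have hline : ∀ u : ℝ, HasDerivAt (fun u : ℝ => z + u * (w - z)) (w - z) u := fun u => by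
    simpa using ((Complex.ofRealCLM.hasDerivAt (x := u)).mul_const (w - z)).const_add z
  have := norm_deriv_le_exp_of_curve (K := koebeConst / m * ‖w - z‖) hU hd (fun u _ => hline u)
    (fun u hu => h _ (hseg u hu) (mem_ball_self hm)) (fun u hu => by
      rw [mul_right_comm]
      gcongr
      exact norm_deriv_deriv_le_of_ball_subset hd hi hm (h _ (hseg u hu)))
  simpa using this

end Distortion

section KoebeDisk

variable {f : ℂ → ℂ} {c z w : ℂ} {r : ℝ}

lemma ball_half_subset_ball (hr : 0 < r) (hz : z ∈ closedBall c (r / (8 * koebeConst))) :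
    ball z (r / 2) ⊆ ball c r := by
  have hsmall : r / (8 * koebeConst) ≤ r / 2 :=
    div_le_div_of_nonneg_left hr.le two_pos (by norm_num [koebeConst])
  exact ball_subset_ball' (by linarith [mem_closedBall.1 hz])

lemma norm_deriv_le_two_mul_of_injOn_ball (hr : 0 < r) (hd : DifferentiableOn ℂ f (ball c r))
    (hi : InjOn f (ball c r)) (hz : z ∈ closedBall c (r / (8 * koebeConst))) :
    ‖deriv f z‖ ≤ 2 * ‖deriv f c‖ := by
  have hK := koebeConst_pos
  have hcenter : c ∈ closedBall c (r / (8 * koebeConst)) := mem_closedBall_self (by positivity)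
  have hexponent : koebeConst / (r / 2) * ‖z - c‖ ≤ 1 / 4 := by
    rw [mem_closedBall, dist_eq_norm] at hz
    calc koebeConst / (r / 2) * ‖z - c‖ ≤ koebeConst / (r / 2) * (r / (8 * koebeConst)) := by gcongr
      _ = 1 / 4 := by field_simp; norm_num
  have hexp : Real.exp (1 / 4) ≤ 2 :=
    (Real.exp_bound_div_one_sub_of_interval (by norm_num) (by norm_num)).trans (by norm_num)
  calc ‖deriv f z‖ ≤ Real.exp (koebeConst / (r / 2) * ‖z - c‖) * ‖deriv f c‖ :=
        norm_deriv_le_exp_mul isOpen_ball hd hi (half_pos hr) fun q hq =>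
          ball_half_subset_ball hr ((convex_closedBall _ _).segment_subset hcenter hz hq)
    _ ≤ 2 * ‖deriv f c‖ := by
        gcongr
        exact (Real.exp_le_exp.2 hexponent).trans hexp

lemma norm_deriv_sub_le_of_injOn_ball (hr : 0 < r) (hd : DifferentiableOn ℂ f (ball c r))
    (hi : InjOn f (ball c r)) (hz : z ∈ closedBall c (r / (8 * koebeConst))) :
    ‖deriv f z - deriv f c‖ ≤ ‖deriv f c‖ / 2 := by
  have hK := koebeConst_pos
  have hmean := (convex_closedBall c (r / (8 * koebeConst))).norm_image_sub_le_of_norm_deriv_le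
    (f := deriv f) (C := koebeConst / (r / 2) * (2 * ‖deriv f c‖))
    (fun p hp => (hd.deriv isOpen_ball).differentiableAt
      (isOpen_ball.mem_nhds (ball_half_subset_ball hr hp (mem_ball_self (half_pos hr)))))
    (fun p hp => (norm_deriv_deriv_le_of_ball_subset hd hi (half_pos hr)
      (ball_half_subset_ball hr hp)).trans
        (by gcongr; exact norm_deriv_le_two_mul_of_injOn_ball hr hd hi hp))
    (mem_closedBall_self (by positivity)) hz
  rw [mem_closedBall, dist_eq_norm] at hz
  calc ‖deriv f z - deriv f c‖
      ≤ koebeConst / (r / 2) * (2 * ‖deriv f c‖) * ‖z - c‖ := hmean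
    _ ≤ koebeConst / (r / 2) * (2 * ‖deriv f c‖) * (r / (8 * koebeConst)) := by gcongr
    _ = ‖deriv f c‖ / 2 := by field_simp; ring

lemma norm_sub_sub_le_of_injOn_ball (hr : 0 < r) (hd : DifferentiableOn ℂ f (ball c r))
    (hi : InjOn f (ball c r)) (hz : z ∈ closedBall c (r / (8 * koebeConst)))
    (hw : w ∈ closedBall c (r / (8 * koebeConst))) :
    ‖f z - f w - deriv f c * (z - w)‖ ≤ ‖deriv f c‖ / 2 * ‖z - w‖ := by
  have hderiv : ∀ p ∈ closedBall c (r / (8 * koebeConst)),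
      HasDerivAt (fun z => f z - deriv f c * z) (deriv f p - deriv f c) p := by
    intro p hp
    have hpr := ball_half_subset_ball hr hp (mem_ball_self (half_pos hr))
    simpa only [mul_one] using (hd.differentiableAt (isOpen_ball.mem_nhds hpr)).hasDerivAt.fun_sub
      ((hasDerivAt_id' p).const_mul (deriv f c))
  have hmean := (convex_closedBall c _).norm_image_sub_le_of_norm_deriv_le
    (fun p hp => (hderiv p hp).differentiableAt) (C := ‖deriv f c‖ / 2)
    (fun p hp => by
      rw [(hderiv p hp).deriv]
      exact norm_deriv_sub_le_of_injOn_ball hr hd hi hp) hw hz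
  rwa [mul_sub, sub_sub_sub_comm]

lemma le_norm_sub_of_injOn_ball (hr : 0 < r) (hd : DifferentiableOn ℂ f (ball c r))
    (hi : InjOn f (ball c r)) (hz : z ∈ closedBall c (r / (8 * koebeConst)))
    (hw : w ∈ closedBall c (r / (8 * koebeConst))) :
    ‖deriv f c‖ / 2 * ‖z - w‖ ≤ ‖f z - f w‖ := by
  have hlinear := norm_sub_sub_le_of_injOn_ball hr hd hi hz hw
  have htriangle := norm_sub_norm_le (deriv f c * (z - w)) (f z - f w)
  rw [norm_sub_rev (deriv f c * (z - w)), norm_mul] at htriangle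
  linarith

lemma norm_sub_le_of_injOn_ball (hr : 0 < r) (hd : DifferentiableOn ℂ f (ball c r))
    (hi : InjOn f (ball c r)) (hz : z ∈ closedBall c (r / (8 * koebeConst)))
    (hw : w ∈ closedBall c (r / (8 * koebeConst))) :
    ‖f z - f w‖ ≤ 2 * ‖deriv f c‖ * ‖z - w‖ := by
  have hlinear := norm_sub_sub_le_of_injOn_ball hr hd hi hz hw
  have htriangle := norm_sub_norm_le (f z - f w) (deriv f c * (z - w))
  rw [norm_mul] at htriangle
  linarith [mul_nonneg (norm_nonneg (deriv f c)) (norm_nonneg (z - w))]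

end KoebeDisk

section HalfPlane

variable {f : ℂ → ℂ} {z w : ℂ} {m : ℝ}

lemma isOpen_halfPlane : IsOpen halfPlane := isOpen_lt continuous_const Complex.continuous_re

lemma ball_subset_halfPlane (hm : m ≤ z.re) : ball z m ⊆ halfPlane := by
  intro w hw
  have := (abs_lt.1 ((Complex.abs_re_le_norm (w - z)).trans_lt (mem_ball_iff_norm.1 hw))).1
  rw [Complex.sub_re] at this
  exact show 0 < w.re by linarith

lemma closedBall_subset_halfPlane (hm : m < z.re) : closedBall z m ⊆ halfPlane :=
  (closedBall_subset_ball hm).trans (ball_subset_halfPlane le_rfl)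

lemma norm_deriv_le_exp_mul_of_le_re (hd : DifferentiableOn ℂ f halfPlane)
    (hi : InjOn f halfPlane) (hm : 0 < m) (hz : m ≤ z.re) (hw : m ≤ w.re) :
    ‖deriv f w‖ ≤ Real.exp (koebeConst / m * ‖w - z‖) * ‖deriv f z‖ :=
  norm_deriv_le_exp_mul isOpen_halfPlane hd hi hm fun _ hp =>
    ball_subset_halfPlane ((convex_halfSpace_re_ge m).segment_subset hz hw hp)

/- The horizontal segment is parametrized geometrically, so that its speed is proportional to the
distance from the boundary of the half-plane. -/
lemma norm_deriv_le_exp_abs_log_mul (hd : DifferentiableOn ℂ f halfPlane)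
    (hi : InjOn f halfPlane) {x s : ℝ} (y : ℝ) (hx : 0 < x) (hs : 0 < s) :
    ‖deriv f (x + y * Complex.I)‖ ≤
      Real.exp (koebeConst * |Real.log (x / s)|) * ‖deriv f (s + y * Complex.I)‖ := by
  set l := Real.log (x / s) with hl
  have hpos : ∀ u : ℝ, 0 < s * Real.exp (u * l) := fun u => mul_pos hs (Real.exp_pos _)
  have hre : ∀ u : ℝ,
      (((s * Real.exp (u * l) : ℝ) : ℂ) + y * Complex.I).re = s * Real.exp (u * l) :=
    fun u => by simp [-Complex.ofReal_mul]
  have hcurve : ∀ u : ℝ, HasDerivAt (fun u : ℝ => ((s * Real.exp (u * l) : ℝ) : ℂ) + y * Complex.I)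
      ((s * (Real.exp (u * l) * l) : ℝ) : ℂ) u := by
    intro u
    have hexp : HasDerivAt (fun u : ℝ => s * Real.exp (u * l)) (s * (Real.exp (u * l) * l)) u := by
      simpa using (((hasDerivAt_id u).mul_const l).exp).const_mul s
    exact hexp.ofReal_comp.add_const _
  have key := norm_deriv_le_exp_of_curve (K := koebeConst * |l|) isOpen_halfPlane hd
    (fun u _ => hcurve u) (fun u _ => (hpos u).trans_eq (hre u).symm) (fun u _ => by
      have hsecond := norm_deriv_deriv_le_of_ball_subset hd hi (hpos u)
        (ball_subset_halfPlane (hre u).ge)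
      rw [Complex.norm_real, Real.norm_eq_abs, ← mul_assoc, abs_mul, abs_of_pos (hpos u)]
      calc _ ≤ koebeConst / (s * Real.exp (u * l)) *
            ‖deriv f (((s * Real.exp (u * l) : ℝ) : ℂ) + y * Complex.I)‖ *
            (s * Real.exp (u * l) * |l|) := by gcongr
        _ = _ := by field_simp)
  have hend : s * Real.exp (1 * l) = x := by
    rw [one_mul, hl, Real.exp_log (div_pos hx hs), mul_div_cancel₀ _ hs.ne']
  have hstart : s * Real.exp (0 * l) = s := by rw [zero_mul, Real.exp_zero, mul_one]
  simpa only [hend, hstart] using key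

end HalfPlane

/-! ### Hölder tracts -/

/-- The estimates on the conformal map `φ` of a Hölder tract from which the theorem is derived. They
are stated on `{Re ξ ≥ x}` instead of `ℋ`, which makes them independent of the level of the tract:
changing the level translates `φ`. -/
structure RegularTract (φ : ℂ → ℂ) (α x C T₁ : ℝ) : Prop where
  holo : DifferentiableOn ℂ φ halfPlane
  inj : InjOn φ halfPlane
  one_le_x : 1 ≤ x
  one_le_C : 1 ≤ C
  le_T₁ : 16 * x ≤ T₁
  tendsto : Tendsto (fun T : ℝ => ‖φ T‖) atTop atTop
  norm_pos : ∀ T ≥ T₁, 0 < ‖φ (T : ℂ)‖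
  osc : ∀ T ≥ T₁, ∀ ξ : ℂ, x ≤ ξ.re → ξ.re ≤ 3 * T → |ξ.im| ≤ 3 * T →
    (3 * T / 4 ≤ ξ.re ∨ 3 * T / 4 ≤ |ξ.im|) →
    ‖φ ξ‖ ≤ C * ‖φ (T : ℂ)‖ ∧ ‖φ (T : ℂ)‖ ≤ C * ‖φ ξ‖
  deriv_le : ∀ T ≥ T₁, ∀ y : ℝ, T ≤ |y| → |y| ≤ 2 * T →
    ‖deriv φ (x + y * Complex.I)‖ * T ^ α ≤ C * ‖φ (T : ℂ)‖
  le_deriv : ∀ T ≥ T₁, ‖φ (T : ℂ)‖ ≤ C * (T * ‖deriv φ (T : ℂ)‖)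

section Rect

variable {T : ℝ} {ξ c : ℂ}

lemma add_mem_rect (hT0 : 0 < T) (hT : 8 * ‖c‖ ≤ T) (hpos : 0 < (ξ + c).re) (hre : ξ.re ≤ 3 * T)
    (him : |ξ.im| ≤ 3 * T) : ξ + c ∈ rect T := by
  have hcre := abs_le.1 (Complex.abs_re_le_norm c)
  have hcim := abs_le.1 (Complex.abs_im_le_norm c)
  rw [abs_le] at him
  refine ⟨hpos, ?_, ?_, ?_⟩ <;> simp only [Complex.add_re, Complex.add_im] <;> linarith

lemma add_mem_rect_diff (hT0 : 0 < T) (hT : 8 * ‖c‖ ≤ T) (hpos : 0 < (ξ + c).re)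
    (hre : ξ.re ≤ 3 * T) (him : |ξ.im| ≤ 3 * T) (hfar : 3 * T / 4 ≤ ξ.re ∨ 3 * T / 4 ≤ |ξ.im|) :
    ξ + c ∈ rect T \ rect (T / 8) := by
  refine ⟨add_mem_rect hT0 hT hpos hre him, ?_⟩
  rintro ⟨-, hlt, hbot, htop⟩
  have hcre := abs_le.1 (Complex.abs_re_le_norm c)
  have hcim := abs_le.1 (Complex.abs_im_le_norm c)
  rw [Complex.add_re] at hlt
  rw [Complex.add_im] at hbot htop
  rcases hfar with hfar | hfar
  · linarith
  · rcases le_abs.1 hfar with hfar | hfar <;> linarith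

lemma ofReal_add_mem_rect_diff (hT0 : 0 < T) (hT : 8 * ‖c‖ ≤ T) :
    (T : ℂ) + c ∈ rect T \ rect (T / 8) := by
  have hcre := (abs_le.1 (Complex.abs_re_le_norm c)).1
  refine add_mem_rect_diff hT0 hT ?_ ?_ ?_ (Or.inl ?_) <;>
    simp only [Complex.add_re, Complex.ofReal_re, Complex.ofReal_im, abs_zero] <;> linarith

lemma closedBall_subset_rect_diff (hT0 : 0 < T) :
    closedBall (T : ℂ) (T / 4) ⊆ rect T \ rect (T / 8) := by
  intro ζ hζ
  rw [mem_closedBall_iff_norm] at hζ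
  have hre := abs_le.1 ((Complex.abs_re_le_norm _).trans hζ)
  have him := (Complex.abs_im_le_norm _).trans hζ
  simp only [Complex.sub_re, Complex.sub_im, Complex.ofReal_re, Complex.ofReal_im, sub_zero]
    at hre him
  rw [← add_zero ζ]
  refine add_mem_rect_diff hT0 (by simpa using hT0.le) ?_ ?_ ?_ (Or.inl ?_) <;>
    try rw [add_zero]
  all_goals linarith

end Rect

section HolderTract

variable {φ ψ : ℂ → ℂ} {T α H M : ℝ} {ξ ξ₁ ξ₂ c : ℂ}

lemma IsHolderOnRect.norm_sub_le (hT : 0 < T)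
    (h : IsHolderOnRect H α (fun z => ψ ((T : ℂ) * z))) (h₁ : ξ₁ ∈ rect T) (h₂ : ξ₂ ∈ rect T) :
    ‖ψ ξ₁ - ψ ξ₂‖ ≤ H * (T * ‖deriv ψ T‖) * (‖ξ₁ - ξ₂‖ / T) ^ α := by
  have hTc : (T : ℂ) ≠ 0 := Complex.ofReal_ne_zero.2 hT.ne'
  have hmem : ∀ ξ ∈ rect T, ξ / T ∈ rect 1 := by
    rintro ξ ⟨hpos, hlt, hbot, htop⟩
    simp only [rect, mem_ofPred_eq, Complex.div_ofReal_re, Complex.div_ofReal_im]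
    refine ⟨div_pos hpos hT, ?_, ?_, ?_⟩
    · exact (div_lt_iff₀ hT).2 (by linarith)
    · exact (lt_div_iff₀ hT).2 (by linarith)
    · exact (div_lt_iff₀ hT).2 (by linarith)
  have hscaled := h _ (hmem _ h₁) _ (hmem _ h₂)
  rw [deriv_comp_mul_left] at hscaled
  simpa only [mul_div_cancel₀ _ hTc, mul_one, smul_eq_mul, norm_mul, Complex.norm_real,
    Real.norm_eq_abs, abs_of_pos hT, ← sub_div, norm_div] using hscaled

lemma mul_norm_deriv_le_of_osc (hT : 0 < T) (hψ : DifferentiableOn ℂ ψ halfPlane)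
    (hosc : ∀ ξ ∈ rect T \ rect (T / 8), ‖ψ ξ‖ ≤ M) : T * ‖deriv ψ T‖ ≤ 4 * M := by
  have hcauchy := Complex.norm_deriv_le_of_forall_mem_sphere_norm_le (by linarith : 0 < T / 4)
    ((hψ.mono (closedBall_subset_halfPlane (by rw [Complex.ofReal_re]; linarith))).diffContOnCl_ball
      Subset.rfl)
    (fun ζ hζ => hosc ζ (closedBall_subset_rect_diff hT (sphere_subset_closedBall hζ)))
  rw [le_div_iff₀ (by linarith)] at hcauchy
  linarith

lemma norm_deriv_mul_rpow_le (hT : 0 < T) (hφ : DifferentiableOn ℂ φ (closedBall ξ 1))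
    (hholder : ∀ ζ ∈ sphere ξ 1, ‖φ ζ - φ ξ‖ ≤ M * (‖ζ - ξ‖ / T) ^ α) :
    ‖deriv φ ξ‖ * T ^ α ≤ M := by
  have hcauchy := Complex.norm_deriv_le_of_forall_mem_sphere_norm_le one_pos
    ((hφ.sub_const (φ ξ)).diffContOnCl_ball Subset.rfl) (C := M * (1 / T) ^ α)
    (fun ζ hζ => by simpa only [mem_sphere_iff_norm.1 hζ] using hholder ζ hζ)
  rw [deriv_sub_const, div_one] at hcauchy
  calc ‖deriv φ ξ‖ * T ^ α ≤ M * (1 / T) ^ α * T ^ α := by gcongr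
    _ = M := by
      rw [mul_assoc, ← Real.mul_rpow (by positivity) hT.le, one_div_mul_cancel hT.ne',
        Real.one_rpow, mul_one]

/- Compare the values at `T + c` and `1`: the former dominates by assumption. -/
lemma IsHolderOnRect.norm_le_mul_deriv (hα : 0 < α) (hα1 : α ≤ 1) (hH : 0 ≤ H) (hT1 : 1 ≤ T)
    (hT : 8 * ‖c‖ ≤ T) (h : IsHolderOnRect H α (fun z => ψ ((T : ℂ) * z)))
    (hlarge : 2 * ‖ψ 1‖ ≤ ‖ψ (T + c)‖) : ‖ψ (T + c)‖ ≤ 6 * H * (T * ‖deriv ψ T‖) := by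
  have hT0 : 0 < T := by linarith
  have hone : (1 : ℂ) ∈ rect T := by refine ⟨?_, ?_, ?_, ?_⟩ <;> norm_num <;> linarith
  have hratio : ‖(T : ℂ) + c - 1‖ / T ≤ 3 := by
    rw [div_le_iff₀ hT0]
    calc ‖(T : ℂ) + c - 1‖ ≤ ‖(T : ℂ)‖ + ‖c‖ + ‖(1 : ℂ)‖ :=
          (_root_.norm_sub_le _ _).trans (by gcongr; exact norm_add_le _ _)
      _ ≤ 3 * T := by rw [Complex.norm_of_nonneg hT0.le, norm_one]; linarith
  have hpow : (‖(T : ℂ) + c - 1‖ / T) ^ α ≤ 3 :=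
    calc (‖(T : ℂ) + c - 1‖ / T) ^ α ≤ (3 : ℝ) ^ α :=
          Real.rpow_le_rpow (by positivity) hratio hα.le
      _ ≤ 3 ^ (1 : ℝ) := Real.rpow_le_rpow_of_exponent_le (by norm_num) hα1
      _ = 3 := Real.rpow_one 3
  have hholder := h.norm_sub_le hT0 (ofReal_add_mem_rect_diff hT0 hT).1 hone
  have hle : H * (T * ‖deriv ψ T‖) * (‖(T : ℂ) + c - 1‖ / T) ^ α ≤ H * (T * ‖deriv ψ T‖) * 3 := by
    gcongr
  have htriangle := norm_sub_norm_le (ψ (T + c)) (ψ 1)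
  linarith

lemma IsHolderOnRect.mono {H' : ℝ} (hH : H ≤ H') (h : IsHolderOnRect H α φ) :
    IsHolderOnRect H' α φ := fun z₁ h₁ z₂ h₂ => (h z₁ h₁ z₂ h₂).trans (by gcongr)

lemma deriv_eq_deriv_sub_of_shift {x₀ : ℝ} (heq : ∀ ξ : ℂ, x₀ ≤ ξ.re → φ ξ = ψ (ξ + c))
    (hξ : x₀ < (ξ - c).re) : deriv ψ ξ = deriv φ (ξ - c) := by
  have hnear : φ =ᶠ[𝓝 (ξ - c)] fun ζ => ψ (ζ + c) := by
    filter_upwards [(isOpen_lt continuous_const Complex.continuous_re).mem_nhds hξ]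
      with ζ hζ using heq ζ (le_of_lt hζ)
  rw [hnear.deriv_eq, deriv_comp_add_const, sub_add_cancel]

end HolderTract

section Shift

variable {φ ψ : ℂ → ℂ} {T α H M x₀ : ℝ} {ξ₁ ξ₂ c : ℂ}

lemma norm_sub_le_of_shift (hψ : DifferentiableOn ℂ ψ halfPlane) (hH : 0 ≤ H)
    (hpos : ∀ ξ : ℂ, x₀ ≤ ξ.re → 0 < (ξ + c).re) (heq : ∀ ξ : ℂ, x₀ ≤ ξ.re → φ ξ = ψ (ξ + c))
    (hosc : ∀ ξ ∈ rect T \ rect (T / 8), ‖ψ ξ‖ ≤ M * ‖φ T‖)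
    (hhol : IsHolderOnRect H α (fun z => ψ ((T : ℂ) * z))) (hT : 0 < T) (hTc : 8 * ‖c‖ ≤ T)
    (hre₁ : x₀ ≤ ξ₁.re) (hre₂ : x₀ ≤ ξ₂.re) (hre₁' : ξ₁.re ≤ 3 * T) (hre₂' : ξ₂.re ≤ 3 * T)
    (him₁ : |ξ₁.im| ≤ 3 * T) (him₂ : |ξ₂.im| ≤ 3 * T) :
    ‖φ ξ₁ - φ ξ₂‖ ≤ H * (4 * (M * ‖φ T‖)) * (‖ξ₁ - ξ₂‖ / T) ^ α := by
  have hholder := hhol.norm_sub_le hT (add_mem_rect hT hTc (hpos ξ₁ hre₁) hre₁' him₁)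
    (add_mem_rect hT hTc (hpos ξ₂ hre₂) hre₂' him₂)
  rw [← heq _ hre₁, ← heq _ hre₂, add_sub_add_right_eq_sub] at hholder
  exact hholder.trans <| mul_le_mul_of_nonneg_right
    (mul_le_mul_of_nonneg_left (mul_norm_deriv_le_of_osc hT hψ hosc) hH) (by positivity)

lemma norm_deriv_mul_rpow_le_of_shift {x y : ℝ} (hφ : DifferentiableOn ℂ φ halfPlane)
    (hψ : DifferentiableOn ℂ ψ halfPlane) (hH : 0 ≤ H)
    (hpos : ∀ ξ : ℂ, x₀ ≤ ξ.re → 0 < (ξ + c).re) (heq : ∀ ξ : ℂ, x₀ ≤ ξ.re → φ ξ = ψ (ξ + c))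
    (hosc : ∀ ξ ∈ rect T \ rect (T / 8), ‖ψ ξ‖ ≤ M * ‖φ T‖)
    (hhol : IsHolderOnRect H α (fun z => ψ ((T : ℂ) * z))) (hT : 1 ≤ T) (hTc : 8 * ‖c‖ ≤ T)
    (hx₀ : x₀ + 1 ≤ x) (hx : 1 < x) (hxT : x + 1 ≤ 3 * T) (hy : |y| ≤ 2 * T) :
    ‖deriv φ (x + y * Complex.I)‖ * T ^ α ≤ H * (4 * (M * ‖φ T‖)) := by
  have hT0 : 0 < T := by linarith
  set ξ : ℂ := x + y * Complex.I with hξ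
  have hre : ξ.re = x := by simp [hξ]
  have him : ξ.im = y := by simp [hξ]
  refine norm_deriv_mul_rpow_le hT0 (hφ.mono (closedBall_subset_halfPlane (hx.trans_eq hre.symm)))
    fun ζ hζ => ?_
  have hζre := abs_le.1 ((Complex.abs_re_le_norm (ζ - ξ)).trans_eq (mem_sphere_iff_norm.1 hζ))
  have hζim := (Complex.abs_im_le_norm (ζ - ξ)).trans_eq (mem_sphere_iff_norm.1 hζ)
  rw [Complex.sub_re, hre] at hζre
  rw [Complex.sub_im, him] at hζim
  have hξim : |ξ.im| ≤ 2 * T := him ▸ hy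
  have := abs_sub_abs_le_abs_sub ζ.im y
  apply norm_sub_le_of_shift hψ hH hpos heq hosc hhol hT0 hTc <;> linarith

lemma norm_le_mul_deriv_of_shift (hφ : DifferentiableOn ℂ φ halfPlane) (hφi : InjOn φ halfPlane)
    (hα : 0 < α) (hα1 : α ≤ 1) (hH : 0 ≤ H) (heq : ∀ ξ : ℂ, x₀ ≤ ξ.re → φ ξ = ψ (ξ + c))
    (hhol : IsHolderOnRect H α (fun z => ψ ((T : ℂ) * z))) (hlarge : 2 * ‖ψ 1‖ ≤ ‖φ T‖)
    (hx₀ : 0 ≤ x₀) (hT : x₀ + 1 + 8 * ‖c‖ ≤ T) :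
    ‖φ T‖ ≤ 6 * H * Real.exp (koebeConst / 1 * ‖c‖) * (T * ‖deriv φ T‖) := by
  have hc := norm_nonneg c
  have hcre := (abs_le.1 (Complex.abs_re_le_norm c)).2
  have hre : ((T : ℂ) - c).re = T - c.re := rfl
  have hTre : (T : ℂ).re = T := Complex.ofReal_re T
  have hvalue : φ T = ψ (T + c) := heq T (by linarith)
  have hderiv : deriv ψ T = deriv φ (T - c) := deriv_eq_deriv_sub_of_shift heq (by linarith)
  have hdistortion : ‖deriv φ (T - c)‖ ≤ Real.exp (koebeConst / 1 * ‖c‖) * ‖deriv φ T‖ := by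
    simpa only [sub_sub_cancel_left, norm_neg] using norm_deriv_le_exp_mul_of_le_re hφ hφi one_pos
      (z := (T : ℂ)) (w := T - c) (by linarith) (by linarith)
  calc ‖φ T‖ ≤ 6 * H * (T * ‖deriv ψ T‖) := by
        rw [hvalue] at hlarge ⊢
        exact hhol.norm_le_mul_deriv hα hα1 hH (by linarith) (by linarith) hlarge
    _ ≤ 6 * H * (T * (Real.exp (koebeConst / 1 * ‖c‖) * ‖deriv φ T‖)) := by
        rw [hderiv]
        have : 0 ≤ T := by linarith
        gcongr
    _ = _ := by ring

lemma norm_le_mul_norm_of_shift (heq : ∀ ξ : ℂ, x₀ ≤ ξ.re → φ ξ = ψ (ξ + c))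
    (hosc : ∀ ξ ∈ rect T \ rect (T / 8), ∀ ξ' ∈ rect T \ rect (T / 8), ‖ψ ξ‖ ≤ M * ‖ψ ξ'‖)
    (hT0 : 0 < T) (hTc : 8 * ‖c‖ ≤ T) (hx₀ : x₀ ≤ T) {ξ : ℂ} (hξ : ξ ∈ rect T \ rect (T / 8)) :
    ‖ψ ξ‖ ≤ M * ‖φ T‖ ∧ ‖φ T‖ ≤ M * ‖ψ ξ‖ := by
  have hT := ofReal_add_mem_rect_diff hT0 hTc
  rw [heq T hx₀]
  exact ⟨hosc _ hξ _ hT, hosc _ hT _ hξ⟩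

lemma exists_regularTract (hα : 0 < α) (hα1 : α ≤ 1) (hφ : DifferentiableOn ℂ φ halfPlane)
    (hφi : InjOn φ halfPlane) (hψ : DifferentiableOn ℂ ψ halfPlane)
    (htend : Tendsto (fun T : ℝ => ‖φ T‖) atTop atTop) (hx₀ : 0 ≤ x₀)
    (hpos : ∀ ξ : ℂ, x₀ ≤ ξ.re → 0 < (ξ + c).re)
    (heq : ∀ ξ : ℂ, x₀ ≤ ξ.re → φ ξ = ψ (ξ + c)) (hH : IsHolderTract H α ψ) :
    ∃ x C T₁, RegularTract φ α x C T₁ := by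
  obtain ⟨⟨M, -, T₂, -, hosc⟩, T₀, -, hhol⟩ := hH
  obtain ⟨H₁, hHH₁, hH₁⟩ : ∃ H₁, H ≤ H₁ ∧ 0 ≤ H₁ := ⟨max H 0, le_max_left _ _, le_max_right _ _⟩
  obtain ⟨C, ⟨hC1, hCM⟩, hCH, hCexp⟩ : ∃ C, (1 ≤ C ∧ M ≤ C) ∧ H₁ * (4 * M) ≤ C ∧
      6 * H₁ * Real.exp (koebeConst / 1 * ‖c‖) ≤ C := by
    simpa only [max_le_iff] using (⟨_, le_rfl⟩ : ∃ C, max (max 1 M)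
      (max (H₁ * (4 * M)) (6 * H₁ * Real.exp (koebeConst / 1 * ‖c‖))) ≤ C)
  have hlarge := (eventually_ge_atTop T₀).and <| (eventually_ge_atTop T₂).and <|
    (eventually_ge_atTop (16 * (x₀ + 2) + 8 * ‖c‖)).and <|
    htend.eventually_ge_atTop (2 * ‖ψ 1‖ + 1)
  obtain ⟨T₁, hT₁⟩ := eventually_atTop.1 hlarge
  have hc := norm_nonneg c
  have hcomp : ∀ T ≥ T₁, ∀ ξ ∈ rect T \ rect (T / 8), ‖ψ ξ‖ ≤ M * ‖φ T‖ ∧ ‖φ T‖ ≤ M * ‖ψ ξ‖ := by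
    intro T hT ξ hξ
    obtain ⟨-, hT₂, hTx, -⟩ := hT₁ T hT
    exact norm_le_mul_norm_of_shift heq (hosc T hT₂) (by linarith) (by linarith) (by linarith) hξ
  refine ⟨x₀ + 2, C, T₁, ⟨hφ, hφi, by linarith, hC1, ?_, htend, fun T hT => ?_,
    fun T hT ξ hx hre him hfar => ?_, fun T hT y _ hy => ?_, fun T hT => ?_⟩⟩
  · linarith [(hT₁ T₁ le_rfl).2.2.1]
  · linarith [(hT₁ T hT).2.2.2, norm_nonneg (ψ 1)]
  · obtain ⟨-, -, hTx, -⟩ := hT₁ T hT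
    obtain ⟨hle, hge⟩ := hcomp T hT _ <|
      add_mem_rect_diff (by linarith) (by linarith) (hpos ξ (by linarith)) hre him hfar
    rw [heq ξ (by linarith)]
    exact ⟨hle.trans (by gcongr), hge.trans (by gcongr)⟩
  · obtain ⟨hT₀, -, hTx, -⟩ := hT₁ T hT
    calc _ ≤ H₁ * (4 * (M * ‖φ T‖)) := by
          refine norm_deriv_mul_rpow_le_of_shift hφ hψ hH₁ hpos heq
            (fun ξ hξ => (hcomp T hT ξ hξ).1) ((hhol T hT₀).mono hHH₁) ?_ ?_ ?_ ?_ ?_ hy <;>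
            linarith
      _ = H₁ * (4 * M) * ‖φ T‖ := by ring
      _ ≤ C * ‖φ T‖ := by gcongr
  · obtain ⟨hT₀, -, hTx, hTφ⟩ := hT₁ T hT
    refine (norm_le_mul_deriv_of_shift hφ hφi hα hα1 hH₁ heq ((hhol T hT₀).mono hHH₁)
      (by linarith) hx₀ (by linarith)).trans ?_
    have : 0 ≤ T := by linarith
    gcongr

end Shift

/-! ### The images of horizontal and vertical segments -/

section Square

variable {k : ℂ → ℂ} {u c : ℂ} {a B l : ℝ}

/-- The square `{|Re u| ≤ a, |Im u| ≤ a}`, on which the two constants theorem is used. -/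
def square (a : ℝ) : Set ℂ := Icc (-a) a ×ℂ Icc (-a) a

lemma I_mul_mem_square (hu : u ∈ square a) : Complex.I * u ∈ square a := by
  obtain ⟨hre, him⟩ := hu
  constructor
  · simpa [and_comm, neg_le] using him
  · simpa using hre

lemma I_pow_mul_mem_square (hu : u ∈ square a) (j : ℕ) : Complex.I ^ j * u ∈ square a := by
  induction j with
  | zero => rwa [pow_zero, one_mul]
  | succ j ih =>
    rw [pow_succ', mul_assoc]
    exact I_mul_mem_square ih

lemma zero_mem_square (ha : 0 ≤ a) : (0 : ℂ) ∈ square a := by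
  constructor <;> exact ⟨neg_nonpos.2 ha, ha⟩

lemma closure_interior_square (ha : 0 < a) : closure (Ioo (-a) a ×ℂ Ioo (-a) a) = square a := by
  rw [Complex.closure_reProdIm, closure_Ioo (by linarith), square]

lemma exists_re_I_pow_mul_eq (hu : u ∈ square a) (hu' : u ∉ Ioo (-a) a ×ℂ Ioo (-a) a) :
    ∃ j ∈ Finset.range 4, (Complex.I ^ j * u).re = -a := by
  obtain ⟨⟨hleft, hright⟩, hbot, htop⟩ := hu
  by_contra! hne
  have h₀ := hne 0 (by decide)
  have h₁ := hne 1 (by decide)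
  have h₂ := hne 2 (by decide)
  have h₃ := hne 3 (by decide)
  simp only [pow_zero, one_mul, pow_one, Complex.I_sq, Complex.I_pow_three, Complex.I_mul_re,
    neg_mul, Complex.neg_re, neg_neg, ne_eq, neg_inj] at h₀ h₁ h₂ h₃
  exact hu' ⟨⟨lt_of_le_of_ne hleft (Ne.symm h₀), lt_of_le_of_ne hright h₂⟩,
    ⟨lt_of_le_of_ne hbot (Ne.symm h₃), lt_of_le_of_ne htop h₁⟩⟩

lemma prod_range_le_mul_pow {p : ℕ → ℝ} {n j : ℕ} (hj : j ∈ Finset.range (n + 1))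
    (hp : ∀ i, 0 ≤ p i) (hB : ∀ i, p i ≤ B) (hl : p j ≤ l) :
    ∏ i ∈ Finset.range (n + 1), p i ≤ l * B ^ n := by
  rw [← Finset.mul_prod_erase _ _ hj]
  refine mul_le_mul hl ?_ (Finset.prod_nonneg fun i _ => hp i) ((hp j).trans hl)
  calc ∏ i ∈ (Finset.range (n + 1)).erase j, p i
      ≤ ∏ _i ∈ (Finset.range (n + 1)).erase j, B :=
        Finset.prod_le_prod (fun i _ => hp i) fun i _ => hB i
    _ = B ^ n := by
        rw [Finset.prod_const, Finset.card_erase_of_mem hj, Finset.card_range, Nat.add_sub_cancel]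

/- A two constants theorem for a function that is small on one side of a square. The maximum
principle is applied to the product of the function and its three rotations. -/
lemma norm_pow_four_le_of_square (ha : 0 < a)
    (hd : ∀ u ∈ square a, DifferentiableAt ℂ k (c + u))
    (hB : ∀ u ∈ square a, ‖k (c + u)‖ ≤ B)
    (hl : ∀ u ∈ square a, u.re = -a → ‖k (c + u)‖ ≤ l) : ‖k c‖ ^ 4 ≤ l * B ^ 3 := by
  set U : Set ℂ := Ioo (-a) a ×ℂ Ioo (-a) a
  set P : ℂ → ℂ := fun u => ∏ j ∈ Finset.range 4, k (c + Complex.I ^ j * u) with hP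
  have hUo : IsOpen U := isOpen_Ioo.reProdIm isOpen_Ioo
  have hUcl : closure U = square a := closure_interior_square ha
  have hPd : ∀ u ∈ closure U, DifferentiableAt ℂ P u := fun u hu =>
    DifferentiableAt.fun_finsetProd fun j _ =>
      (hd _ (I_pow_mul_mem_square (hUcl ▸ hu) j)).comp u (by fun_prop)
  have hPc : DiffContOnCl ℂ P U :=
    ⟨fun u hu => (hPd u (subset_closure hu)).differentiableWithinAt,
      fun u hu => (hPd u hu).continuousAt.continuousWithinAt⟩
  have hfrontier : ∀ u ∈ frontier U, ‖P u‖ ≤ l * B ^ 3 := by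
    intro u hu
    rw [hUo.frontier_eq, hUcl] at hu
    obtain ⟨j, hj, hjre⟩ := exists_re_I_pow_mul_eq hu.1 hu.2
    have hmem := I_pow_mul_mem_square hu.1
    rw [hP, norm_prod]
    exact prod_range_le_mul_pow hj (fun _ => norm_nonneg _) (fun i => hB _ (hmem i))
      (hl _ (hmem j) hjre)
  have hcenter := Complex.norm_le_of_forall_mem_frontier_norm_le
    ((isBounded_Ioo _ _).reProdIm (isBounded_Ioo _ _)) hPc hfrontier
    (hUcl ▸ zero_mem_square ha.le : (0 : ℂ) ∈ closure U)
  simpa only [hP, mul_zero, add_zero, Finset.prod_const, Finset.card_range, norm_pow] using hcenter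

end Square

section Line

variable {φ : ℂ → ℂ} {r a b : ℝ}

lemma line_mem_halfPlane (hr : 0 < r) (y : ℝ) : (r + y * Complex.I : ℂ) ∈ halfPlane := by
  simpa [halfPlane] using hr

lemma continuous_deriv_line (hφ : DifferentiableOn ℂ φ halfPlane) (hr : 0 < r) :
    Continuous fun y : ℝ => deriv φ (r + y * Complex.I) :=
  (hφ.deriv isOpen_halfPlane).continuousOn.comp_continuous (by fun_prop) (line_mem_halfPlane hr)

lemma norm_sub_le_integral_line (hφ : DifferentiableOn ℂ φ halfPlane) (hr : 0 < r) (hab : a ≤ b) :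
    ‖φ (r + b * Complex.I) - φ (r + a * Complex.I)‖ ≤
      ∫ y in a..b, ‖deriv φ (r + y * Complex.I)‖ := by
  have hline : ∀ y : ℝ, HasDerivAt (fun y : ℝ => (r + y * Complex.I : ℂ)) Complex.I y := fun y => by
    simpa only [one_mul, Complex.ofRealCLM_apply, Complex.ofReal_one] using
      ((Complex.ofRealCLM.hasDerivAt (x := y)).mul_const Complex.I).const_add (r : ℂ)
  have hder : ∀ y ∈ uIcc a b, HasDerivAt (fun y : ℝ => φ (r + y * Complex.I))
      (deriv φ (r + y * Complex.I) * Complex.I) y := fun y _ =>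
    (hφ.differentiableAt (isOpen_halfPlane.mem_nhds
      (line_mem_halfPlane hr y))).hasDerivAt.comp_of_eq y (hline y) rfl
  rw [← intervalIntegral.integral_eq_sub_of_hasDerivAt (E := ℂ) hder
    (((continuous_deriv_line hφ hr).mul continuous_const).intervalIntegrable a b)]
  refine (intervalIntegral.norm_integral_le_integral_norm hab).trans_eq ?_
  simp only [norm_mul, Complex.norm_I, mul_one]

end Line

namespace RegularTract

variable {φ : ℂ → ℂ} {α x C T₁ T s : ℝ} {ξ ζ : ℂ}

lemma norm_shift_sub_le (h : RegularTract φ α x C T₁) (hT : T₁ ≤ T) (hs : 0 ≤ s)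
    (hsT : s ≤ T / 2) (hx : x ≤ ζ.re) (hre : ζ.re ≤ 3 * T) (hTim : T ≤ ζ.im)
    (him : ζ.im ≤ 2 * T) : ‖φ (ζ + s * Complex.I) - φ ζ‖ ≤ 2 * C * ‖φ T‖ := by
  have hosc : ∀ u : ℝ, 0 ≤ u → u ≤ T / 2 → ‖φ (ζ + u * Complex.I)‖ ≤ C * ‖φ T‖ := by
    intro u hu huT
    have hure : (ζ + u * Complex.I).re = ζ.re := by simp
    have huim : (ζ + u * Complex.I).im = ζ.im + u := by simp
    have habs : |ζ.im + u| = ζ.im + u := abs_of_nonneg (by linarith)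
    refine (h.osc T hT _ ?_ ?_ ?_ (Or.inr ?_)).1 <;> simp only [hure, huim, habs] <;> linarith
  have hζ := hosc 0 le_rfl (hs.trans hsT)
  rw [Complex.ofReal_zero, zero_mul, add_zero] at hζ
  linarith [norm_sub_le (φ (ζ + s * Complex.I)) (φ ζ), hosc s hs hsT]

lemma norm_shift_sub_pow_four_le (h : RegularTract φ α x C T₁) (hT : T₁ ≤ T) (hs : 0 ≤ s)
    (hsT : s ≤ T / 2) (hre : ξ.re = x + T / 4) (him : ξ.im = 5 * T / 4) :
    ‖φ (ξ + s * Complex.I) - φ ξ‖ ^ 4 ≤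
      (∫ y in T..(2 * T), ‖deriv φ (x + y * Complex.I)‖) * (2 * C * ‖φ T‖) ^ 3 := by
  have hx := h.one_le_x
  have hx0 : 0 < x := by linarith
  have hTx := h.le_T₁.trans hT
  have hdiff : ∀ ζ ∈ halfPlane, DifferentiableAt ℂ φ ζ := fun ζ hζ =>
    h.holo.differentiableAt (isOpen_halfPlane.mem_nhds hζ)
  refine norm_pow_four_le_of_square (k := fun z => φ (z + s * Complex.I) - φ z) (a := T / 4)
    (by linarith) ?_ ?_ ?_
  · rintro u ⟨⟨hleft, -⟩, -⟩
    have hpos : 0 < (ξ + u).re := by rw [Complex.add_re]; linarith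
    exact ((hdiff _ (by simpa [halfPlane] using hpos)).comp (ξ + u) (by fun_prop)).sub
      (hdiff _ hpos)
  · rintro u ⟨⟨hleft, hright⟩, hbot, htop⟩
    apply h.norm_shift_sub_le hT hs hsT <;> simp only [Complex.add_re, Complex.add_im] <;> linarith
  · rintro u ⟨-, hbot, htop⟩ hside
    have hu : ξ + u = (x : ℂ) + ((5 * T / 4 + u.im : ℝ) : ℂ) * Complex.I := by
      apply Complex.ext <;> simp [hre, him, hside]
    have hus : ξ + u + s * Complex.I =
        (x : ℂ) + ((5 * T / 4 + u.im + s : ℝ) : ℂ) * Complex.I := by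
      rw [hu]; push_cast; ring
    simp only [hus]
    rw [hu]
    exact (norm_sub_le_integral_line h.holo hx0 (by linarith)).trans <|
      intervalIntegral.integral_mono_interval (by linarith) (by linarith) (by linarith)
        (Eventually.of_forall fun y => norm_nonneg _)
        ((continuous_deriv_line h.holo hx0).norm.intervalIntegrable _ _)

lemma norm_le_mul_norm_deriv (h : RegularTract φ α x C T₁) (hT : T₁ ≤ T) (hre : T / 4 ≤ ξ.re)
    (hξ : ‖(T : ℂ) - ξ‖ ≤ 4 * T) :
    ‖φ T‖ ≤ C * Real.exp (16 * koebeConst) * (T * ‖deriv φ ξ‖) := by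
  have hTx := h.le_T₁.trans hT
  have hT0 : 0 < T := by linarith [h.one_le_x]
  have hC := h.one_le_C
  have hK := koebeConst_pos
  have hdistortion := norm_deriv_le_exp_mul_of_le_re h.holo h.inj (z := ξ) (w := T) (m := T / 4)
    (by linarith) hre (by rw [Complex.ofReal_re]; linarith)
  have hexponent : koebeConst / (T / 4) * ‖(T : ℂ) - ξ‖ ≤ 16 * koebeConst :=
    calc koebeConst / (T / 4) * ‖(T : ℂ) - ξ‖ ≤ koebeConst / (T / 4) * (4 * T) := by gcongr
      _ = 16 * koebeConst := by field_simp; norm_num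
  calc ‖φ T‖ ≤ C * (T * ‖deriv φ T‖) := h.le_deriv T hT
    _ ≤ C * (T * (Real.exp (16 * koebeConst) * ‖deriv φ ξ‖)) := by
        gcongr
        exact hdistortion.trans (by gcongr)
    _ = _ := by ring

lemma norm_le_mul_norm_shift_sub (h : RegularTract φ α x C T₁) (hT : T₁ ≤ T)
    (hre : T / 4 ≤ ξ.re) (hξ : ‖(T : ℂ) - ξ‖ ≤ 4 * T) :
    ‖φ T‖ ≤ 64 * koebeConst * C * Real.exp (16 * koebeConst) *
      ‖φ (ξ + (T / (32 * koebeConst) : ℝ) * Complex.I) - φ ξ‖ := by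
  have hTx := h.le_T₁.trans hT
  have hT0 : 0 < T := by linarith [h.one_le_x]
  have hC := h.one_le_C
  have hK := koebeConst_pos
  have hre0 : 0 < ξ.re := by linarith
  set s := T / (32 * koebeConst) with hs
  have hnorm : ‖(s : ℂ) * Complex.I‖ = s := by
    rw [norm_mul, Complex.norm_I, mul_one, Complex.norm_of_nonneg (by positivity)]
  have hball : ball ξ ξ.re ⊆ halfPlane := ball_subset_halfPlane le_rfl
  have hmem : ξ + s * Complex.I ∈ closedBall ξ (ξ.re / (8 * koebeConst)) := by
    rw [mem_closedBall, dist_self_add_left, hnorm, hs, div_le_div_iff₀ (by positivity)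
      (by positivity)]
    nlinarith
  have hlower := le_norm_sub_of_injOn_ball hre0 (h.holo.mono hball) (h.inj.mono hball) hmem
    (mem_closedBall_self (by positivity))
  rw [add_sub_cancel_left, hnorm] at hlower
  calc ‖φ T‖ ≤ C * Real.exp (16 * koebeConst) * (T * ‖deriv φ ξ‖) :=
        h.norm_le_mul_norm_deriv hT hre hξ
    _ = 64 * koebeConst * C * Real.exp (16 * koebeConst) * (‖deriv φ ξ‖ / 2 * s) := by
        rw [hs]; field_simp; ring
    _ ≤ _ := by gcongr

/- The image of the segment `x + i[T, 2T]` is not short: otherwise the difference of `φ` and its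
translate would be small on one side of a square, hence at the center, against distortion. -/
lemma exists_norm_le_mul_integral_line_x (h : RegularTract φ α x C T₁) :
    ∃ A > 0, ∀ T ≥ T₁, ‖φ (T : ℂ)‖ ≤ A * ∫ y in T..(2 * T), ‖deriv φ (x + y * Complex.I)‖ := by
  have hx := h.one_le_x
  have hC := h.one_le_C
  have hK := koebeConst_pos
  set A₁ := 64 * koebeConst * C * Real.exp (16 * koebeConst)
  refine ⟨A₁ ^ 4 * (2 * C) ^ 3, by positivity, fun T hT => ?_⟩
  have hTx := h.le_T₁.trans hT
  set ξ : ℂ := ⟨x + T / 4, 5 * T / 4⟩ with hξ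
  have hsT : T / (32 * koebeConst) ≤ T / 2 :=
    div_le_div_of_nonneg_left (by linarith) two_pos (by norm_num [koebeConst])
  have hdist : ‖(T : ℂ) - ξ‖ ≤ 4 * T := by
    refine (Complex.norm_le_abs_re_add_abs_im _).trans ?_
    have hre : |T - (x + T / 4)| ≤ T := abs_le.2 ⟨by linarith, by linarith⟩
    have him : |0 - 5 * T / 4| ≤ 2 * T := abs_le.2 ⟨by linarith, by linarith⟩
    simp only [hξ, Complex.sub_re, Complex.sub_im, Complex.ofReal_re, Complex.ofReal_im]
    linarith
  have hupper := h.norm_shift_sub_pow_four_le (ξ := ξ) hT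
    (s := T / (32 * koebeConst)) (div_nonneg (by linarith) (by linarith)) hsT rfl rfl
  have hlower := h.norm_le_mul_norm_shift_sub (ξ := ξ) hT
    (show T / 4 ≤ x + T / 4 by linarith) hdist
  refine le_of_mul_le_mul_right ?_ (pow_pos (h.norm_pos T hT) 3)
  calc ‖φ T‖ * ‖φ T‖ ^ 3 = ‖φ T‖ ^ 4 := by ring
    _ ≤ (A₁ * ‖φ (ξ + (T / (32 * koebeConst) : ℝ) * Complex.I) - φ ξ‖) ^ 4 := by gcongr
    _ ≤ A₁ ^ 4 * ((∫ y in T..(2 * T), ‖deriv φ (x + y * Complex.I)‖) * (2 * C * ‖φ T‖) ^ 3) := by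
        rw [mul_pow]; gcongr
    _ = _ := by ring

lemma exists_le_integral (h : RegularTract φ α x C T₁) :
    ∃ c > 0, ∀ T ≥ T₁, c * ‖φ (T : ℂ)‖ ≤
      ∫ y in T..(2 * T), ‖deriv φ ((1 : ℝ) + y * Complex.I)‖ := by
  obtain ⟨A, hA, hint⟩ := h.exists_norm_le_mul_integral_line_x
  have hx0 : 0 < x := by linarith [h.one_le_x]
  set F := Real.exp (koebeConst * |Real.log (x / 1)|)
  refine ⟨(A * F)⁻¹, by positivity, fun T hT => ?_⟩
  have hT0 : T ≤ 2 * T := by linarith [h.le_T₁]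
  rw [inv_mul_le_iff₀ (by positivity), mul_assoc]
  refine (hint T hT).trans ?_
  gcongr
  rw [← intervalIntegral.integral_const_mul]
  exact intervalIntegral.integral_mono_on hT0
    ((continuous_deriv_line h.holo hx0).norm.intervalIntegrable _ _)
    (((continuous_deriv_line h.holo one_pos).norm.const_mul F).intervalIntegrable _ _)
    fun y _ => norm_deriv_le_exp_abs_log_mul h.holo h.inj y hx0 one_pos

end RegularTract

/-! ### Integral means -/

section MeanInequalities

lemma integral_rpow_mul_rpow_le {X : Type*} [MeasurableSpace X] {μ : Measure X} {f g : X → ℝ}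
    {p q : ℝ} (hf : ∀ x, 0 ≤ f x) (hg : ∀ x, 0 ≤ g x) (hfi : Integrable f μ) (hgi : Integrable g μ)
    (hp : 0 ≤ p) (hq : 0 ≤ q) (hpq : p + q = 1) :
    ∫ x, f x ^ p * g x ^ q ∂μ ≤ (∫ x, f x ∂μ) ^ p * (∫ x, g x ∂μ) ^ q := by
  have hfm := hfi.aestronglyMeasurable
  have hgm := hgi.aestronglyMeasurable
  rw [integral_eq_lintegral_of_nonneg_ae (Eventually.of_forall hf) hfm,
    integral_eq_lintegral_of_nonneg_ae (Eventually.of_forall hg) hgm,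
    integral_eq_lintegral_of_nonneg_ae (Eventually.of_forall fun x =>
      mul_nonneg (Real.rpow_nonneg (hf x) p) (Real.rpow_nonneg (hg x) q))
      ((hfm.aemeasurable.pow_const p).mul (hgm.aemeasurable.pow_const q)).aestronglyMeasurable,
    ENNReal.toReal_rpow, ENNReal.toReal_rpow, ← ENNReal.toReal_mul]
  refine ENNReal.toReal_mono (ENNReal.mul_ne_top
    (ENNReal.rpow_ne_top_of_nonneg hp hfi.lintegral_lt_top.ne)
    (ENNReal.rpow_ne_top_of_nonneg hq hgi.lintegral_lt_top.ne)) ?_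
  refine le_trans (le_of_eq (lintegral_congr fun x => ?_))
    (ENNReal.lintegral_mul_norm_pow_le hfm.aemeasurable.ennreal_ofReal
      hgm.aemeasurable.ennreal_ofReal hp hq hpq)
  rw [ENNReal.ofReal_mul (Real.rpow_nonneg (hf x) p), ENNReal.ofReal_rpow_of_nonneg (hf x) hp,
    ENNReal.ofReal_rpow_of_nonneg (hg x) hq]

lemma convexOn_limsup {E ι : Type*} [AddCommGroup E] [Module ℝ E] {l : Filter ι} [l.NeBot]
    {F : E → ι → ℝ} {s : Set E} (hs : Convex ℝ s) (hconv : ∀ᶠ i in l, ConvexOn ℝ s (F · i))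
    (hle : ∀ t ∈ s, IsBoundedUnder (· ≤ ·) l (F t))
    (hge : ∀ t ∈ s, IsBoundedUnder (· ≥ ·) l (F t)) : ConvexOn ℝ s fun t => limsup (F t) l := by
  have hmono : ∀ {r : ℝ}, 0 ≤ r → Monotone (r * ·) := fun hr => monotone_mul_left_of_nonneg hr
  have hmul : ∀ t ∈ s, ∀ {r : ℝ}, 0 ≤ r →
      limsup (fun i => r * F t i) l = r * limsup (F t) l := fun t ht r hr =>
    ((hmono hr).map_limsup_of_continuousAt (F t) (by fun_prop) (hle t ht)
      (hge t ht).isCoboundedUnder_le).symm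
  have hle' : ∀ t ∈ s, ∀ {r : ℝ}, 0 ≤ r → IsBoundedUnder (· ≤ ·) l fun i => r * F t i :=
    fun t ht r hr => (hmono hr).isBoundedUnder_le_comp (hle t ht)
  have hge' : ∀ t ∈ s, ∀ {r : ℝ}, 0 ≤ r → IsBoundedUnder (· ≥ ·) l fun i => r * F t i :=
    fun t ht r hr => (hmono hr).isBoundedUnder_ge_comp (hge t ht)
  refine ⟨hs, fun a ha b hb p q hp hq hpq => ?_⟩
  have hab := hs ha hb hp hq hpq
  calc limsup (F (p • a + q • b)) l ≤ limsup ((fun i => p * F a i) + fun i => q * F b i) l :=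
        limsup_le_limsup (hconv.mono fun i hi => hi.2 ha hb hp hq hpq)
          (hge _ hab).isCoboundedUnder_le (isBoundedUnder_le_add (hle' a ha hp) (hle' b hb hq))
    _ ≤ limsup (fun i => p * F a i) l + limsup (fun i => q * F b i) l :=
        limsup_add_le (hge' a ha hp) (hle' a ha hp) (hge' b hb hq).isCoboundedUnder_le
          (hle' b hb hq)
    _ = p • limsup (F a) l + q • limsup (F b) l := by rw [hmul a ha hp, hmul b hb hq]; rfl

end MeanInequalities

section FirstZero

variable {b : ℝ → ℝ} {δ κ : ℝ}

lemma sInf_zeros_mem (hδ : 0 < δ) (hconv : ConvexOn ℝ (Ioi 0) b)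
    (hpos : ∀ t, 0 < t → t < δ → 0 < b t) (hneg : ∀ t > κ, b t < 0) :
    δ ≤ sInf {t | 0 < t ∧ b t = 0} ∧ b (sInf {t | 0 < t ∧ b t = 0}) = 0 := by
  set Z := {t | 0 < t ∧ b t = 0}
  have hcont : ContinuousOn b (Ioi 0) := hconv.continuousOn isOpen_Ioi
  have hZδ : ∀ t ∈ Z, δ ≤ t := fun t ht => by
    by_contra! hlt
    exact (hpos t ht.1 hlt).ne' ht.2
  have hZ : Z = Ici δ ∩ b ⁻¹' {0} := by
    ext t
    exact ⟨fun ht => ⟨hZδ t ht, ht.2⟩, fun ht => ⟨hδ.trans_le ht.1, ht.2⟩⟩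
  have hne : Z.Nonempty := by
    set u := max δ κ + 1
    have hδu : δ / 2 ≤ u := by linarith [le_max_left δ κ]
    obtain ⟨z, hz, hz0⟩ := intermediate_value_Icc' hδu
      (hcont.mono fun t ht => (half_pos hδ).trans_le ht.1)
      ⟨(hneg u (by linarith [le_max_right δ κ])).le, (hpos _ (half_pos hδ) (half_lt_self hδ)).le⟩
    exact ⟨z, (half_pos hδ).trans_le hz.1, hz0⟩
  have hclosed : IsClosed Z := hZ ▸ (hcont.mono (Ici_subset_Ioi.2 hδ)).preimage_isClosed_of_isClosed
    isClosed_Ici isClosed_singleton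
  have hmem := hclosed.csInf_mem hne ⟨δ, hZδ⟩
  exact ⟨hZδ _ hmem, hmem.2⟩

lemma neg_of_sInf_zeros_lt (hδ : 0 < δ) (hconv : ConvexOn ℝ (Ioi 0) b)
    (hpos : ∀ t, 0 < t → t < δ → 0 < b t) (hneg : ∀ t > κ, b t < 0) {t : ℝ}
    (ht : sInf {t | 0 < t ∧ b t = 0} < t) : b t < 0 := by
  obtain ⟨hδz, hz⟩ := sInf_zeros_mem hδ hconv hpos hneg
  by_contra! hnonneg
  have hle := hconv.le_right_of_left_le'' (z := max κ t + 1) (hδ.trans_le hδz)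
    ((hδ.trans_le hδz).trans (ht.trans (by linarith [le_max_right κ t]))) ht
    (by linarith [le_max_right κ t]) (hz.trans_le hnonneg)
  linarith [hneg (max κ t + 1) (by linarith [le_max_left κ t])]

lemma pos_of_lt_sInf_zeros (hδ : 0 < δ) (hcont : ContinuousOn b (Ioi 0))
    (hpos : ∀ t, 0 < t → t < δ → 0 < b t) {t : ℝ} (ht0 : 0 < t)
    (ht : t < sInf {t | 0 < t ∧ b t = 0}) : 0 < b t := by
  by_contra! hnonpos
  have hδt : δ ≤ t := not_lt.1 fun hlt => hnonpos.not_gt (hpos t ht0 hlt)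
  obtain ⟨z, hz, hz0⟩ := intermediate_value_Icc' ((half_lt_self hδ).le.trans hδt)
    (hcont.mono fun s hs => (half_pos hδ).trans_le hs.1)
    ⟨hnonpos, (hpos _ (half_pos hδ) (half_lt_self hδ)).le⟩
  have hinf : sInf {t | 0 < t ∧ b t = 0} ≤ z :=
    csInf_le ⟨0, fun s hs => hs.1.le⟩ ⟨(half_pos hδ).trans_le hz.1, hz0⟩
  linarith [hz.2]

end FirstZero

/-- The set over which the integral means are taken. -/
abbrev meansDomain : Set ℝ := Icc (-2 : ℝ) (-1) ∪ Icc (1 : ℝ) 2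

lemma isCompact_meansDomain : IsCompact meansDomain := isCompact_Icc.union isCompact_Icc

lemma disjoint_Icc_neg : Disjoint (Icc (-2 : ℝ) (-1)) (Icc 1 2) :=
  Set.disjoint_left.2 fun y hy hy' => by linarith [hy.2, hy'.1]

lemma volume_meansDomain : volume meansDomain = 2 := by
  rw [measure_union disjoint_Icc_neg measurableSet_Icc, Real.volume_Icc, Real.volume_Icc,
    ← ENNReal.ofReal_add] <;> norm_num

lemma volume_real_meansDomain : volume.real meansDomain = 2 := by
  rw [Measure.real, volume_meansDomain, ENNReal.toReal_ofNat]

/-- A family of positive functions on `meansDomain` with the growth of the derivatives of the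
rescaled conformal maps of a Hölder tract. -/
structure SpectralFamily (D : ℝ → ℝ → ℝ) (α A c T₂ : ℝ) : Prop where
  one_lt : 1 < T₂
  A_pos : 0 < A
  c_pos : 0 < c
  cont : ∀ T ≥ T₂, Continuous (D T)
  pos : ∀ T ≥ T₂, ∀ y, 0 < D T y
  le : ∀ T ≥ T₂, ∀ y ∈ meansDomain, D T y ≤ A * T ^ (1 - α)
  le_integral : ∀ T ≥ T₂, c ≤ ∫ y in meansDomain, D T y

/-- The integral means of a family of functions: `β_T(t) = log ∫ D_T ^ t / log T`. -/
def logMeans (D : ℝ → ℝ → ℝ) (t T : ℝ) : ℝ :=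
  Real.log (∫ y in meansDomain, D T y ^ t) / Real.log T

lemma tendsto_add_div_log (a b : ℝ) :
    Tendsto (fun T : ℝ => a + b / Real.log T) atTop (𝓝 a) := by
  simpa only [add_zero] using
    tendsto_const_nhds.add (tendsto_const_nhds.div_atTop Real.tendsto_log_atTop)

namespace SpectralFamily

variable {D : ℝ → ℝ → ℝ} {α A c T₂ T t : ℝ}

lemma continuous_rpow (h : SpectralFamily D α A c T₂) (hT : T ≥ T₂) (t : ℝ) :
    Continuous fun y => D T y ^ t :=
  (h.cont T hT).rpow_const fun y => Or.inl (h.pos T hT y).ne'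

lemma integrableOn (h : SpectralFamily D α A c T₂) (hT : T ≥ T₂) (t : ℝ) :
    IntegrableOn (fun y => D T y ^ t) meansDomain :=
  (h.continuous_rpow hT t).continuousOn.integrableOn_compact isCompact_meansDomain

lemma integral_pos (h : SpectralFamily D α A c T₂) (hT : T ≥ T₂) (t : ℝ) :
    0 < ∫ y in meansDomain, D T y ^ t := by
  have hp : ∀ y, 0 < D T y ^ t := fun y => Real.rpow_pos_of_pos (h.pos T hT y) t
  have hsupport : Function.support (fun y => D T y ^ t) = univ :=
    eq_univ_of_forall fun y => (hp y).ne'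
  rw [integral_pos_iff_support_of_nonneg (fun y => (hp y).le) (h.integrableOn hT t), hsupport,
    Measure.restrict_apply_univ, volume_meansDomain]
  norm_num

lemma integral_rpow_le (h : SpectralFamily D α A c T₂) (hT : T ≥ T₂) {a b p q : ℝ}
    (hp : 0 ≤ p) (hq : 0 ≤ q) (hpq : p + q = 1) :
    ∫ y in meansDomain, D T y ^ (p * a + q * b) ≤
      (∫ y in meansDomain, D T y ^ a) ^ p * (∫ y in meansDomain, D T y ^ b) ^ q := by
  have hD := fun y => (h.pos T hT y).le
  refine le_trans (le_of_eq (integral_congr_ae (Eventually.of_forall fun y => ?_)))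
    (integral_rpow_mul_rpow_le (fun y => Real.rpow_nonneg (hD y) a)
      (fun y => Real.rpow_nonneg (hD y) b) (h.integrableOn hT a) (h.integrableOn hT b) hp hq hpq)
  simp only [← Real.rpow_mul (hD y), mul_comm a p, mul_comm b q, Real.rpow_add (h.pos T hT y)]

lemma convexOn_log_integral (h : SpectralFamily D α A c T₂) (hT : T ≥ T₂) :
    ConvexOn ℝ univ fun t : ℝ => Real.log (∫ y in meansDomain, D T y ^ t) := by
  refine ⟨convex_univ, fun a _ b _ p q hp hq hpq => ?_⟩
  have ha := h.integral_pos hT a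
  have hb := h.integral_pos hT b
  have hlog := Real.log_le_log (h.integral_pos hT _)
    (h.integral_rpow_le hT (a := a) (b := b) hp hq hpq)
  rwa [Real.log_mul (Real.rpow_pos_of_pos ha p).ne' (Real.rpow_pos_of_pos hb q).ne',
    Real.log_rpow ha, Real.log_rpow hb] at hlog

lemma convexOn_logMeans (h : SpectralFamily D α A c T₂) (hT : T ≥ T₂) :
    ConvexOn ℝ univ fun t : ℝ => logMeans D t T := by
  simpa only [logMeans, div_eq_inv_mul, smul_eq_mul] using (h.convexOn_log_integral hT).smul
    (inv_nonneg.2 (Real.log_nonneg (by linarith [h.one_lt])))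

lemma integral_rpow_le_mul_rpow (h : SpectralFamily D α A c T₂) (ht : 0 < t) (hT : T ≥ T₂) :
    ∫ y in meansDomain, D T y ^ t ≤ 2 * (A * T ^ (1 - α)) ^ t := by
  have hle := setIntegral_mono_on (h.integrableOn hT t)
    (integrableOn_const (C := (A * T ^ (1 - α)) ^ t) isCompact_meansDomain.measure_lt_top.ne)
    isCompact_meansDomain.measurableSet
    (fun y hy => Real.rpow_le_rpow (h.pos T hT y).le (h.le T hT y hy) ht.le)
  rwa [setIntegral_const, volume_real_meansDomain, smul_eq_mul] at hle

lemma logMeans_le (h : SpectralFamily D α A c T₂) (ht : 0 < t) (hT : T ≥ T₂) :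
    logMeans D t T ≤ t * (1 - α) + (Real.log 2 + t * Real.log A) / Real.log T := by
  have hT0 : 0 < T := by linarith [h.one_lt]
  have hlog : 0 < Real.log T := Real.log_pos (by linarith [h.one_lt])
  have hA := h.A_pos
  have hTα := Real.rpow_pos_of_pos hT0 (1 - α)
  have hle := Real.log_le_log (h.integral_pos hT t) (h.integral_rpow_le_mul_rpow ht hT)
  rw [Real.log_mul two_ne_zero (by positivity), Real.log_rpow (by positivity),
    Real.log_mul hA.ne' hTα.ne', Real.log_rpow hT0] at hle
  rw [logMeans, div_le_iff₀ hlog, add_mul, div_mul_cancel₀ _ hlog.ne']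
  linarith

lemma mul_rpow_le_integral (h : SpectralFamily D α A c T₂) (ht : t ≤ 1) (hT : T ≥ T₂) :
    c * (A * T ^ (1 - α)) ^ (t - 1) ≤ ∫ y in meansDomain, D T y ^ t := by
  have hT0 : 0 < T := by linarith [h.one_lt]
  have hA := h.A_pos
  have hint : IntegrableOn (D T) meansDomain :=
    (h.cont T hT).continuousOn.integrableOn_compact isCompact_meansDomain
  refine (mul_le_mul_of_nonneg_right (h.le_integral T hT) (by positivity)).trans ?_
  rw [← integral_mul_const]
  refine setIntegral_mono_on (hint.mul_const _) (h.integrableOn hT t)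
    isCompact_meansDomain.measurableSet fun y hy => ?_
  have hp := h.pos T hT y
  calc D T y * (A * T ^ (1 - α)) ^ (t - 1) ≤ D T y * D T y ^ (t - 1) :=
        mul_le_mul_of_nonneg_left
          (Real.rpow_le_rpow_of_nonpos hp (h.le T hT y hy) (by linarith)) hp.le
    _ = D T y ^ t := by
        rw [mul_comm, ← Real.rpow_add_one hp.ne', sub_add_cancel]

lemma le_logMeans_of_le_one (h : SpectralFamily D α A c T₂) (ht : t ≤ 1) (hT : T ≥ T₂) :
    -((1 - α) * (1 - t)) + (Real.log c - (1 - t) * Real.log A) / Real.log T ≤ logMeans D t T := by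
  have hT0 : 0 < T := by linarith [h.one_lt]
  have hlog : 0 < Real.log T := Real.log_pos (by linarith [h.one_lt])
  have hA := h.A_pos
  have hTα := Real.rpow_pos_of_pos hT0 (1 - α)
  have hle := Real.log_le_log (mul_pos h.c_pos (by positivity)) (h.mul_rpow_le_integral ht hT)
  rw [Real.log_mul h.c_pos.ne' (by positivity), Real.log_rpow (by positivity),
    Real.log_mul hA.ne' hTα.ne', Real.log_rpow hT0] at hle
  rw [logMeans, le_div_iff₀ hlog, add_mul, div_mul_cancel₀ _ hlog.ne']
  linarith

/- Convexity between the exponents `0` and `t`, compared at `1`. -/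
lemma le_logMeans_of_one_le (h : SpectralFamily D α A c T₂) (ht : 1 ≤ t) (hT : T ≥ T₂) :
    (t * Real.log c - (t - 1) * Real.log 2) / Real.log T ≤ logMeans D t T := by
  have hlog : 0 < Real.log T := Real.log_pos (by linarith [h.one_lt])
  have ht0 : 0 < t := by linarith
  have hconv := (h.convexOn_log_integral hT).2 (mem_univ 0) (mem_univ t)
    (sub_nonneg.2 ((div_le_one ht0).2 ht)) (by positivity : 0 ≤ 1 / t) (sub_add_cancel 1 (1 / t))
  simp only [smul_eq_mul, mul_zero, zero_add, one_div_mul_cancel ht0.ne', Real.rpow_one,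
    Real.rpow_zero, setIntegral_const, volume_real_meansDomain, mul_one] at hconv
  have hle := mul_le_mul_of_nonneg_left
    ((Real.log_le_log h.c_pos (h.le_integral T hT)).trans hconv) ht0.le
  rw [mul_add, ← mul_assoc, ← mul_assoc, mul_one_div_cancel ht0.ne', mul_sub,
    mul_one_div_cancel ht0.ne', mul_one, one_mul] at hle
  rw [logMeans]
  gcongr
  linarith

lemma isBoundedUnder_le (h : SpectralFamily D α A c T₂) (ht : 0 < t) :
    IsBoundedUnder (· ≤ ·) atTop (logMeans D t) :=
  (tendsto_add_div_log _ _).isBoundedUnder_le.mono_le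
    (eventually_atTop.2 ⟨T₂, fun _ hT => h.logMeans_le ht hT⟩)

lemma isBoundedUnder_ge (h : SpectralFamily D α A c T₂) (t : ℝ) :
    IsBoundedUnder (· ≥ ·) atTop (logMeans D t) := by
  rcases le_total t 1 with ht | ht
  · exact (tendsto_add_div_log _ _).isBoundedUnder_ge.mono_ge
      (eventually_atTop.2 ⟨T₂, fun _ hT => h.le_logMeans_of_le_one ht hT⟩)
  · have hbdd := (tendsto_add_div_log 0 (t * Real.log c - (t - 1) * Real.log 2)).isBoundedUnder_ge
    simp only [zero_add] at hbdd
    exact hbdd.mono_ge (eventually_atTop.2 ⟨T₂, fun _ hT => h.le_logMeans_of_one_le ht hT⟩)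

lemma limsup_logMeans_le (h : SpectralFamily D α A c T₂) (ht : 0 < t) :
    limsup (logMeans D t) atTop ≤ t * (1 - α) := by
  rw [← (tendsto_add_div_log (t * (1 - α)) (Real.log 2 + t * Real.log A)).limsup_eq]
  exact limsup_le_limsup (eventually_atTop.2 ⟨T₂, fun _ hT => h.logMeans_le ht hT⟩)
    (h.isBoundedUnder_ge t).isCoboundedUnder_le (tendsto_add_div_log _ _).isBoundedUnder_le

lemma le_limsup_logMeans (h : SpectralFamily D α A c T₂) (ht : 0 < t) (ht1 : t ≤ 1) :
    -((1 - α) * (1 - t)) ≤ limsup (logMeans D t) atTop := by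
  rw [← (tendsto_add_div_log (-((1 - α) * (1 - t)))
    (Real.log c - (1 - t) * Real.log A)).limsup_eq]
  exact limsup_le_limsup (eventually_atTop.2 ⟨T₂, fun _ hT => h.le_logMeans_of_le_one ht1 hT⟩)
    (tendsto_add_div_log _ _).isBoundedUnder_ge.isCoboundedUnder_le (h.isBoundedUnder_le ht)

lemma convexOn_limsup_logMeans (h : SpectralFamily D α A c T₂) :
    ConvexOn ℝ (Ioi 0) fun t => limsup (logMeans D t) atTop :=
  convexOn_limsup (convex_Ioi 0)
    (eventually_atTop.2 ⟨T₂, fun _ hT => (h.convexOn_logMeans hT).subset (subset_univ _)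
      (convex_Ioi 0)⟩)
    (fun _ ht => h.isBoundedUnder_le ht) fun t _ => h.isBoundedUnder_ge t

end SpectralFamily

section Rescale

variable {φ : ℂ → ℂ} {T a b : ℝ}

/-- The function `y ↦ |φ_T'(1 / T + i y)|` whose integral means define the spectrum. -/
def rescaledDeriv (φ : ℂ → ℂ) (T y : ℝ) : ℝ :=
  ‖deriv (rescale φ T) (((1 / T : ℝ) : ℂ) + y * Complex.I)‖

lemma betaInf_eq_limsup (φ : ℂ → ℂ) (t : ℝ) :
    betaInf φ t = limsup (logMeans (rescaledDeriv φ) t) atTop := by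
  unfold betaInf logMeans rescaledDeriv integralMeans
  simp only [one_div_one_div]

lemma rescaledDeriv_eq (hT : 0 < T) (y : ℝ) :
    rescaledDeriv φ T y = T / ‖φ T‖ * ‖deriv φ ((1 : ℝ) + (T * y : ℝ) * Complex.I)‖ := by
  have hTc : (T : ℂ) ≠ 0 := Complex.ofReal_ne_zero.2 hT.ne'
  have hpoint : (T : ℂ) * (((1 / T : ℝ) : ℂ) + y * Complex.I) =
      (1 : ℝ) + (T * y : ℝ) * Complex.I := by
    push_cast
    field_simp
  rw [rescaledDeriv, show rescale φ T = fun z => φ ((T : ℂ) * z) / (‖φ (T : ℂ)‖ : ℂ) from rfl,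
    deriv_div_const, deriv_comp_mul_left, hpoint, norm_div, norm_smul, Complex.norm_real,
    Complex.norm_real, norm_norm, Real.norm_eq_abs, abs_of_pos hT]
  ring

lemma setIntegral_rescaledDeriv_rpow (hT : 0 < T) (hab : a ≤ b) (t : ℝ) :
    ∫ y in Icc a b, rescaledDeriv φ T y ^ t = T ^ (t - 1) * ‖φ T‖ ^ (-t) *
      ∫ y in (T * a)..(T * b), ‖deriv φ ((1 : ℝ) + y * Complex.I)‖ ^ t := by
  rw [integral_Icc_eq_integral_Ioc, ← intervalIntegral.integral_of_le hab]
  simp only [rescaledDeriv_eq hT,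
    Real.mul_rpow (div_nonneg hT.le (norm_nonneg (φ T))) (norm_nonneg _)]
  rw [intervalIntegral.integral_const_mul, intervalIntegral.integral_comp_mul_left
    (f := fun y : ℝ => ‖deriv φ ((1 : ℝ) + y * Complex.I)‖ ^ t) hT.ne', smul_eq_mul, ← mul_assoc,
    Real.div_rpow hT.le (norm_nonneg _), Real.rpow_neg (norm_nonneg _), Real.rpow_sub hT,
    Real.rpow_one]
  ring

end Rescale

namespace RegularTract

variable {φ : ℂ → ℂ} {α x C T₁ T t : ℝ}

lemma norm_deriv_pos (h : RegularTract φ α x C T₁) (y : ℝ) :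
    0 < ‖deriv φ ((1 : ℝ) + y * Complex.I)‖ := norm_pos_iff.2 <|
  deriv_ne_zero_of_injOn isOpen_halfPlane h.holo h.inj (line_mem_halfPlane one_pos y)

lemma pos_of_le (h : RegularTract φ α x C T₁) (hT : T₁ ≤ T) : 0 < T := by
  linarith [h.le_T₁, h.one_le_x]

lemma continuous_rescaledDeriv (h : RegularTract φ α x C T₁) (hT : T₁ ≤ T) :
    Continuous (rescaledDeriv φ T) := by
  simp only [funext (rescaledDeriv_eq (φ := φ) (h.pos_of_le hT))]
  exact (((continuous_deriv_line h.holo one_pos).comp (continuous_const_mul T)).norm).const_mul _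

lemma rescaledDeriv_le (h : RegularTract φ α x C T₁) (hT : T₁ ≤ T) {y : ℝ}
    (hy : y ∈ meansDomain) :
    rescaledDeriv φ T y ≤
      Real.exp (koebeConst * |Real.log (1 / x)|) * C * T ^ (1 - α) := by
  have hT0 := h.pos_of_le hT
  have hφ := h.norm_pos T hT
  have hx : 0 < x := by linarith [h.one_le_x]
  have hyabs : 1 ≤ |y| ∧ |y| ≤ 2 := by
    rcases hy with hy | hy
    · rw [abs_of_neg (by linarith [hy.2])]
      exact ⟨by linarith [hy.2], by linarith [hy.1]⟩
    · rw [abs_of_pos (by linarith [hy.1])]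
      exact hy
  have habs : |T * y| = T * |y| := by rw [abs_mul, abs_of_pos hT0]
  have hderiv := h.deriv_le T hT (T * y) (by rw [habs]; nlinarith) (by rw [habs]; nlinarith)
  rw [← le_div_iff₀ (Real.rpow_pos_of_pos hT0 α)] at hderiv
  calc rescaledDeriv φ T y
      = T / ‖φ T‖ * ‖deriv φ ((1 : ℝ) + (T * y : ℝ) * Complex.I)‖ := rescaledDeriv_eq hT0 y
    _ ≤ T / ‖φ T‖ * (Real.exp (koebeConst * |Real.log (1 / x)|) * (C * ‖φ T‖ / T ^ α)) := by
        gcongr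
        exact (norm_deriv_le_exp_abs_log_mul h.holo h.inj (T * y) one_pos hx).trans (by gcongr)
    _ = Real.exp (koebeConst * |Real.log (1 / x)|) * C * T ^ (1 - α) := by
        rw [Real.rpow_sub hT0, Real.rpow_one]
        field_simp

lemma exists_spectralFamily (h : RegularTract φ α x C T₁) :
    ∃ A c, SpectralFamily (rescaledDeriv φ) α A c T₁ := by
  obtain ⟨c, hc, hint⟩ := h.exists_le_integral
  have hC := h.one_le_C
  refine ⟨Real.exp (koebeConst * |Real.log (1 / x)|) * C, c, by linarith [h.le_T₁, h.one_le_x],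
    by positivity, hc, fun T hT => h.continuous_rescaledDeriv hT, fun T hT y => ?_,
    fun T hT y => h.rescaledDeriv_le hT, fun T hT => ?_⟩
  · rw [rescaledDeriv_eq (h.pos_of_le hT)]
    exact mul_pos (div_pos (h.pos_of_le hT) (h.norm_pos T hT)) (h.norm_deriv_pos _)
  · have hscale := setIntegral_rescaledDeriv_rpow (φ := φ) (h.pos_of_le hT) one_le_two 1
    simp only [Real.rpow_one, sub_self, Real.rpow_zero, one_mul, mul_one, Real.rpow_neg_one,
      mul_comm T 2] at hscale
    calc c ≤ ‖φ T‖⁻¹ * ∫ y in T..(2 * T), ‖deriv φ ((1 : ℝ) + y * Complex.I)‖ := by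
          rw [le_inv_mul_iff₀ (h.norm_pos T hT), mul_comm]
          exact hint T hT
      _ = ∫ y in Icc 1 2, rescaledDeriv φ T y := hscale.symm
      _ ≤ _ := setIntegral_mono_set
          ((h.continuous_rescaledDeriv hT).continuousOn.integrableOn_compact isCompact_meansDomain)
          (Eventually.of_forall fun y => norm_nonneg _) (LE.le.eventuallyLE subset_union_right)

lemma convexOn_bInf (h : RegularTract φ α x C T₁) : ConvexOn ℝ (Ioi 0) (bInf φ) := by
  obtain ⟨A, c, hS⟩ := h.exists_spectralFamily
  have hβ : ConvexOn ℝ (Ioi 0) (betaInf φ) := by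
    rw [funext (betaInf_eq_limsup φ)]
    exact hS.convexOn_limsup_logMeans
  exact (hβ.sub (concaveOn_id (convex_Ioi 0))).add_const 1

lemma bInf_pos_of_lt_one (h : RegularTract φ α x C T₁) (hα : 0 < α) (ht : 0 < t) (ht1 : t < 1) :
    0 < bInf φ t := by
  obtain ⟨A, c, hS⟩ := h.exists_spectralFamily
  have hβ := hS.le_limsup_logMeans ht ht1.le
  rw [← betaInf_eq_limsup] at hβ
  rw [bInf]
  linarith [mul_pos hα (sub_pos.2 ht1)]

lemma bInf_neg_of_inv_lt (h : RegularTract φ α x C T₁) (hα : 0 < α) (ht : α⁻¹ < t) :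
    bInf φ t < 0 := by
  obtain ⟨A, c, hS⟩ := h.exists_spectralFamily
  have hβ := hS.limsup_logMeans_le ((inv_pos.2 hα).trans ht)
  rw [← betaInf_eq_limsup] at hβ
  rw [inv_lt_iff_one_lt_mul₀ hα] at ht
  rw [bInf]
  linarith

lemma one_le_theta (h : RegularTract φ α x C T₁) (hα : 0 < α) : 1 ≤ theta φ :=
  (sInf_zeros_mem one_pos h.convexOn_bInf (fun _ => h.bInf_pos_of_lt_one hα)
    fun _ => h.bInf_neg_of_inv_lt hα).1

lemma theta_le_inv (h : RegularTract φ α x C T₁) (hα : 0 < α) : theta φ ≤ α⁻¹ := by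
  by_contra! hlt
  exact (h.bInf_neg_of_inv_lt hα hlt).ne (sInf_zeros_mem one_pos h.convexOn_bInf
    (fun _ => h.bInf_pos_of_lt_one hα) fun _ => h.bInf_neg_of_inv_lt hα).2

lemma bInf_neg_of_theta_lt (h : RegularTract φ α x C T₁) (hα : 0 < α) (ht : theta φ < t) :
    bInf φ t < 0 :=
  neg_of_sInf_zeros_lt one_pos h.convexOn_bInf (fun _ => h.bInf_pos_of_lt_one hα)
    (fun _ => h.bInf_neg_of_inv_lt hα) ht

lemma bInf_pos_of_lt_theta (h : RegularTract φ α x C T₁) (hα : 0 < α) (ht0 : 0 < t)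
    (ht : t < theta φ) : 0 < bInf φ t :=
  pos_of_lt_sInf_zeros one_pos (h.convexOn_bInf.continuousOn isOpen_Ioi)
    (fun _ => h.bInf_pos_of_lt_one hα) ht0 ht

lemma setIntegral_meansDomain (h : RegularTract φ α x C T₁) (hT : T₁ ≤ T) (t : ℝ) :
    ∫ y in meansDomain, rescaledDeriv φ T y ^ t = T ^ (t - 1) * (‖φ T‖ ^ (-t) *
      ((∫ y in T..(2 * T), ‖deriv φ ((1 : ℝ) + y * Complex.I)‖ ^ t) +
        ∫ y in (-(2 * T))..(-T), ‖deriv φ ((1 : ℝ) + y * Complex.I)‖ ^ t)) := by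
  obtain ⟨A, c, hS⟩ := h.exists_spectralFamily
  have hT0 := h.pos_of_le hT
  rw [setIntegral_union disjoint_Icc_neg measurableSet_Icc
    ((hS.integrableOn hT t).mono_set subset_union_left)
    ((hS.integrableOn hT t).mono_set subset_union_right),
    setIntegral_rescaledDeriv_rpow hT0 (by norm_num), setIntegral_rescaledDeriv_rpow hT0 one_le_two]
  simp only [mul_one, mul_neg, mul_comm T 2]
  ring

lemma frequently_integral_ge (h : RegularTract φ α x C T₁) (hb : 0 < bInf φ t) :
    ∃ ε > (0 : ℝ), ∃ᶠ T : ℝ in atTop, T ^ ε ≤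
      ‖φ (T : ℂ)‖ ^ (-t) * ((∫ y in T..(2 * T), ‖deriv φ ((1 : ℝ) + y * Complex.I)‖ ^ t) +
        ∫ y in (-(2 * T))..(-T), ‖deriv φ ((1 : ℝ) + y * Complex.I)‖ ^ t) := by
  obtain ⟨A, c, hS⟩ := h.exists_spectralFamily
  refine ⟨bInf φ t / 2, half_pos hb, ?_⟩
  have hlt : t - 1 + bInf φ t / 2 < betaInf φ t := by
    rw [bInf] at hb ⊢
    linarith
  rw [betaInf_eq_limsup] at hlt
  have hfreq := frequently_lt_of_lt_limsup (hS.isBoundedUnder_ge t).isCoboundedUnder_le hlt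
  refine (hfreq.and_eventually (eventually_ge_atTop T₁)).mono fun T hT => ?_
  obtain ⟨hlog, hT₁⟩ := hT
  have hT0 := h.pos_of_le hT₁
  have hlogT : 0 < Real.log T := Real.log_pos (hS.one_lt.trans_le hT₁)
  rw [logMeans, lt_div_iff₀ hlogT, ← Real.log_rpow hT0, Real.log_lt_log_iff
    (Real.rpow_pos_of_pos hT0 _) (hS.integral_pos hT₁ t), h.setIntegral_meansDomain hT₁,
    Real.rpow_add hT0] at hlog
  exact (lt_of_mul_lt_mul_left hlog (Real.rpow_nonneg hT0.le _)).le

end RegularTract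

/-! ### Iterated function systems -/

section Coding

variable {X : Type*} [MetricSpace X] {N : ℕ} {p : (ℕ → Fin N) → X} {a c t : ℝ}

lemma injective_of_separated (ha : 0 < a) (hc : 0 < c)
    (hsep : ∀ i j n, (∀ m < n, i m = j m) → i n ≠ j n → c * a ^ n ≤ dist (p i) (p j)) :
    Function.Injective p := by
  intro i j hij
  by_contra hne
  have hle := hsep i j _ (fun _ => PiNat.apply_eq_of_lt_firstDiff) (PiNat.apply_firstDiff_ne hne)
  rw [hij, dist_self] at hle
  exact hle.not_gt (by positivity)

lemma dist_ofDigits_le_of_separated (hN : 1 < N) (ha : 0 < a) (hc : 0 < c) (ht : 0 < t)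
    (hNa : 1 ≤ N * a ^ t)
    (hsep : ∀ i j n, (∀ m < n, i m = j m) → i n ≠ j n → c * a ^ n ≤ dist (p i) (p j))
    (i j : ℕ → Fin N) :
    dist (Real.ofDigits i) (Real.ofDigits j) ≤ c ^ (-t) * dist (p i) (p j) ^ t := by
  by_cases hij : i = j
  · rw [hij, dist_self, dist_self]
    positivity
  have heq : ∀ m < PiNat.firstDiff i j, i m = j m := fun _ => PiNat.apply_eq_of_lt_firstDiff
  have hle := hsep i j _ heq (PiNat.apply_firstDiff_ne hij)
  set n := PiNat.firstDiff i j
  have : (0 : ℝ) < N := by exact_mod_cast Nat.zero_lt_of_lt hN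
  have hpow : ((N : ℝ) ^ n)⁻¹ ≤ (a ^ n) ^ t := by
    rw [inv_le_iff_one_le_mul₀ (by positivity), ← Real.rpow_natCast a n, ← Real.rpow_mul ha.le,
      mul_comm (n : ℝ) t, Real.rpow_mul ha.le, Real.rpow_natCast, ← mul_pow, mul_comm]
    exact one_le_pow₀ hNa
  calc dist (Real.ofDigits i) (Real.ofDigits j)
      ≤ ((N : ℝ) ^ n)⁻¹ := Real.abs_ofDigits_sub_ofDigits_le heq
    _ ≤ (a ^ n) ^ t := hpow
    _ = c ^ (-t) * (c * a ^ n) ^ t := by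
      rw [Real.mul_rpow hc.le (by positivity), ← mul_assoc, ← Real.rpow_add hc, neg_add_cancel,
        Real.rpow_zero, one_mul]
    _ ≤ c ^ (-t) * dist (p i) (p j) ^ t := by gcongr

/- The expansion in base `N` carries the image of `p` onto the unit interval, by a `t`-Hölder
map. -/
lemma le_dimH_range_of_separated (hN : 1 < N) (ha : 0 < a) (hc : 0 < c) (ht : 0 < t)
    (hNa : 1 ≤ N * a ^ t)
    (hsep : ∀ i j n, (∀ m < n, i m = j m) → i n ≠ j n → c * a ^ n ≤ dist (p i) (p j)) :
    ENNReal.ofReal t ≤ dimH (range p) := by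
  have : Nonempty (ℕ → Fin N) := ⟨fun _ => ⟨0, by lia⟩⟩
  set F : X → ℝ := fun z => Real.ofDigits (Function.invFun p z)
  have hFp : ∀ i, F (p i) = Real.ofDigits i := fun i => by
    simp only [F, Function.leftInverse_invFun (injective_of_separated ha hc hsep) i]
  have hhol : HolderOnWith (c ^ (-t)).toNNReal t.toNNReal F (range p) := by
    rintro _ ⟨i, rfl⟩ _ ⟨j, rfl⟩
    have hct : 0 ≤ c ^ (-t) := by positivity
    rw [edist_dist, edist_dist, Real.coe_toNNReal t ht.le,
      ENNReal.ofReal_rpow_of_nonneg dist_nonneg ht.le, ENNReal.ofNNReal_toNNReal,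
      ← ENNReal.ofReal_mul hct, hFp, hFp]
    exact ENNReal.ofReal_le_ofReal (dist_ofDigits_le_of_separated hN ha hc ht hNa hsep i j)
  have hsub : Icc (0 : ℝ) 1 ⊆ F '' range p := by
    intro s hs
    obtain ⟨i, -, hi⟩ := Real.ofDigits_SurjOn hN hs
    exact ⟨p i, mem_range_self i, (hFp i).trans hi⟩
  have hIcc : dimH (Icc (0 : ℝ) 1) = 1 := by
    rw [Real.dimH_of_nonempty_interior (by rw [interior_Icc]; exact nonempty_Ioo.2 one_pos),
      Module.finrank_self, Nat.cast_one]
  have hle : 1 ≤ dimH (range p) / t.toNNReal :=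
    (hIcc.ge.trans (dimH_mono hsub)).trans (hhol.dimH_image_le (Real.toNNReal_pos.2 ht))
  rwa [ENNReal.le_div_iff_mul_le (Or.inl (by simpa using ht)) (Or.inl (by simp)), one_mul] at hle

end Coding

/-- A finite iterated function system `G` on a bounded closed set `D`: the maps contract distances
at least by the factor `L` and at most by the factor `a`, and their images have mutual distances at
least `d`. The diameter of `D` is at most `δ`. -/
structure SeparatedIFS {X : Type*} [MetricSpace X] {N : ℕ} (D : Set X) (G : Fin N → X → X)
    (a d L δ : ℝ) : Prop where
  isClosed : IsClosed D
  nonempty : D.Nonempty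
  dist_le : ∀ x ∈ D, ∀ y ∈ D, dist x y ≤ δ
  a_pos : 0 < a
  d_pos : 0 < d
  L_nonneg : 0 ≤ L
  L_lt_one : L < 1
  mapsTo : ∀ k, MapsTo (G k) D D
  lip : ∀ k, ∀ x ∈ D, ∀ y ∈ D, dist (G k x) (G k y) ≤ L * dist x y
  antilip : ∀ k, ∀ x ∈ D, ∀ y ∈ D, a * dist x y ≤ dist (G k x) (G k y)
  sep : ∀ k l, k ≠ l → ∀ x ∈ D, ∀ y ∈ D, d ≤ dist (G k x) (G l y)

/-- `p` is the coding map of the iterated function system `G` on `D`: `p i` is the point of the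
limit set with itinerary `i`, characterised by self-similarity. -/
structure IsCoding {X : Type*} {N : ℕ} (D : Set X) (G : Fin N → X → X) (p : (ℕ → Fin N) → X) :
    Prop where
  mem : ∀ i, p i ∈ D
  eq : ∀ i, p i = G (i 0) (p fun m => i (m + 1))

/-- The word that agrees with `i` up to the index `n` (excluded) and continues with `u`. -/
def splice {A : Type*} (i : ℕ → A) (n : ℕ) (u : ℕ → A) (m : ℕ) : A :=
  if m < n then i m else u (m - n)

lemma splice_of_lt {A : Type*} (i u : ℕ → A) {m n : ℕ} (h : m < n) : splice i n u m = i m :=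
  if_pos h

lemma splice_add {A : Type*} (i u : ℕ → A) (m n : ℕ) : splice i n u (m + n) = u m := by
  rw [splice, if_neg (by lia), Nat.add_sub_cancel]

namespace SeparatedIFS

variable {X : Type*} [MetricSpace X] {N : ℕ} {D : Set X} {G : Fin N → X → X} {a d L δ : ℝ}
  {p : (ℕ → Fin N) → X}

/-- The finite approximations `G (i 0) (G (i 1) (… x₀))` of the coding map. -/
def approx (G : Fin N → X → X) (x₀ : X) : ℕ → (ℕ → Fin N) → X
  | 0, _ => x₀
  | n + 1, i => G (i 0) (approx G x₀ n fun m => i (m + 1))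

lemma approx_mem (h : SeparatedIFS D G a d L δ) {x₀ : X} (hx₀ : x₀ ∈ D) (n : ℕ) (i : ℕ → Fin N) :
    approx G x₀ n i ∈ D := by
  induction n generalizing i with
  | zero => exact hx₀
  | succ n ih => exact h.mapsTo _ (ih _)

lemma dist_approx_succ_le (h : SeparatedIFS D G a d L δ) {x₀ : X} (hx₀ : x₀ ∈ D) (n : ℕ)
    (i : ℕ → Fin N) : dist (approx G x₀ n i) (approx G x₀ (n + 1) i) ≤ δ * L ^ n := by
  induction n generalizing i with
  | zero => simpa using h.dist_le _ (h.approx_mem hx₀ 0 i) _ (h.approx_mem hx₀ 1 i)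
  | succ n ih =>
    calc dist (approx G x₀ (n + 1) i) (approx G x₀ (n + 1 + 1) i)
        ≤ L * dist (approx G x₀ n fun m => i (m + 1)) (approx G x₀ (n + 1) fun m => i (m + 1)) :=
          h.lip _ _ (h.approx_mem hx₀ _ _) _ (h.approx_mem hx₀ _ _)
      _ ≤ L * (δ * L ^ n) := mul_le_mul_of_nonneg_left (ih _) h.L_nonneg
      _ = δ * L ^ (n + 1) := by ring

lemma exists_isCoding [CompleteSpace X] (h : SeparatedIFS D G a d L δ) :
    ∃ p, IsCoding D G p := by
  obtain ⟨x₀, hx₀⟩ := h.nonempty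
  have hlim : ∀ i, ∃ z, Tendsto (fun n => approx G x₀ n i) atTop (𝓝 z) := fun i =>
    cauchySeq_tendsto_of_complete
      (cauchySeq_of_le_geometric L δ h.L_lt_one fun n => h.dist_approx_succ_le hx₀ n i)
  choose p hp using hlim
  have hpD : ∀ i, p i ∈ D := fun i =>
    h.isClosed.mem_of_tendsto (hp i) (Eventually.of_forall fun n => h.approx_mem hx₀ n i)
  refine ⟨p, hpD, fun i => tendsto_nhds_unique ((tendsto_add_atTop_iff_nat 1).2 (hp i)) ?_⟩
  rw [tendsto_iff_dist_tendsto_zero]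
  have h0 := (tendsto_iff_dist_tendsto_zero.1 (hp fun m => i (m + 1))).const_mul L
  rw [mul_zero] at h0
  exact squeeze_zero (fun _ => dist_nonneg)
    (fun n => h.lip _ _ (h.approx_mem hx₀ _ _) _ (hpD _)) h0

lemma le_dist_coding (h : SeparatedIFS D G a d L δ) (hp : IsCoding D G p) {n : ℕ}
    {i j : ℕ → Fin N} (heq : ∀ m < n, i m = j m) (hne : i n ≠ j n) :
    d * a ^ n ≤ dist (p i) (p j) := by
  induction n generalizing i j with
  | zero =>
    rw [hp.eq i, hp.eq j, pow_zero, mul_one]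
    exact h.sep _ _ hne _ (hp.mem _) _ (hp.mem _)
  | succ n ih =>
    rw [hp.eq i, hp.eq j, heq 0 n.succ_pos]
    calc d * a ^ (n + 1) = a * (d * a ^ n) := by ring
      _ ≤ a * dist (p fun m => i (m + 1)) (p fun m => j (m + 1)) :=
        mul_le_mul_of_nonneg_left (ih (fun m hm => heq _ (by lia)) hne) h.a_pos.le
      _ ≤ _ := h.antilip _ _ (hp.mem _) _ (hp.mem _)

lemma dist_coding_le (h : SeparatedIFS D G a d L δ) (hp : IsCoding D G p) {n : ℕ}
    {i j : ℕ → Fin N} (heq : ∀ m < n, i m = j m) : dist (p i) (p j) ≤ δ * L ^ n := by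
  induction n generalizing i j with
  | zero => simpa using h.dist_le _ (hp.mem _) _ (hp.mem _)
  | succ n ih =>
    rw [hp.eq i, hp.eq j, heq 0 n.succ_pos]
    calc dist (G (j 0) (p fun m => i (m + 1))) (G (j 0) (p fun m => j (m + 1)))
        ≤ L * dist (p fun m => i (m + 1)) (p fun m => j (m + 1)) :=
          h.lip _ _ (hp.mem _) _ (hp.mem _)
      _ ≤ L * (δ * L ^ n) := mul_le_mul_of_nonneg_left (ih fun m hm => heq _ (by lia)) h.L_nonneg
      _ = δ * L ^ (n + 1) := by ring

lemma tendsto_coding_splice (h : SeparatedIFS D G a d L δ) (hp : IsCoding D G p)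
    (i u : ℕ → Fin N) : Tendsto (fun n => p (splice i n u)) atTop (𝓝 (p i)) := by
  have h0 := (tendsto_pow_atTop_nhds_zero_of_lt_one h.L_nonneg h.L_lt_one).const_mul δ
  rw [mul_zero] at h0
  exact tendsto_iff_dist_tendsto_zero.2 (squeeze_zero (fun _ => dist_nonneg)
    (fun n => h.dist_coding_le hp fun m hm => splice_of_lt i u hm) h0)

end SeparatedIFS

/-- Sensitive dependence on initial conditions at `z`: every neighbourhood of `z` contains, for all
large `n`, two points that `fⁿ` maps to points at distance at least a fixed `ε`. -/
def IsSensitiveAt (f : ℂ → ℂ) (z : ℂ) : Prop :=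
  ∃ ε > 0, ∀ U ∈ 𝓝 z, ∀ᶠ n in atTop, ∃ w₁ ∈ U, ∃ w₂ ∈ U, ε ≤ dist (f^[n] w₁) (f^[n] w₂)

/-- A set whose points have uniformly bounded orbits in `{|z| > 1}` and are points of sensitive
dependence. Such sets lie in the Julia set of a model and in that of an entire function. -/
structure IsSensitiveSet (f : ℂ → ℂ) (E : Set ℂ) : Prop where
  one_lt : ∀ z ∈ E, ∀ n, 1 < ‖f^[n] z‖
  bounded : ∃ B, ∀ z ∈ E, ∀ n, ‖f^[n] z‖ ≤ B
  sensitive : ∀ z ∈ E, IsSensitiveAt f z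

lemma IsSensitiveAt.not_tendstoLocallyUniformlyOn {f : ℂ → ℂ} (hf : Continuous f) {z : ℂ}
    (h : IsSensitiveAt f z) {U : Set ℂ} (hU : U ∈ 𝓝 z) {v : ℕ → ℕ} (hv : Tendsto v atTop atTop)
    (g : ℂ → ℂ) : ¬ TendstoLocallyUniformlyOn (fun k => f^[v k]) g atTop U := by
  intro hg
  obtain ⟨ε, hε, hsens⟩ := h
  have hε4 : 0 < ε / 4 := by linarith
  have hzU : z ∈ U := mem_of_mem_nhds hU
  have hgc : ContinuousAt g z := (hg.continuousOn
    (Eventually.of_forall fun k => (hf.iterate _).continuousOn).frequently).continuousAt hU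
  obtain ⟨s, hs, hsv⟩ := Metric.tendstoLocallyUniformlyOn_iff.1 hg (ε / 4) hε4 z hzU
  rw [nhdsWithin_eq_nhds.2 hU] at hs
  obtain ⟨k, hclose, w₁, hw₁, w₂, hw₂, hfar⟩ :=
    (hsv.and (hv.eventually (hsens _ (inter_mem hs (hgc (ball_mem_nhds _ hε4)))))).exists
  have hw₁g : dist (g w₁) (g z) < ε / 4 := hw₁.2
  have hw₂g : dist (g w₂) (g z) < ε / 4 := hw₂.2
  have hfw₁ := hclose w₁ hw₁.1
  rw [dist_comm] at hfw₁
  linarith [hclose w₂ hw₂.1, dist_triangle4 (f^[v k] w₁) (g w₁) (g w₂) (f^[v k] w₂),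
    dist_triangle_right (g w₁) (g w₂) (g z)]

lemma IsSensitiveSet.subset_julia {f : ℂ → ℂ} (hf : Continuous f) {E : Set ℂ}
    (h : IsSensitiveSet f E) : E ⊆ julia f := by
  rintro z hz ⟨r, hr, hnorm⟩
  obtain ⟨B, hB⟩ := h.bounded
  obtain ⟨v, hv, ⟨g, hg⟩ | hescape⟩ := hnorm id strictMono_id
  · exact (h.sensitive z hz).not_tendstoLocallyUniformlyOn hf (ball_mem_nhds z hr)
      hv.tendsto_atTop g hg
  · obtain ⟨k, hk⟩ :=
      (hescape {z} (singleton_subset_iff.2 (mem_ball_self hr)) isCompact_singleton B).exists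
    exact (hB z hz _).not_gt (hk z rfl)

lemma le_dist_exp {x y : ℂ} (h : dist x y ≤ 1 / 2) :
    Real.exp y.re / 2 * dist x y ≤ dist (Complex.exp x) (Complex.exp y) := by
  rw [dist_eq_norm] at h
  have hquad := Complex.norm_exp_sub_one_sub_id_le (x := x - y) (by linarith)
  have htri := norm_sub_norm_le (x - y) (x - y - (Complex.exp (x - y) - 1))
  rw [sub_sub_cancel, norm_sub_rev (x - y) (Complex.exp (x - y) - 1)] at htri
  have hexp : Complex.exp x - Complex.exp y = Complex.exp y * (Complex.exp (x - y) - 1) := by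
    rw [mul_sub, ← Complex.exp_add, add_sub_cancel, mul_one]
  have hhalf : ‖x - y‖ / 2 ≤ ‖Complex.exp (x - y) - 1‖ := by nlinarith [norm_nonneg (x - y)]
  calc Real.exp y.re / 2 * dist x y = Real.exp y.re * (‖x - y‖ / 2) := by rw [dist_eq_norm]; ring
    _ ≤ Real.exp y.re * ‖Complex.exp (x - y) - 1‖ := by gcongr
    _ = dist (Complex.exp x) (Complex.exp y) := by
      rw [dist_eq_norm, hexp, norm_mul, Complex.norm_exp]

lemma IsCoding.iterate_exp {N : ℕ} {D : Set ℂ} {G : Fin N → ℂ → ℂ}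
    {p : (ℕ → Fin N) → ℂ} {f : ℂ → ℂ} (hp : IsCoding D G p)
    (hconj : ∀ k, ∀ η ∈ D, f (Complex.exp (G k η)) = Complex.exp η) (n : ℕ) (i : ℕ → Fin N) :
    f^[n] (Complex.exp (p i)) = Complex.exp (p fun m => i (m + n)) := by
  induction n generalizing i with
  | zero => rfl
  | succ n ih =>
    rw [Function.iterate_succ_apply, hp.eq i, hconj _ _ (hp.mem _), ih]
    congr 2

namespace SeparatedIFS

variable {N : ℕ} {D : Set ℂ} {G : Fin N → ℂ → ℂ} {a d L δ t : ℝ} {p : (ℕ → Fin N) → ℂ} {f : ℂ → ℂ}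

lemma abs_re_sub_le (h : SeparatedIFS D G a d L δ) {x y : ℂ} (hx : x ∈ D) (hy : y ∈ D) :
    |x.re - y.re| ≤ δ := by
  rw [← Complex.sub_re]
  exact (Complex.abs_re_le_norm _).trans ((dist_eq_norm x y).ge.trans (h.dist_le x hx y hy))

lemma le_dist_exp_branch (h : SeparatedIFS D G a d L δ) (hp : IsCoding D G p) (hδ : L * δ ≤ 1 / 2)
    {x₀ : ℂ} (hx₀ : x₀ ∈ D) (k : Fin N) {n : ℕ} {i j : ℕ → Fin N} (heq : ∀ m < n, i m = j m)
    (hne : i n ≠ j n) :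
    Real.exp (x₀.re - δ) / 2 * (a * d) * a ^ n ≤
      dist (Complex.exp (G k (p i))) (Complex.exp (G k (p j))) := by
  have ha := h.a_pos
  have hd := h.d_pos
  have hhalf : dist (G k (p i)) (G k (p j)) ≤ 1 / 2 :=
    ((h.lip k _ (hp.mem i) _ (hp.mem j)).trans (mul_le_mul_of_nonneg_left
      (h.dist_le _ (hp.mem i) _ (hp.mem j)) h.L_nonneg)).trans hδ
  have hre := (abs_le.1 (h.abs_re_sub_le (h.mapsTo k (hp.mem j)) hx₀)).1
  have hle : a * (d * a ^ n) ≤ dist (G k (p i)) (G k (p j)) :=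
    (mul_le_mul_of_nonneg_left (h.le_dist_coding hp heq hne) ha.le).trans
      (h.antilip k _ (hp.mem i) _ (hp.mem j))
  calc Real.exp (x₀.re - δ) / 2 * (a * d) * a ^ n
      = Real.exp (x₀.re - δ) / 2 * (a * (d * a ^ n)) := by ring
    _ ≤ Real.exp (G k (p j)).re / 2 * dist (G k (p i)) (G k (p j)) := by
      gcongr
      linarith
    _ ≤ _ := le_dist_exp hhalf

lemma isSensitiveAt_exp_coding (h : SeparatedIFS D G a d L δ) (hp : IsCoding D G p)
    (hconj : ∀ k, ∀ η ∈ D, f (Complex.exp (G k η)) = Complex.exp η) {u₁ u₂ : ℕ → Fin N}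
    (hne : Complex.exp (p u₁) ≠ Complex.exp (p u₂)) (i : ℕ → Fin N) :
    IsSensitiveAt f (Complex.exp (p i)) := by
  have hlim : ∀ u, Tendsto (fun n => Complex.exp (p (splice i n u))) atTop
      (𝓝 (Complex.exp (p i))) := fun u =>
    (Complex.continuous_exp.tendsto _).comp (h.tendsto_coding_splice hp i u)
  have hval : ∀ n u, f^[n] (Complex.exp (p (splice i n u))) = Complex.exp (p u) := fun n u => by
    rw [hp.iterate_exp hconj, funext fun m => splice_add i u m n]
  refine ⟨dist (Complex.exp (p u₁)) (Complex.exp (p u₂)), dist_pos.2 hne, fun U hU => ?_⟩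
  filter_upwards [(hlim u₁).eventually hU, (hlim u₂).eventually hU] with n h₁ h₂
  exact ⟨_, h₁, _, h₂, by rw [hval, hval]⟩

lemma exists_isSensitiveSet (h : SeparatedIFS D G a d L δ) (hN : 1 < N) (ht : 0 < t)
    (hNa : 1 ≤ N * a ^ t) (hδ : L * δ ≤ 1 / 2) (hre : ∀ η ∈ D, 0 < η.re)
    (hconj : ∀ k, ∀ η ∈ D, f (Complex.exp (G k η)) = Complex.exp η) :
    ∃ E : Set ℂ, ENNReal.ofReal t ≤ dimH E ∧ IsSensitiveSet f E := by
  obtain ⟨p, hp⟩ := h.exists_isCoding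
  obtain ⟨x₀, hx₀⟩ := h.nonempty
  have ha := h.a_pos
  have hd := h.d_pos
  set k₀ : Fin N := ⟨0, by lia⟩
  set q : (ℕ → Fin N) → (ℕ → Fin N) := splice (fun _ => k₀) 1
  have hq : ∀ i, p (q i) = G k₀ (p i) := fun i => by
    rw [hp.eq, funext fun m => splice_add (fun _ => k₀) i m 1]
    rfl
  set c := Real.exp (x₀.re - δ) / 2 * (a * d)
  have hc : 0 < c := by positivity
  have hsep : ∀ i j n, (∀ m < n, i m = j m) → i n ≠ j n →
      c * a ^ n ≤ dist (Complex.exp (p (q i))) (Complex.exp (p (q j))) := fun i j n heq hne => by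
    rw [hq, hq]
    exact h.le_dist_exp_branch hp hδ hx₀ k₀ heq hne
  have hinj := injective_of_separated ha hc hsep
  refine ⟨range fun i => Complex.exp (p (q i)),
    le_dimH_range_of_separated hN ha hc ht hNa hsep, ?_, ⟨Real.exp (x₀.re + δ), ?_⟩, ?_⟩
  · rintro _ ⟨i, rfl⟩ n
    rw [hp.iterate_exp hconj, Complex.norm_exp]
    exact Real.one_lt_exp_iff.2 (hre _ (hp.mem _))
  · rintro _ ⟨i, rfl⟩ n
    rw [hp.iterate_exp hconj, Complex.norm_exp, Real.exp_le_exp]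
    linarith [(abs_le.1 (h.abs_re_sub_le (hp.mem fun m => q i (m + n)) hx₀)).2]
  · rintro _ ⟨i, rfl⟩
    have hwords : (fun _ => k₀ : ℕ → Fin N) ≠ fun _ => ⟨1, hN⟩ := fun heq => by
      simpa [k₀] using congrFun heq 0
    exact h.isSensitiveAt_exp_coding hp hconj (hinj.ne hwords) (q i)

end SeparatedIFS

/-! ### Branches of the logarithm -/

section Sums

lemma sum_le_mul_harmonic {ι : Type*} {X : ι → ℝ} {A : ℝ} (n : ℕ) (K : Finset ι)
    (hcard : K.card = n) (hA : ∀ k ∈ K, ((K.filter fun j => X k ≤ X j).card : ℝ) * X k ≤ A)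
    (hX : ∀ k ∈ K, 0 ≤ X k) : ∑ k ∈ K, X k ≤ A * (harmonic n : ℝ) := by
  classical
  induction n generalizing K with
  | zero => simp [Finset.card_eq_zero.1 hcard]
  | succ n ih =>
    obtain ⟨k₀, hk₀, hmin⟩ := K.exists_min_image X (Finset.card_pos.1 (by lia))
    have hrest := ih (K.erase k₀) (by rw [Finset.card_erase_of_mem hk₀, hcard, Nat.add_sub_cancel])
      (fun k hk => (mul_le_mul_of_nonneg_right
        (Nat.cast_le.2 (Finset.card_le_card (Finset.filter_subset_filter _ (K.erase_subset k₀))))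
        (hX k (Finset.mem_of_mem_erase hk))).trans (hA k (Finset.mem_of_mem_erase hk)))
      (fun k hk => hX k (Finset.mem_of_mem_erase hk))
    have hleast : X k₀ ≤ A * ((n + 1 : ℕ) : ℝ)⁻¹ := by
      have := hA k₀ hk₀
      rw [Finset.filter_true_of_mem hmin, hcard] at this
      rw [← div_eq_mul_inv, le_div_iff₀ (by positivity)]
      linarith
    rw [← Finset.add_sum_erase K X hk₀, harmonic_succ]
    push_cast at hleast ⊢
    linarith

lemma exists_sum_le_card_mul {ι : Type*} {K : Finset ι} (hK : K.Nonempty) {X : ι → ℝ}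
    (hX : ∀ k ∈ K, 0 ≤ X k) :
    ∃ k ∈ K, ∑ j ∈ K, X j ≤
      (1 + Real.log K.card) * (((K.filter fun j => X k ≤ X j).card : ℝ) * X k) := by
  obtain ⟨k, hk, hmax⟩ := K.exists_max_image
    (fun k => ((K.filter fun j => X k ≤ X j).card : ℝ) * X k) hK
  refine ⟨k, hk, (sum_le_mul_harmonic K.card K rfl hmax hX).trans ?_⟩
  rw [mul_comm]
  exact mul_le_mul_of_nonneg_right (harmonic_le_one_add_log _)
    (mul_nonneg (Nat.cast_nonneg _) (hX k hk))

variable {g : ℝ → ℝ} {w E a b : ℝ}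

lemma integral_le_sum_range (hg : Continuous g) (hw : 0 ≤ w)
    (hE : ∀ y u, |y - u| ≤ w → g y ≤ E * g u) (m : ℤ) (n : ℕ) :
    ∫ y in (w * m)..(w * (m + n)), g y ≤ w * E * ∑ k ∈ Finset.range n, g (w * (m + k)) := by
  have hint : ∀ u v : ℝ, IntervalIntegrable g volume u v := fun u v => hg.intervalIntegrable u v
  have hcell : ∀ u : ℝ, ∫ y in u..(u + w), g y ≤ w * E * g u := fun u => by
    have := intervalIntegral.integral_mono_on (b := u + w) (by linarith) (hint u _)
      (intervalIntegrable_const (c := E * g u)) fun y hy =>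
        hE y u (abs_le.2 ⟨by linarith [hy.1], by linarith [hy.2]⟩)
    rwa [intervalIntegral.integral_const, add_sub_cancel_left, smul_eq_mul, ← mul_assoc] at this
  have hadjacent := intervalIntegral.sum_integral_adjacent_intervals (n := n)
    (a := fun k : ℕ => w * ((m : ℝ) + k)) fun k _ => hint _ _
  rw [Nat.cast_zero, add_zero] at hadjacent
  rw [← hadjacent, Finset.mul_sum]
  refine Finset.sum_le_sum fun k _ => ?_
  rw [Nat.cast_add_one, ← add_assoc, mul_add_one]
  exact hcell _

lemma exists_integral_le_sum (hg : Continuous g) (hg0 : ∀ y, 0 ≤ g y) (hw : 0 < w)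
    (hE : ∀ y u, |y - u| ≤ w → g y ≤ E * g u) (hab : a ≤ b) :
    ∃ Y : Finset ℤ, (Y.card : ℝ) ≤ (b - a) / w + 2 ∧ (∀ k ∈ Y, a - w ≤ w * k ∧ w * k ≤ b) ∧
      ∫ y in a..b, g y ≤ w * E * ∑ k ∈ Y, g (w * k) := by
  set m : ℤ := ⌊a / w⌋
  set n : ℕ := (⌊b / w⌋ - m + 1).toNat
  have hmle : m ≤ ⌊b / w⌋ := Int.floor_le_floor (by gcongr)
  have hnr : (n : ℝ) = (⌊b / w⌋ : ℝ) - m + 1 := by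
    exact_mod_cast Int.toNat_of_nonneg (show 0 ≤ ⌊b / w⌋ - m + 1 by lia)
  have hma := Int.floor_le (a / w)
  have ham := Int.lt_floor_add_one (a / w)
  have hmb := Int.floor_le (b / w)
  have hbm := Int.lt_floor_add_one (b / w)
  rw [le_div_iff₀' hw] at hma hmb
  rw [div_lt_iff₀' hw] at ham hbm
  have hinj : Function.Injective fun k : ℕ => m + (k : ℤ) := fun k l hkl => by simpa using hkl
  refine ⟨(Finset.range n).map ⟨_, hinj⟩, ?_, ?_, ?_⟩
  · rw [Finset.card_map, Finset.card_range, ← sub_le_iff_le_add, le_div_iff₀' hw, hnr]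
    linarith
  · intro k hk
    obtain ⟨j, hj, rfl⟩ := Finset.mem_map.1 hk
    have hjn : w * ((j : ℝ) + 1) ≤ w * n := by
      gcongr
      exact_mod_cast Finset.mem_range.1 hj
    have : 0 ≤ w * j := by positivity
    rw [hnr] at hjn
    simp only [Function.Embedding.coeFn_mk, Int.cast_add, Int.cast_natCast]
    constructor <;> linarith
  · simp only [Finset.sum_map, Function.Embedding.coeFn_mk, Int.cast_add, Int.cast_natCast]
    refine (intervalIntegral.integral_mono_interval hma hab ?_ (Eventually.of_forall hg0)
      (hg.intervalIntegrable _ _)).trans (integral_le_sum_range hg hw.le hE m n)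
    rw [hnr]
    linarith

/- A sum is comparable, up to a logarithm of the number of terms, to the contribution of one of its
level sets. -/
lemma exists_integral_le_card_mul (hg : Continuous g) (hg0 : ∀ y, 0 ≤ g y) (hw : 0 < w)
    (hE0 : 0 ≤ E) (hE : ∀ y u, |y - u| ≤ w → g y ≤ E * g u) (hab : a ≤ b) :
    ∃ (K : Finset ℤ) (k₀ : ℤ),
      (∀ k ∈ K, a - w ≤ w * k ∧ w * k ≤ b ∧ g (w * k₀) ≤ g (w * k)) ∧
      ∫ y in a..b, g y ≤
        w * E * ((1 + Real.log ((b - a) / w + 2)) * (K.card * g (w * k₀))) := by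
  obtain ⟨Y, hcard, hY, hint⟩ := exists_integral_le_sum hg hg0 hw hE hab
  rcases Y.eq_empty_or_nonempty with rfl | hne
  · refine ⟨∅, 0, by simp, by simpa using hint⟩
  obtain ⟨k₀, -, hk₀⟩ := exists_sum_le_card_mul (X := fun k : ℤ => g (w * k)) hne fun _ _ => hg0 _
  refine ⟨Y.filter fun k => g (w * k₀) ≤ g (w * k), k₀, fun k hk => ?_, hint.trans ?_⟩
  · rw [Finset.mem_filter] at hk
    exact ⟨(hY k hk.1).1, (hY k hk.1).2, hk.2⟩
  · refine mul_le_mul_of_nonneg_left (hk₀.trans ?_) (by positivity)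
    have := hg0 (w * k₀)
    have : (0 : ℝ) < Y.card := by exact_mod_cast hne.card_pos
    gcongr

end Sums

/-- `Λ` is a branch of `log F` on `V` with values in `D` that contracts distances at least by the
factor `L` and at most by the factor `a`. -/
structure IsLogBranch (F Λ : ℂ → ℂ) (V D : Set ℂ) (a L : ℝ) : Prop where
  exp_eq : ∀ ξ ∈ V, Complex.exp (Λ ξ) = F ξ
  mapsTo : MapsTo Λ V D
  lip : ∀ ξ ∈ V, ∀ ξ' ∈ V, dist (Λ ξ) (Λ ξ') ≤ L * dist ξ ξ'
  antilip : ∀ ξ ∈ V, ∀ ξ' ∈ V, a * dist ξ ξ' ≤ dist (Λ ξ) (Λ ξ')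

lemma IsLogBranch.mono {F Λ : ℂ → ℂ} {V D : Set ℂ} {a a' L L' : ℝ}
    (h : IsLogBranch F Λ V D a L) (ha : a' ≤ a) (hL : L ≤ L') : IsLogBranch F Λ V D a' L' where
  exp_eq := h.exp_eq
  mapsTo := h.mapsTo
  lip ξ hξ ξ' hξ' := (h.lip ξ hξ ξ' hξ').trans (by gcongr)
  antilip ξ hξ ξ' hξ' := (h.antilip ξ hξ ξ' hξ').trans' (by gcongr)

section LogBranch

variable {F : ℂ → ℂ} {c z w : ℂ} {r ρ C M : ℝ}

lemma exists_log_bilipschitz_on_ball (hr : 0 < r) (hd : DifferentiableOn ℂ F (ball c r))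
    (hi : InjOn F (ball c r)) (hF0 : ∀ z ∈ ball c r, F z ≠ 0) :
    ∃ Λ : ℂ → ℂ, Λ c = Complex.log (F c) ∧ (∀ z ∈ ball c r, Complex.exp (Λ z) = F z) ∧
      ∀ z ∈ closedBall c (r / (8 * koebeConst)), ∀ w ∈ closedBall c (r / (8 * koebeConst)),
        dist (Λ z) (Λ w) ≤ 2 * ‖deriv F c / F c‖ * dist z w ∧
        ‖deriv F c / F c‖ / 2 * dist z w ≤ dist (Λ z) (Λ w) := by
  obtain ⟨Λ, hΛc, hΛ⟩ := exists_log_on_ball hr hd hF0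
  have hΛd : DifferentiableOn ℂ Λ (ball c r) := fun z hz =>
    (hΛ z hz).1.differentiableAt.differentiableWithinAt
  have hΛi : InjOn Λ (ball c r) := fun z hz w hw heq =>
    hi hz hw (by rw [← (hΛ z hz).2, ← (hΛ w hw).2, heq])
  refine ⟨Λ, hΛc, fun z hz => (hΛ z hz).2, fun z hz w hw => ?_⟩
  rw [dist_eq_norm, dist_eq_norm, ← (hΛ c (mem_ball_self hr)).1.deriv]
  exact ⟨norm_sub_le_of_injOn_ball hr hΛd hΛi hz hw, le_norm_sub_of_injOn_ball hr hΛd hΛi hz hw⟩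

lemma norm_logDeriv_le (hr : 0 < r) (hC : 0 ≤ C) (hd : DifferentiableOn ℂ F (ball c r))
    (hM : 0 < M) (hosc : ∀ z ∈ ball c r, ‖F z‖ ≤ C * M ∧ M ≤ C * ‖F z‖) :
    ‖deriv F c / F c‖ ≤ 2 * C ^ 2 / r := by
  have hsub : closedBall c (r / 2) ⊆ ball c r := closedBall_subset_ball (by linarith)
  have hlow := (hosc c (mem_ball_self hr)).2
  have hFc : 0 < ‖F c‖ := pos_of_mul_pos_right (hM.trans_le hlow) hC
  rw [norm_div, div_le_iff₀ hFc]
  calc ‖deriv F c‖ ≤ C * M / (r / 2) :=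
        Complex.norm_deriv_le_of_forall_mem_sphere_norm_le (half_pos hr)
          ((hd.mono hsub).diffContOnCl_ball Subset.rfl)
          fun z hz => (hosc z (hsub (sphere_subset_closedBall hz))).1
    _ ≤ C * (C * ‖F c‖) / (r / 2) := by gcongr
    _ = 2 * C ^ 2 / r * ‖F c‖ := by field_simp

lemma abs_re_sub_log_le (hC : 0 < C) (hM : 0 < M) (hz : ‖Complex.exp z‖ ≤ C * M)
    (hz' : M ≤ C * ‖Complex.exp z‖) : |z.re - Real.log M| ≤ Real.log C := by
  rw [Complex.norm_exp] at hz hz'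
  have hupper := Real.log_le_log (Real.exp_pos _) hz
  have hlower := Real.log_le_log hM hz'
  rw [Real.log_mul hC.ne' hM.ne', Real.log_exp] at hupper
  rw [Real.log_mul hC.ne' (Real.exp_pos _).ne', Real.log_exp] at hlower
  rw [abs_le]
  constructor <;> linarith

lemma mem_closedBall_of_norm_sub_log_le {s l : ℝ} (hre : |z.re - s| ≤ l)
    (hw : ‖z - Complex.log w‖ ≤ 1) : z ∈ closedBall (s : ℂ) (l + 8) := by
  have him := (Complex.abs_im_le_norm _).trans hw
  rw [Complex.sub_im, Complex.log_im] at him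
  have harg := (Complex.abs_arg_le_pi w).trans Real.pi_le_four
  have htriangle := abs_sub_abs_le_abs_sub z.im w.arg
  rw [mem_closedBall_iff_norm]
  refine (Complex.norm_le_abs_re_add_abs_im _).trans ?_
  rw [Complex.sub_re, Complex.sub_im, Complex.ofReal_re, Complex.ofReal_im, sub_zero]
  linarith

lemma exists_isLogBranch (hr : 0 < r) (hC : 0 < C) (hM : 0 < M)
    (hd : DifferentiableOn ℂ F (ball c r)) (hi : InjOn F (ball c r))
    (hosc : ∀ z ∈ ball c r, ‖F z‖ ≤ C * M ∧ M ≤ C * ‖F z‖) (hρ : 0 ≤ ρ)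
    (hρK : 8 * koebeConst * ρ ≤ r) (hρC : 4 * C ^ 2 * ρ ≤ r) :
    ∃ Λ, IsLogBranch F Λ (closedBall c ρ) (closedBall (Real.log M : ℂ) (Real.log C + 8))
      (‖deriv F c / F c‖ / 2) (4 * C ^ 2 / r) := by
  have hF0 : ∀ z ∈ ball c r, F z ≠ 0 := fun z hz =>
    norm_pos_iff.1 (pos_of_mul_pos_right (hM.trans_le (hosc z hz).2) hC.le)
  obtain ⟨Λ, hΛc, hexp, hΛ⟩ := exists_log_bilipschitz_on_ball hr hd hi hF0
  have hK := koebeConst_pos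
  have hsub : closedBall c ρ ⊆ closedBall c (r / (8 * koebeConst)) :=
    closedBall_subset_closedBall ((le_div_iff₀' (by positivity)).2 hρK)
  have hsub' : closedBall c ρ ⊆ ball c r := fun z hz =>
    ball_half_subset_ball hr (hsub hz) (mem_ball_self (half_pos hr))
  have hlip : ∀ z ∈ closedBall c ρ, ∀ w ∈ closedBall c ρ,
      dist (Λ z) (Λ w) ≤ 4 * C ^ 2 / r * dist z w := fun z hz w hw => by
    refine (hΛ z (hsub hz) w (hsub hw)).1.trans (mul_le_mul_of_nonneg_right ?_ dist_nonneg)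
    calc 2 * ‖deriv F c / F c‖ ≤ 2 * (2 * C ^ 2 / r) := by
          gcongr
          exact norm_logDeriv_le hr hC.le hd hM hosc
      _ = 4 * C ^ 2 / r := by ring
  refine ⟨Λ, ⟨fun z hz => hexp z (hsub' hz), fun z hz => ?_, hlip,
    fun z hz w hw => (hΛ z (hsub hz) w (hsub hw)).2⟩⟩
  refine mem_closedBall_of_norm_sub_log_le (w := F c) (abs_re_sub_log_le hC hM ?_ ?_) ?_
  · rw [hexp z (hsub' hz)]
    exact (hosc z (hsub' hz)).1
  · rw [hexp z (hsub' hz)]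
    exact (hosc z (hsub' hz)).2
  · rw [← hΛc, ← dist_eq_norm]
    calc dist (Λ z) (Λ c) ≤ 4 * C ^ 2 / r * dist z c := hlip z hz c (mem_closedBall_self hρ)
      _ ≤ 4 * C ^ 2 / r * ρ := by gcongr; exact hz
      _ = 4 * C ^ 2 * ρ / r := by ring
      _ ≤ 1 := div_le_one_of_le₀ hρC hr.le

end LogBranch

namespace RegularTract

variable {φ : ℂ → ℂ} {α x C T₁ T s y r : ℝ}

lemma osc_of_mem_ball (h : RegularTract φ α x C T₁) (hT : T₁ ≤ T) (hxs : 2 * x ≤ s)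
    (hsT : s ≤ T / 8) (hy : 7 * T / 8 ≤ |y|) (hy' : |y| ≤ 5 * T / 2) {ξ : ℂ}
    (hξ : ξ ∈ ball (s + y * Complex.I : ℂ) (s / 2)) :
    ‖φ ξ‖ ≤ C * ‖φ T‖ ∧ ‖φ T‖ ≤ C * ‖φ ξ‖ := by
  have hx := h.one_le_x
  rw [mem_ball_iff_norm] at hξ
  have hre := abs_le.1 ((Complex.abs_re_le_norm _).trans hξ.le)
  have him := (Complex.abs_im_le_norm _).trans hξ.le
  simp only [Complex.sub_re, Complex.add_re, Complex.re_ofReal_mul, Complex.I_re, mul_zero,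
    add_zero, Complex.ofReal_re] at hre
  simp only [Complex.sub_im, Complex.add_im, Complex.im_ofReal_mul, Complex.I_im, mul_one,
    zero_add, Complex.ofReal_im] at him
  have hupper := abs_sub_abs_le_abs_sub ξ.im y
  have hlower := abs_sub_abs_le_abs_sub y ξ.im
  rw [abs_sub_comm] at hlower
  exact h.osc T hT ξ (by linarith) (by linarith) (by linarith) (Or.inr (by linarith))

lemma le_norm_logDeriv (h : RegularTract φ α x C T₁) (hs : 1 ≤ s)
    (hlow : 0 < ‖φ (s + y * Complex.I)‖) (hup : ‖φ (s + y * Complex.I)‖ ≤ C * ‖φ T‖) :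
    Real.exp (-(koebeConst * Real.log s)) / C *
      (‖deriv φ ((1 : ℝ) + y * Complex.I)‖ / ‖φ (T : ℂ)‖) ≤
      ‖deriv φ (s + y * Complex.I) / φ (s + y * Complex.I)‖ := by
  have hC : 0 < C := zero_lt_one.trans_le h.one_le_C
  have hφT : 0 < ‖φ (T : ℂ)‖ := pos_of_mul_pos_right (hlow.trans_le hup) hC.le
  have hdist := norm_deriv_le_exp_abs_log_mul h.holo h.inj y one_pos (zero_lt_one.trans_le hs)
  rw [one_div, Real.log_inv, abs_neg, abs_of_nonneg (Real.log_nonneg hs)] at hdist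
  rw [norm_div, le_div_iff₀ hlow, Real.exp_neg]
  calc (Real.exp (koebeConst * Real.log s))⁻¹ / C *
        (‖deriv φ ((1 : ℝ) + y * Complex.I)‖ / ‖φ (T : ℂ)‖) * ‖φ (s + y * Complex.I)‖
      ≤ (Real.exp (koebeConst * Real.log s))⁻¹ / C *
        (Real.exp (koebeConst * Real.log s) * ‖deriv φ (s + y * Complex.I)‖ / ‖φ (T : ℂ)‖) *
        (C * ‖φ T‖) := by gcongr
    _ = ‖deriv φ (s + y * Complex.I)‖ := by field_simp

lemma exists_isLogBranch (h : RegularTract φ α x C T₁) (hT : T₁ ≤ T) (hxs : 2 * x ≤ s)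
    (hsT : s ≤ T / 8) (hy : 7 * T / 8 ≤ |y|) (hy' : |y| ≤ 5 * T / 2) (hr : 0 ≤ r)
    (hrK : 16 * koebeConst * r ≤ s) (hrC : 8 * C ^ 2 * r ≤ s) :
    ∃ Λ, IsLogBranch φ Λ (closedBall (s + y * Complex.I) r)
      (closedBall (Real.log ‖φ T‖ : ℂ) (Real.log C + 8))
      (Real.exp (-(koebeConst * Real.log s)) / (2 * C) *
        (‖deriv φ ((1 : ℝ) + y * Complex.I)‖ / ‖φ (T : ℂ)‖)) (8 * C ^ 2 / s) := by
  have hx := h.one_le_x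
  have hC := h.one_le_C
  have hs2 : 0 < s / 2 := by linarith
  have hφT := h.norm_pos T hT
  have hosc := fun ξ => h.osc_of_mem_ball (ξ := ξ) hT hxs hsT hy hy'
  have hsub : ball (s + y * Complex.I : ℂ) (s / 2) ⊆ halfPlane :=
    ball_subset_halfPlane (by simp; linarith)
  obtain ⟨hup, hlow⟩ := hosc _ (mem_ball_self hs2)
  obtain ⟨Λ, hΛ⟩ := Tract.exists_isLogBranch hs2 (zero_lt_one.trans_le hC) hφT (h.holo.mono hsub)
    (h.inj.mono hsub) hosc hr (by linarith) (by linarith)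
  refine ⟨Λ, hΛ.mono ?_ (by field_simp; norm_num)⟩
  calc _ = Real.exp (-(koebeConst * Real.log s)) / C *
        (‖deriv φ ((1 : ℝ) + y * Complex.I)‖ / ‖φ (T : ℂ)‖) / 2 := by ring
    _ ≤ _ := by
      gcongr
      exact h.le_norm_logDeriv (by linarith)
        (pos_of_mul_pos_right (hφT.trans_le hlow) (by linarith)) hup

lemma exists_log_norm_le (h : RegularTract φ α x C T₁) :
    ∃ B ≥ 1, ∀ᶠ T : ℝ in atTop, Real.log ‖φ (T : ℂ)‖ ≤ B * Real.log T := by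
  have hC := h.one_le_C
  have hK := koebeConst_pos
  have hone : 0 < ‖deriv φ 1‖ := by simpa using h.norm_deriv_pos 0
  set l := Real.log (C * ‖deriv φ 1‖)
  refine ⟨|l| + 1 + koebeConst, by linarith [abs_nonneg l], ?_⟩
  filter_upwards [eventually_ge_atTop T₁, Real.tendsto_log_atTop.eventually_ge_atTop 1]
    with T hT hlog
  have hT0 := h.pos_of_le hT
  have hdist := norm_deriv_le_exp_abs_log_mul h.holo h.inj 0 hT0 one_pos
  simp only [Complex.ofReal_zero, zero_mul, add_zero, div_one, Complex.ofReal_one] at hdist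
  rw [abs_of_nonneg (by linarith)] at hdist
  have hpoly : ‖φ T‖ ≤ C * ‖deriv φ 1‖ * (T * Real.exp (koebeConst * Real.log T)) :=
    calc ‖φ T‖ ≤ C * (T * ‖deriv φ T‖) := h.le_deriv T hT
      _ ≤ C * (T * (Real.exp (koebeConst * Real.log T) * ‖deriv φ 1‖)) := by gcongr
      _ = _ := by ring
  calc Real.log ‖φ T‖ ≤ l + (Real.log T + koebeConst * Real.log T) := by
        rw [← Real.log_exp (koebeConst * Real.log T),
          ← Real.log_mul hT0.ne' (Real.exp_pos _).ne',
          ← Real.log_mul (by positivity) (by positivity)]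
        exact Real.log_le_log (h.norm_pos T hT) hpoly
    _ ≤ |l| * Real.log T + (Real.log T + koebeConst * Real.log T) := by
        gcongr
        exact (le_abs_self l).trans (le_mul_of_one_le_right (abs_nonneg l) hlog)
    _ = _ := by ring

end RegularTract

/-! ### From integral means to iterated function systems -/

section Growth

variable {A B C K T ε t w : ℝ}

lemma one_add_log_add_two_le (hT : 2 ≤ T) (hlog : 1 ≤ Real.log T) :
    1 + Real.log (T + 2) ≤ 3 * Real.log T := by
  have hmul : Real.log (T + 2) ≤ Real.log (T * T) := Real.log_le_log (by linarith) (by nlinarith)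
  rw [Real.log_mul (by linarith) (by linarith)] at hmul
  linarith

lemma eventually_log_mul_le_rpow (hε : 0 < ε) (ht : 0 < t) (hA : 0 ≤ A) (hB : 0 < B) (hC : 0 < C)
    (hK : 0 < K) :
    ∀ᶠ T : ℝ in atTop, ∀ s : ℝ, 1 ≤ s → s ≤ B * Real.log T →
      A * (1 + Real.log (T + 2)) * (C * Real.exp (K * Real.log s)) ^ t ≤ T ^ ε := by
  set M : ℝ := A * 3 * (C * B ^ K) ^ t + 1
  have hM : 0 < M := by positivity
  filter_upwards [(isLittleO_log_rpow_rpow_atTop (1 + K * t) hε).bound (inv_pos.2 hM),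
    eventually_ge_atTop 2, Real.tendsto_log_atTop.eventually_ge_atTop 1]
    with T hlittle hT hlog s hs hsB
  have hlog0 : 0 < Real.log T := by linarith
  rw [Real.norm_of_nonneg (by positivity), Real.norm_of_nonneg (by positivity)] at hlittle
  have hexp : Real.exp (K * Real.log s) ≤ B ^ K * Real.log T ^ K := by
    rw [mul_comm K, ← Real.rpow_def_of_pos (by linarith), ← Real.mul_rpow hB.le hlog0.le]
    exact Real.rpow_le_rpow (by linarith) hsB hK.le
  calc A * (1 + Real.log (T + 2)) * (C * Real.exp (K * Real.log s)) ^ t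
      ≤ A * (3 * Real.log T) * (C * (B ^ K * Real.log T ^ K)) ^ t := by
        gcongr
        exact one_add_log_add_two_le hT hlog
    _ = A * 3 * (C * B ^ K) ^ t * (Real.log T * (Real.log T ^ K) ^ t) := by
      rw [← mul_assoc C, Real.mul_rpow (by positivity) (by positivity)]
      ring
    _ = A * 3 * (C * B ^ K) ^ t * Real.log T ^ (1 + K * t) := by
      rw [Real.rpow_add hlog0, Real.rpow_one, Real.rpow_mul hlog0.le]
    _ ≤ M * Real.log T ^ (1 + K * t) := by
      gcongr
      exact le_add_of_nonneg_right zero_le_one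
    _ ≤ M * (M⁻¹ * T ^ ε) := by gcongr
    _ = T ^ ε := mul_inv_cancel_left₀ hM.ne' _

lemma one_le_mul_rpow_of_rpow_le {n a : ℝ} (hC : 0 < C) (ha : 0 ≤ a)
    (h : (C * Real.exp K) ^ t ≤ n * a ^ t) : 1 ≤ n * (Real.exp (-K) / C * a) ^ t := by
  have hdiv : Real.exp (-K) / C * a = a / (C * Real.exp K) := by
    rw [Real.exp_neg]
    field_simp
  rwa [hdiv, Real.div_rpow ha (by positivity), ← mul_div_assoc, le_div_iff₀ (by positivity),
    one_mul]

lemma eventually_mul_log_le (B : ℝ) {c : ℝ} (hc : 0 < c) :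
    ∀ᶠ T : ℝ in atTop, B * Real.log T ≤ c * T := by
  filter_upwards [(Real.isLittleO_log_id_atTop.const_mul_left B).bound hc, eventually_ge_atTop 0]
    with T hT hT0
  rw [Real.norm_eq_abs, id, Real.norm_of_nonneg hT0] at hT
  exact (le_abs_self _).trans hT

lemma exists_interval_add_integral_le (hw : 0 ≤ w) (hT : 8 * w ≤ T) (g : ℝ → ℝ) :
    ∃ a b : ℝ, a ≤ b ∧ b - a = T ∧
      (∀ y, a - w ≤ y → y ≤ b → 7 * T / 8 ≤ |y| ∧ |y| ≤ 5 * T / 2) ∧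
      (∫ y in T..(2 * T), g y) + ∫ y in (-(2 * T))..(-T), g y ≤ 2 * ∫ y in a..b, g y := by
  rcases le_total (∫ y in (-(2 * T))..(-T), g y) (∫ y in T..(2 * T), g y) with hle | hle
  · refine ⟨T, 2 * T, by linarith, by ring, fun y hay hyb => ?_, by linarith⟩
    rw [abs_of_nonneg (by linarith)]
    constructor <;> linarith
  · refine ⟨-(2 * T), -T, by linarith, by ring, fun y hay hyb => ?_, by linarith⟩
    rw [abs_of_nonpos (by linarith)]
    constructor <;> linarith

end Growth

namespace RegularTract

variable {φ : ℂ → ℂ} {α x C T₁ T t w : ℝ}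

lemma norm_deriv_rpow_le (h : RegularTract φ α x C T₁) (ht : 0 ≤ t) {y u : ℝ}
    (hyu : |y - u| ≤ w) :
    ‖deriv φ ((1 : ℝ) + y * Complex.I)‖ ^ t ≤
      Real.exp (koebeConst * w) ^ t * ‖deriv φ ((1 : ℝ) + u * Complex.I)‖ ^ t := by
  have hK := koebeConst_pos
  have hdist := norm_deriv_le_exp_mul_of_le_re h.holo h.inj one_pos
    (z := (1 : ℝ) + u * Complex.I) (w := (1 : ℝ) + y * Complex.I) (by simp) (by simp)
  rw [add_sub_add_left_eq_sub, ← sub_mul, norm_mul, Complex.norm_I, mul_one,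
    ← Complex.ofReal_sub, Complex.norm_real, Real.norm_eq_abs, div_one] at hdist
  rw [← Real.mul_rpow (Real.exp_pos _).le (norm_nonneg _)]
  refine Real.rpow_le_rpow (norm_nonneg _) (hdist.trans ?_) ht
  gcongr

lemma exists_integral_le_card_mul (h : RegularTract φ α x C T₁) (ht : 0 ≤ t) (hw : 1 ≤ w)
    (hT : 8 * w ≤ T) :
    ∃ (K : Finset ℤ) (k₀ : ℤ),
      (∀ k ∈ K, 7 * T / 8 ≤ |w * k| ∧ |w * k| ≤ 5 * T / 2 ∧
        ‖deriv φ ((1 : ℝ) + (w * k₀ : ℝ) * Complex.I)‖ ^ t ≤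
          ‖deriv φ ((1 : ℝ) + (w * k : ℝ) * Complex.I)‖ ^ t) ∧
      (∫ y in T..(2 * T), ‖deriv φ ((1 : ℝ) + y * Complex.I)‖ ^ t) +
          ∫ y in (-(2 * T))..(-T), ‖deriv φ ((1 : ℝ) + y * Complex.I)‖ ^ t ≤
        2 * (w * Real.exp (koebeConst * w) ^ t) * (1 + Real.log (T + 2)) *
          (K.card * ‖deriv φ ((1 : ℝ) + (w * k₀ : ℝ) * Complex.I)‖ ^ t) := by
  have hw0 : 0 < w := by linarith
  obtain ⟨a, b, hab, hlen, hrange, hsum⟩ := exists_interval_add_integral_le hw0.le hT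
    fun y => ‖deriv φ ((1 : ℝ) + y * Complex.I)‖ ^ t
  obtain ⟨K, k₀, hK, hint⟩ := Tract.exists_integral_le_card_mul
    (g := fun y : ℝ => ‖deriv φ ((1 : ℝ) + y * Complex.I)‖ ^ t)
    ((continuous_deriv_line h.holo one_pos).norm.rpow_const fun _ => Or.inr ht)
    (fun y => by positivity) hw0 (by positivity) (fun y u => h.norm_deriv_rpow_le ht) hab
  refine ⟨K, k₀, fun k hk => ?_, hsum.trans ?_⟩
  · obtain ⟨hak, hkb, hle⟩ := hK k hk
    exact ⟨(hrange _ hak hkb).1, (hrange _ hak hkb).2, hle⟩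
  · have hT0 : 0 < T := by linarith
    have hlog : Real.log ((b - a) / w + 2) ≤ Real.log (T + 2) := by
      rw [hlen]
      gcongr
      exact div_le_self hT0.le hw
    have : 0 ≤ Real.log (T + 2) := Real.log_nonneg (by linarith)
    calc _ ≤ 2 * (w * Real.exp (koebeConst * w) ^ t * ((1 + Real.log (T + 2)) *
          (K.card * ‖deriv φ ((1 : ℝ) + (w * k₀ : ℝ) * Complex.I)‖ ^ t))) := by
          grw [hint, hlog]
      _ = _ := by ring

lemma exists_large_deriv (h : RegularTract φ α x C T₁) (ht : 0 < t) (hw : 1 ≤ w)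
    (hb : 0 < bInf φ t) (S₀ : ℝ) :
    ∃ T s : ℝ, T₁ ≤ T ∧ s = Real.log ‖φ (T : ℂ)‖ ∧ S₀ ≤ s ∧ s ≤ T / 8 ∧
      ∃ (a : ℝ) (K : Finset ℤ), 0 < a ∧
        1 ≤ K.card * (Real.exp (-(koebeConst * Real.log s)) / (2 * C) * a) ^ t ∧
        ∀ k ∈ K, 7 * T / 8 ≤ |w * k| ∧ |w * k| ≤ 5 * T / 2 ∧
          a ≤ ‖deriv φ ((1 : ℝ) + (w * k : ℝ) * Complex.I)‖ / ‖φ (T : ℂ)‖ := by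
  have hC : 0 < C := zero_lt_one.trans_le h.one_le_C
  obtain ⟨ε, hε, hfreq⟩ := h.frequently_integral_ge hb
  obtain ⟨B, hB, hlogle⟩ := h.exists_log_norm_le
  have hgrow := eventually_log_mul_le_rpow (A := 2 * (w * Real.exp (koebeConst * w) ^ t))
    (C := 2 * C) hε ht (by positivity) (zero_lt_one.trans_le hB) (by positivity) koebeConst_pos
  obtain ⟨T, hint, hT, hTlog, hTgrow, hT8, hTS, hTw⟩ := (hfreq.and_eventually
    ((eventually_ge_atTop T₁).and (hlogle.and (hgrow.and ((eventually_mul_log_le B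
      (c := 1 / 8) (by norm_num)).and (((Real.tendsto_log_atTop.comp
        h.tendsto).eventually_ge_atTop (max S₀ 1)).and (eventually_ge_atTop (8 * w)))))))).exists
  obtain ⟨K, k₀, hK, hsum⟩ := h.exists_integral_le_card_mul ht.le hw hTw
  have hφT := h.norm_pos T hT
  set s := Real.log ‖φ (T : ℂ)‖
  set u := ‖deriv φ ((1 : ℝ) + (w * k₀ : ℝ) * Complex.I)‖
  have hu : 0 < u := h.norm_deriv_pos _
  refine ⟨T, s, hT, rfl, (le_max_left _ _).trans hTS, by linarith, u / ‖φ T‖, K, by positivity,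
    ?_, fun k hk => ?_⟩
  · have hlog : 0 ≤ Real.log (T + 2) := Real.log_nonneg (by linarith)
    refine one_le_mul_rpow_of_rpow_le (by positivity) (by positivity) (le_of_mul_le_mul_left
      (((hTgrow s ((le_max_right _ _).trans hTS) hTlog).trans hint).trans ?_)
      (show 0 < 2 * (w * Real.exp (koebeConst * w) ^ t) * (1 + Real.log (T + 2)) by positivity))
    rw [Real.div_rpow hu.le hφT.le, Real.rpow_neg hφT.le]
    calc _ ≤ (‖φ T‖ ^ t)⁻¹ * (2 * (w * Real.exp (koebeConst * w) ^ t) *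
          (1 + Real.log (T + 2)) * (K.card * u ^ t)) := by gcongr
      _ = _ := by ring
  · obtain ⟨hlow, hup, hle⟩ := hK k hk
    refine ⟨hlow, hup, ?_⟩
    gcongr
    exact (Real.rpow_le_rpow_iff hu.le (norm_nonneg _) ht).1 hle

end RegularTract

section IFS

lemma exists_pos_forall_le_dist {ι X : Type*} [Finite ι] [MetricSpace X] {S : ι → Set X}
    (hS : ∀ k, IsCompact (S k)) (hdisj : Pairwise fun k l => Disjoint (S k) (S l)) :
    ∃ d > (0 : ℝ), ∀ k l, k ≠ l → ∀ x ∈ S k, ∀ y ∈ S l, d ≤ dist x y := by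
  have hev : ∀ᶠ d in 𝓝[>] (0 : ℝ), ∀ k l, k ≠ l → ∀ x ∈ S k, ∀ y ∈ S l, d ≤ dist x y := by
    refine eventually_all.2 fun k => eventually_all.2 fun l => ?_
    by_cases hkl : k = l
    · exact Eventually.of_forall fun d hne => absurd hkl hne
    obtain ⟨δ, hδ, hthick⟩ := (hdisj hkl).exists_thickenings (hS k) (hS l).isClosed
    filter_upwards [Ioo_mem_nhdsGT hδ] with d hd _ x hx y hy
    by_contra! hlt
    exact Set.disjoint_left.1 hthick
      (mem_thickening_iff.2 ⟨x, hx, by rw [dist_comm]; exact hlt.trans hd.2⟩)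
      (self_subset_thickening hδ _ hy)
  obtain ⟨d, hd, hd0⟩ := (hev.and self_mem_nhdsWithin).exists
  exact ⟨d, hd0, hd⟩

lemma SeparatedIFS.one_lt_card {X : Type*} [MetricSpace X] {N : ℕ} {D : Set X}
    {G : Fin N → X → X} {a d L δ t : ℝ} (h : SeparatedIFS D G a d L δ) (hD : D.Nontrivial)
    (ht : 0 < t) (hN : 1 ≤ N * a ^ t) : 1 < N := by
  obtain ⟨x, hx, y, hy, hxy⟩ := hD
  have hpos : 0 < N := by
    rw [Nat.pos_iff_ne_zero]
    rintro rfl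
    norm_num at hN
  have ha : a < 1 := (le_of_mul_le_mul_right ((h.antilip ⟨0, hpos⟩ x hx y hy).trans
    (h.lip ⟨0, hpos⟩ x hx y hy)) (dist_pos.2 hxy)).trans_lt h.L_lt_one
  have hat : a ^ t < 1 := Real.rpow_lt_one h.a_pos.le ha ht
  have : 0 < a ^ t := Real.rpow_pos_of_pos h.a_pos t
  have : (1 : ℝ) < N := by nlinarith
  exact_mod_cast this

lemma exists_separatedIFS {N : ℕ} {φ : ℂ → ℂ} {Λ : Fin N → ℂ → ℂ} {U D : Set ℂ}
    {V : Fin N → Set ℂ} {v : Fin N → ℂ} {a L δ : ℝ} (hφ : InjOn φ U) (hD : IsCompact D)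
    (hne : D.Nonempty) (hδ : ∀ η ∈ D, ∀ η' ∈ D, dist η η' ≤ δ) (ha : 0 < a) (hL : 0 ≤ L)
    (hL1 : L < 1) (hΛ : ∀ k, IsLogBranch φ (Λ k) (V k) D a L) (hVU : ∀ k, V k ⊆ U)
    (hDV : ∀ k, ∀ η ∈ D, η + v k ∈ V k) (hv : Pairwise fun k l => δ < dist (v k) (v l)) :
    ∃ d, SeparatedIFS D (fun k η => Λ k (η + v k)) a d L δ := by
  have hlip : ∀ k, ∀ η ∈ D, ∀ η' ∈ D, dist (Λ k (η + v k)) (Λ k (η' + v k)) ≤ L * dist η η' :=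
    fun k η hη η' hη' => by
      simpa only [dist_add_right] using (hΛ k).lip _ (hDV k η hη) _ (hDV k η' hη')
  have hcomp : ∀ k, IsCompact ((fun η => Λ k (η + v k)) '' D) := fun k =>
    hD.image_of_continuousOn (LipschitzOnWith.of_dist_le_mul (K := L.toNNReal)
      fun η hη η' hη' => by rw [Real.coe_toNNReal L hL]; exact hlip k η hη η' hη').continuousOn
  have hdisj : Pairwise fun k l =>
      Disjoint ((fun η => Λ k (η + v k)) '' D) ((fun η => Λ l (η + v l)) '' D) := by
    refine fun k l hkl => Set.disjoint_left.2 ?_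
    rintro _ ⟨η, hη, rfl⟩ ⟨η', hη', heq⟩
    have hshift : η' + v l = η + v k := by
      refine hφ (hVU l (hDV l η' hη')) (hVU k (hDV k η hη)) ?_
      rw [← (hΛ l).exp_eq _ (hDV l η' hη'), ← (hΛ k).exp_eq _ (hDV k η hη)]
      exact congrArg _ heq
    have hdist : dist (v k) (v l) = dist η' η := by
      rw [dist_eq_norm, dist_eq_norm]
      congr 1
      linear_combination -hshift
    exact (hv hkl).not_ge (hdist.trans_le (hδ η' hη' η hη))
  obtain ⟨d, hd0, hd⟩ := exists_pos_forall_le_dist hcomp hdisj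
  exact ⟨d, hD.isClosed, hne, hδ, ha, hd0, hL, hL1, fun k η hη => (hΛ k).mapsTo (hDV k η hη), hlip,
    fun k η hη η' hη' => by
      simpa only [dist_add_right] using (hΛ k).antilip _ (hDV k η hη) _ (hDV k η' hη'),
    fun k l hkl η hη η' hη' => hd k l hkl _ (mem_image_of_mem _ hη) _ (mem_image_of_mem _ hη')⟩

end IFS

lemma le_abs_mul_intCast_sub {w : ℝ} (hw : 0 ≤ w) {m n : ℤ} (hmn : m ≠ n) :
    w ≤ |w * m - w * n| := by
  rw [← mul_sub, abs_mul, abs_of_nonneg hw]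
  exact le_mul_of_one_le_right hw (by exact_mod_cast Int.one_le_abs (sub_ne_zero.2 hmn))

lemma mul_exp_add_mul_I_sub_log {R : ℝ} (hR : 0 < R) (η : ℂ) (n : ℤ) :
    R * Complex.exp (η + ((2 * Real.pi * n : ℝ) * Complex.I - Real.log R)) = Complex.exp η := by
  have hperiod : Complex.exp ((2 * Real.pi * n : ℝ) * Complex.I) = 1 :=
    Complex.exp_eq_one_iff.2 ⟨n, by push_cast; ring⟩
  have hR0 : (R : ℂ) ≠ 0 := Complex.ofReal_ne_zero.2 hR.ne'
  rw [Complex.exp_add, Complex.exp_sub, hperiod, ← Complex.ofReal_exp, Real.exp_log hR]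
  field_simp

namespace RegularTract

variable {φ : ℂ → ℂ} {α x C T₁ T s r ρ a t : ℝ}

lemma exists_separatedIFS (h : RegularTract φ α x C T₁) (hT : T₁ ≤ T)
    (hs : s = Real.log ‖φ (T : ℂ)‖) (hsT : s ≤ T / 8) (hxs : 2 * x ≤ s)
    (hr : r = Real.log C + 8) (hρ : 0 ≤ ρ) (hrK : 16 * koebeConst * (r + ρ) ≤ s)
    (hrC : 32 * C ^ 2 * (r + ρ) ≤ s) (ha : 0 < a) {N : ℕ} {y : Fin N → ℝ}
    (hy : ∀ k, 7 * T / 8 ≤ |y k| ∧ |y k| ≤ 5 * T / 2 ∧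
      a ≤ ‖deriv φ ((1 : ℝ) + y k * Complex.I)‖ / ‖φ (T : ℂ)‖)
    (hsep : Pairwise fun k l => 2 * r < |y k - y l|) :
    ∃ (Λ : Fin N → ℂ → ℂ) (d : ℝ),
      SeparatedIFS (closedBall (s : ℂ) r) (fun k η => Λ k (η + (y k * Complex.I - ρ)))
        (Real.exp (-(koebeConst * Real.log s)) / (2 * C) * a) d (8 * C ^ 2 / s) (2 * r) ∧
      ∀ k, ∀ η ∈ closedBall (s : ℂ) r, η + (y k * Complex.I - ρ) ∈ halfPlane ∧
        Complex.exp (Λ k (η + (y k * Complex.I - ρ))) = φ (η + (y k * Complex.I - ρ)) := by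
  have hC := h.one_le_C
  have hC2 : 1 ≤ C ^ 2 := one_le_pow₀ hC
  have hr0 : 8 ≤ r := by linarith [Real.log_nonneg hC]
  have hrs : r + ρ < s := by nlinarith
  have hs0 : 0 < s := by linarith
  have hbranch : ∀ k, ∃ Λ, IsLogBranch φ Λ (closedBall (s + y k * Complex.I) (r + ρ))
      (closedBall (s : ℂ) r) (Real.exp (-(koebeConst * Real.log s)) / (2 * C) * a)
      (8 * C ^ 2 / s) := fun k => by
    obtain ⟨hlow, hup, hak⟩ := hy k
    obtain ⟨Λ, hΛ⟩ := h.exists_isLogBranch hT hxs hsT hlow hup (r := r + ρ) (by linarith) hrK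
      (by nlinarith)
    rw [← hs, ← hr] at hΛ
    exact ⟨Λ, hΛ.mono (by gcongr) le_rfl⟩
  choose Λ hΛ using hbranch
  have hV : ∀ k, closedBall (s + y k * Complex.I : ℂ) (r + ρ) ⊆ halfPlane := fun k =>
    closedBall_subset_halfPlane (by simpa using hrs)
  have hshift : ∀ k, ∀ η ∈ closedBall (s : ℂ) r,
      η + (y k * Complex.I - ρ) ∈ closedBall (s + y k * Complex.I : ℂ) (r + ρ) := by
    intro k η hη
    rw [mem_closedBall_iff_norm] at hη ⊢
    calc _ = ‖(η - s) - ρ‖ := by ring_nf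
      _ ≤ ‖η - s‖ + ‖(ρ : ℂ)‖ := norm_sub_le _ _
      _ ≤ r + ρ := by rw [Complex.norm_real, Real.norm_of_nonneg hρ]; gcongr
  have hdist : Pairwise fun k l =>
      2 * r < dist (y k * Complex.I - ρ : ℂ) (y l * Complex.I - ρ) := fun k l hkl =>
    (hsep hkl).trans_eq (by
      rw [dist_sub_right, dist_eq_norm, ← sub_mul, norm_mul, Complex.norm_I, mul_one,
        ← Complex.ofReal_sub, Complex.norm_real, Real.norm_eq_abs])
  obtain ⟨d, hd⟩ := Tract.exists_separatedIFS h.inj (isCompact_closedBall (s : ℂ) r)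
    (nonempty_closedBall.2 (by linarith)) (fun η hη η' hη' => by
      linarith [dist_triangle_right η η' s, mem_closedBall.1 hη, mem_closedBall.1 hη'])
    (by positivity) (by positivity) ((div_lt_one hs0).2 (by nlinarith)) hΛ hV hshift hdist
  exact ⟨Λ, d, hd, fun k η hη => ⟨hV k (hshift k η hη), (hΛ k).exp_eq _ (hshift k η hη)⟩⟩

/- The lattice points `yₖ` lie in `2πℤ`, so that `exp` does not see the translations `iyₖ`; with
`ρ = log R` every branch `η ↦ Λₖ(η + iyₖ - ρ)` is then conjugated by `exp` to an inverse branch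
of `f`. -/
lemma exists_isSensitiveSet (h : RegularTract φ α x C T₁) {f : ℂ → ℂ} {R : ℝ} (hR : 1 ≤ R)
    (hf : ∀ ξ ∈ halfPlane, f (φ ξ) = R * Complex.exp ξ) (ht : 0 < t) (hb : 0 < bInf φ t) :
    ∃ E : Set ℂ, ENNReal.ofReal t ≤ dimH E ∧ IsSensitiveSet f E := by
  have hR0 : 0 < R := by linarith
  have hC := h.one_le_C
  have hC2 : 1 ≤ C ^ 2 := one_le_pow₀ hC
  have hρ : 0 ≤ Real.log R := Real.log_nonneg hR
  obtain ⟨r, hr⟩ : ∃ r, r = Real.log C + 8 := ⟨_, rfl⟩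
  have hr0 : 8 ≤ r := by linarith [Real.log_nonneg hC]
  set q : ℤ := ⌈2 * r⌉
  have hq : 2 * r ≤ q := Int.le_ceil _
  have hw : (q : ℝ) < 2 * Real.pi * q := by nlinarith [Real.pi_gt_three]
  obtain ⟨T, s, hT, hs, hsS, hsT, a, K, ha, hcard, hK⟩ := h.exists_large_deriv ht
    (by linarith : 1 ≤ 2 * Real.pi * q) hb
    (max (2 * x) (max (16 * koebeConst * (r + Real.log R)) (32 * C ^ 2 * (r + Real.log R))))
  rw [max_le_iff, max_le_iff] at hsS
  obtain ⟨hxs, hrK, hrC⟩ := hsS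
  set y : Fin K.card → ℝ := fun k => 2 * Real.pi * q * (K.equivFin.symm k : ℤ) with hy
  have hsep : Pairwise fun k l => 2 * r < |y k - y l| := fun k l hkl => by
    exact (hq.trans_lt hw).trans_le <| le_abs_mul_intCast_sub (by linarith)
      fun heq => hkl (K.equivFin.symm.injective (Subtype.ext heq))
  obtain ⟨Λ, d, hIFS, hΛ⟩ := h.exists_separatedIFS hT hs hsT hxs hr hρ hrK hrC ha
    (y := y) (fun k => hK _ (K.equivFin.symm k).2) hsep
  have hs0 : 0 < s := by nlinarith
  have hnontrivial : (closedBall (s : ℂ) r).Nontrivial :=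
    ⟨s, mem_closedBall_self (by linarith), s + 1, by simp; linarith, by simp⟩
  refine hIFS.exists_isSensitiveSet (hIFS.one_lt_card hnontrivial ht hcard) ht hcard ?_
    (fun η hη => closedBall_subset_halfPlane (by simp; nlinarith) hη) fun k η hη => ?_
  · rw [div_mul_eq_mul_div, div_le_iff₀ hs0]
    nlinarith
  · rw [(hΛ k η hη).2, hf _ (hΛ k η hη).1]
    have hyk : y k = 2 * Real.pi * (q * (K.equivFin.symm k : ℤ) : ℤ) := by
      simp only [hy]
      push_cast
      ring
    rw [hyk, mul_exp_add_mul_I_sub_log hR0]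

end RegularTract

/-! ### Change of level, models and entire functions -/

section Levels

variable {f : ℂ → ℂ} {R R' α : ℝ} {Ω Ω' : Set ℂ} {φ ψ : ℂ → ℂ} {ξ z : ℂ}

lemma lt_mul_exp_iff {x : ℝ} (hR : 0 < R) (hR' : 0 < R') :
    R' < R * Real.exp x ↔ Real.log (R' / R) < x := by
  rw [Real.log_lt_iff_lt_exp (div_pos hR' hR), div_lt_iff₀ hR, mul_comm]

lemma eqOn_const_of_exp_eqOn_const {U : Set ℂ} (hU : IsOpen U) (hc : IsPreconnected U)
    {v : ℂ → ℂ} (hv : DifferentiableOn ℂ v U) {a : ℂ} (hexp : ∀ ξ ∈ U, Complex.exp (v ξ) = a)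
    (hz : z ∈ U) (hξ : ξ ∈ U) : v ξ = v z := by
  refine hU.is_const_of_deriv_eq_zero hc hv (fun η hη => ?_) hξ hz
  have hd := (hv.differentiableAt (hU.mem_nhds hη)).hasDerivAt.cexp
  have h0 : HasDerivAt (fun ξ => Complex.exp (v ξ)) 0 η :=
    (hasDerivAt_const η a).congr_of_eventuallyEq (by
      filter_upwards [hU.mem_nhds hη] with ζ hζ using hexp ζ hζ)
  exact (mul_eq_zero.1 (hd.unique h0)).resolve_left (Complex.exp_ne_zero _)

namespace IsTractMap

lemma norm_eq (h : IsTractMap f R Ω φ) (hR : 0 < R) (hξ : ξ ∈ halfPlane) :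
    ‖f (φ ξ)‖ = R * Real.exp ξ.re := by
  rw [h.eq_exp ξ hξ, norm_mul, Complex.norm_exp, Complex.norm_real, Real.norm_of_nonneg hR.le]

lemma connectedComponentIn_eq (h : IsTractMap f R Ω φ) (hΩ : Ω ∈ tracts f R) (hR : 0 < R)
    (hRR' : R ≤ R') (hz : z ∈ Ω) (hfz : R' < ‖f z‖) :
    connectedComponentIn {w | R' < ‖f w‖} z = φ '' {ξ | Real.log (R' / R) < ξ.re} := by
  have hR' : 0 < R' := hR.trans_le hRR'
  have hsub : {ξ : ℂ | Real.log (R' / R) < ξ.re} ⊆ halfPlane := fun ξ hξ =>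
    (Real.log_nonneg ((one_le_div hR).2 hRR')).trans_lt hξ
  have hsurj : ∀ w ∈ Ω, R' < ‖f w‖ → w ∈ φ '' {ξ | Real.log (R' / R) < ξ.re} := by
    intro w hw hfw
    obtain ⟨ξ, hξ, rfl⟩ := h.bij.surjOn hw
    rw [h.norm_eq hR hξ, lt_mul_exp_iff hR hR'] at hfw
    exact ⟨ξ, hfw, rfl⟩
  obtain ⟨z₀, -, rfl⟩ := hΩ
  refine Subset.antisymm (fun w hw => hsurj w ?_ (connectedComponentIn_subset _ z hw :)) ?_
  · rw [_root_.connectedComponentIn_eq hz]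
    exact connectedComponentIn_mono z (fun v hv => hRR'.trans_lt hv) hw
  · refine IsPreconnected.subset_connectedComponentIn
      ((convex_halfSpace_re_gt _).isPreconnected.image φ (h.holo.continuousOn.mono hsub))
      (hsurj z hz hfz) ?_
    rintro _ ⟨ξ, hξ, rfl⟩
    rwa [mem_ofPred_eq, h.norm_eq hR (hsub hξ), lt_mul_exp_iff hR hR']

lemma exp_sub_eq (h : IsTractMap f R Ω φ) (h' : IsTractMap f R' Ω' ψ) (hR : R ≠ 0) {η : ℂ}
    (hη : η ∈ halfPlane) (hξ : ξ ∈ halfPlane) (heq : φ η = ψ ξ) :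
    Complex.exp (η - ξ) = R' / R := by
  rw [Complex.exp_sub, div_eq_div_iff (Complex.exp_ne_zero _) (by exact_mod_cast hR), mul_comm,
    ← h.eq_exp η hη, heq, h'.eq_exp ξ hξ]

/- `φ⁻¹ ∘ ψ - id` is holomorphic and its exponential is constant. -/
lemma exists_shift (h : IsTractMap f R Ω φ) (h' : IsTractMap f R' Ω' ψ) (hR : 0 < R)
    (hR' : 0 < R') (hΩ : Ω' ⊆ Ω) :
    ∃ c : ℂ, c.re = Real.log (R' / R) ∧ ∀ ξ ∈ halfPlane, 0 < (ξ + c).re ∧ ψ ξ = φ (ξ + c) := by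
  obtain ⟨τ, hτ, hφτ⟩ : ∃ τ : ℂ → ℂ, DifferentiableOn ℂ τ Ω ∧
      ∀ w ∈ Ω, τ w ∈ halfPlane ∧ φ (τ w) = w :=
    ⟨Function.invFunOn φ halfPlane, h.bij.image_eq ▸ differentiableOn_of_leftInvOn isOpen_halfPlane
      h.holo h.bij.injOn.leftInvOn_invFunOn, fun w hw => Function.invFunOn_pos (h.bij.surjOn hw)⟩
  have hmem : MapsTo ψ halfPlane Ω := h'.bij.mapsTo.mono_right hΩ
  have hexp : ∀ ξ ∈ halfPlane, Complex.exp (τ (ψ ξ) - ξ) = R' / R := fun ξ hξ =>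
    h.exp_sub_eq h' hR.ne' (hφτ _ (hmem hξ)).1 hξ (hφτ _ (hmem hξ)).2
  have hone : (1 : ℂ) ∈ halfPlane := one_pos (α := ℝ)
  refine ⟨τ (ψ 1) - 1, ?_, fun ξ hξ => ?_⟩
  · have hnorm := congrArg norm (hexp 1 hone)
    rw [Complex.norm_exp, norm_div, Complex.norm_real, Complex.norm_real,
      Real.norm_of_nonneg hR'.le, Real.norm_of_nonneg hR.le] at hnorm
    rw [← hnorm, Real.log_exp]
  · have hconst := eqOn_const_of_exp_eqOn_const isOpen_halfPlane
      (convex_halfSpace_re_gt 0).isPreconnected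
      ((hτ.comp h'.holo hmem).sub differentiableOn_id) hexp hone hξ
    rw [Pi.sub_apply, Pi.sub_apply, Function.comp_apply, Function.comp_apply, id, id] at hconst
    rw [← hconst, add_sub_cancel]
    exact ⟨(hφτ _ (hmem hξ)).1, (hφτ _ (hmem hξ)).2.symm⟩

lemma exists_shift_of_le (h : IsTractMap f R Ω φ) (hΩ : Ω ∈ tracts f R) (hR : 0 < R)
    (hRR' : R ≤ R') :
    ∃ Ω' ∈ tracts f R', ∀ ψ, IsTractMap f R' Ω' ψ →
      ∃ c : ℂ, 0 ≤ c.re ∧ ∀ ξ ∈ halfPlane, ψ ξ = φ (ξ + c) := by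
  have hR' : 0 < R' := hR.trans_le hRR'
  have hlog : 0 ≤ Real.log (R' / R) := Real.log_nonneg ((one_le_div hR).2 hRR')
  obtain ⟨ξ₀, hξ₀⟩ : ∃ ξ₀ : ℂ, Real.log (R' / R) < ξ₀.re :=
    ⟨(Real.log (R' / R) + 1 : ℝ), by simp⟩
  have hξ₀m : ξ₀ ∈ halfPlane := hlog.trans_lt hξ₀
  have hfξ₀ : R' < ‖f (φ ξ₀)‖ := by rwa [h.norm_eq hR hξ₀m, lt_mul_exp_iff hR hR']
  refine ⟨_, ⟨φ ξ₀, hfξ₀, rfl⟩, fun ψ hψ => ?_⟩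
  rw [h.connectedComponentIn_eq hΩ hR hRR' (h.bij.mapsTo hξ₀m) hfξ₀] at hψ
  obtain ⟨c, hc, hshift⟩ := h.exists_shift hψ hR hR' (by
    rintro _ ⟨ξ, hξ, rfl⟩
    exact h.bij.mapsTo (hlog.trans_lt hξ))
  exact ⟨c, hc ▸ hlog, fun ξ hξ => (hshift ξ hξ).2⟩

lemma exists_shift_of_ge (h : IsTractMap f R Ω φ) (hΩ : Ω ∈ tracts f R) (hR' : 0 < R')
    (hR'R : R' ≤ R) :
    ∃ Ω' ∈ tracts f R', ∀ ψ, IsTractMap f R' Ω' ψ →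
      ∃ c : ℂ, ∀ ξ ∈ halfPlane, 0 < (ξ + c).re ∧ φ ξ = ψ (ξ + c) := by
  obtain ⟨z₀, hz₀, rfl⟩ := hΩ
  refine ⟨_, ⟨z₀, hR'R.trans_lt hz₀, rfl⟩, fun ψ hψ => ?_⟩
  obtain ⟨c, -, hshift⟩ := hψ.exists_shift h hR' (hR'.trans_le hR'R)
    (connectedComponentIn_mono z₀ fun v hv => hR'R.trans_lt hv)
  exact ⟨c, hshift⟩

/- The level at which the Hölder condition holds need not be `R`, but passing between levels only
translates the conformal map. -/
lemma exists_regularTract (h : IsTractMap f R Ω φ) (hΩ : Ω ∈ tracts f R) (hR : 0 < R)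
    (hα : 0 < α) (hα1 : α ≤ 1) (hH : HasHolderTracts f α)
    (htend : Tendsto (fun T : ℝ => ‖φ T‖) atTop atTop) : ∃ x C T₁, RegularTract φ α x C T₁ := by
  obtain ⟨R', hR', -, hholder⟩ := hH
  rcases le_total R R' with hle | hle
  · obtain ⟨Ω', hΩ', hshift⟩ := h.exists_shift_of_le hΩ hR hle
    obtain ⟨ψ, hψ, H, hψH⟩ := hholder Ω' hΩ'
    obtain ⟨c, hc, hψφ⟩ := hshift ψ hψ
    have hpos : ∀ ξ : ℂ, c.re + 1 ≤ ξ.re → 0 < (ξ + -c).re := fun ξ hξ => by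
      rw [Complex.add_re, Complex.neg_re]
      linarith
    refine Tract.exists_regularTract (c := -c) hα hα1 h.holo h.bij.injOn hψ.holo htend
      (by linarith) hpos (fun ξ hξ => ?_) hψH
    rw [hψφ _ (hpos ξ hξ), neg_add_cancel_right]
  · obtain ⟨Ω', hΩ', hshift⟩ := h.exists_shift_of_ge hΩ (one_pos.trans_le hR') hle
    obtain ⟨ψ, hψ, H, hψH⟩ := hholder Ω' hΩ'
    obtain ⟨c, hφψ⟩ := hshift ψ hψ
    exact Tract.exists_regularTract hα hα1 h.holo h.bij.injOn hψ.holo htend zero_le_one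
      (fun ξ hξ => (hφψ ξ (one_pos.trans_le hξ)).1)
      (fun ξ hξ => (hφψ ξ (one_pos.trans_le hξ)).2) hψH

lemma tendsto_norm (h : IsTractMap f R Ω φ) (hR : 0 < R) (hf : Continuous f) :
    Tendsto (fun T : ℝ => ‖φ T‖) atTop atTop := by
  refine tendsto_atTop.2 fun B => ?_
  obtain ⟨M, hM⟩ := (isCompact_closedBall (0 : ℂ) B).exists_bound_of_continuousOn hf.continuousOn
  filter_upwards [eventually_gt_atTop 0,
    (Real.tendsto_exp_atTop.const_mul_atTop hR).eventually_gt_atTop M] with T hT hTM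
  by_contra! hlt
  refine hTM.not_ge ?_
  calc R * Real.exp T = ‖f (φ T)‖ := (h.norm_eq hR (show 0 < (T : ℂ).re from hT)).symm
    _ ≤ M := hM _ (mem_closedBall_zero_iff.2 hlt.le)

end IsTractMap

end Levels

section Dimension

variable {f : ℂ → ℂ} {E J : Set ℂ}

lemma IsSensitiveSet.subset_radial (h : IsSensitiveSet f E) (hE : E ⊆ J) : E ⊆ radial f J := by
  obtain ⟨B, hB⟩ := h.bounded
  refine fun z hz => ⟨hE hz, lt_of_le_of_lt (liminf_le_of_frequently_le' (x := ENNReal.ofReal B)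
    (Eventually.of_forall fun n => ?_).frequently) ENNReal.ofReal_lt_top⟩
  rw [← ofReal_norm]
  exact ENNReal.ofReal_le_ofReal (hB z hz n)

lemma dimH_le_two (s : Set ℂ) : dimH s ≤ 2 :=
  (dimH_mono (subset_univ s)).trans_eq (by
    rw [Real.dimH_univ_eq_finrank ℂ, Complex.finrank_real_complex, Nat.cast_ofNat])

lemma RegularTract.theta_le_dimH_radial {R α x C T₁ : ℝ} {φ : ℂ → ℂ}
    (h : RegularTract φ α x C T₁) (hα : 0 < α) (hR : 1 ≤ R)
    (hf : ∀ ξ ∈ halfPlane, f (φ ξ) = R * Complex.exp ξ)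
    (hJ : ∀ E, IsSensitiveSet f E → E ⊆ J) :
    ENNReal.ofReal (theta φ) ≤ dimH (radial f J) := by
  refine le_of_forall_lt_imp_le_of_dense fun s hs => ?_
  obtain ⟨t, ht, hst, htθ⟩ := ENNReal.lt_iff_exists_real_btwn.1 hs
  have ht0 : 0 < t := ENNReal.ofReal_pos.1 (bot_le.trans_lt hst)
  obtain ⟨E, htE, hE⟩ := h.exists_isSensitiveSet hR hf ht0
    (h.bInf_pos_of_lt_theta hα ht0 ((ENNReal.ofReal_lt_ofReal_iff_of_nonneg ht).1 htθ))
  exact hst.le.trans (htE.trans (dimH_mono (hE.subset_radial (hJ E hE))))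

end Dimension

namespace Model

variable (m : Model)

lemma toFun_eq {j : Fin m.N} {z : ℂ} (hz : z ∈ m.Ω j) : m.toFun z = Complex.exp (m.τ j z) := by
  have hex : ∃ j, z ∈ m.Ω j := ⟨j, hz⟩
  have hj : hex.choose = j := by
    by_contra hne
    exact Set.disjoint_left.1 (m.disjoint hne) hex.choose_spec hz
  rw [toFun, dif_pos hex, hj]

lemma one_lt_norm_toFun_iff {z : ℂ} : 1 < ‖m.toFun z‖ ↔ ∃ j, z ∈ m.Ω j := by
  refine ⟨fun h => ?_, fun ⟨j, hj⟩ => ?_⟩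
  · by_contra hex
    rw [toFun, dif_neg hex, norm_zero] at h
    exact h.not_gt one_pos
  · rw [m.toFun_eq hj, Complex.norm_exp]
    exact Real.one_lt_exp_iff.2 ((m.bij j).mapsTo hj)

lemma connectedComponentIn_eq {j : Fin m.N} {z : ℂ} (hz : z ∈ m.Ω j) :
    connectedComponentIn {w | 1 < ‖m.toFun w‖} z = m.Ω j := by
  refine Subset.antisymm ?_ ?_
  · refine isPreconnected_connectedComponentIn.subset_left_of_subset_union (m.isOpen j)
      (v := ⋃ i ∈ {i | i ≠ j}, m.Ω i) (isOpen_biUnion fun i _ => m.isOpen i)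
      (Set.disjoint_iUnion₂_right.2 fun i hi => m.disjoint (Ne.symm hi)) (fun w hw => ?_)
      ⟨z, mem_connectedComponentIn (m.one_lt_norm_toFun_iff.2 ⟨j, hz⟩), hz⟩
    obtain ⟨i, hi⟩ := m.one_lt_norm_toFun_iff.1 (connectedComponentIn_subset _ z hw :)
    by_cases hij : i = j
    · exact Or.inl (hij ▸ hi)
    · exact Or.inr (mem_biUnion hij hi)
  · have := m.simplyConnected j
    have hpre : IsPreconnected (m.Ω j) := isPreconnected_iff_preconnectedSpace.2 inferInstance
    exact hpre.subset_connectedComponentIn hz fun w hw => m.one_lt_norm_toFun_iff.2 ⟨j, hw⟩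

lemma mem_tracts (j : Fin m.N) : m.Ω j ∈ tracts m.toFun 1 := by
  obtain ⟨z, hz⟩ : (m.Ω j).Nonempty := nonempty_iff_ne_empty.2 fun h =>
    m.unbounded j (h ▸ Bornology.isBounded_empty)
  exact ⟨z, m.one_lt_norm_toFun_iff.2 ⟨j, hz⟩, (m.connectedComponentIn_eq hz).symm⟩

lemma isTractMap (j : Fin m.N) : IsTractMap m.toFun 1 (m.Ω j) (m.φ j) := by
  have hinv := (m.bij j).invOn_invFunOn
  have hbij : BijOn (m.φ j) halfPlane (m.Ω j) := (m.bij j).symm hinv.symm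
  refine ⟨?_, hbij, fun ξ hξ => ?_⟩
  · rw [← (m.bij j).image_eq]
    exact differentiableOn_of_leftInvOn (m.isOpen j) (m.holo j) hinv.1
  · rw [m.toFun_eq (hbij.mapsTo hξ), Complex.ofReal_one, one_mul]
    exact congrArg _ (hinv.2 hξ)

lemma tendsto_norm (j : Fin m.N) : Tendsto (fun T : ℝ => ‖m.φ j T‖) atTop atTop := by
  have hreal : Tendsto (fun T : ℝ => (T : ℂ)) atTop (Bornology.cobounded ℂ) := by
    rw [← tendsto_norm_atTop_iff_cobounded]
    simpa only [Complex.norm_real] using tendsto_norm_atTop_atTop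
  refine tendsto_norm_cobounded_atTop.comp ((m.tendsto_infty j).comp
    (tendsto_inf.2 ⟨hreal, tendsto_principal.2 ?_⟩))
  filter_upwards [eventually_gt_atTop 0] with T hT using hT

end Model

lemma ClassB.exists_lt_norm {f : ℂ → ℂ} (hf : ClassB f) (R : ℝ) : ∃ z, R < ‖f z‖ := by
  by_contra! hle
  obtain ⟨c, hc⟩ := hf.entire.exists_const_forall_eq_of_bounded
    (isBounded_iff_forall_norm_le.2 ⟨R, forall_mem_range.2 hle⟩)
  exact hf.transcendental ⟨Polynomial.C c, fun z => by rw [hc z, Polynomial.eval_C]⟩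

lemma IsTractSystem.pos_of_exists_lt_norm {f : ℂ → ℂ} {R : ℝ} {N : ℕ} {Ω : Fin N → Set ℂ}
    {φ : Fin N → ℂ → ℂ} (h : IsTractSystem f R Ω φ) (hR : ∃ z, R < ‖f z‖) : 0 < N := by
  obtain ⟨z, hz⟩ := hR
  obtain ⟨j, -⟩ : connectedComponentIn {w | R < ‖f w‖} z ∈ range Ω := h.range_eq ▸ ⟨z, hz, rfl⟩
  exact j.pos

section Maxima

variable {N : ℕ}

lemma theta_le_thetaMax (φ : Fin N → ℂ → ℂ) (j : Fin N) : theta (φ j) ≤ thetaMax φ :=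
  le_ciSup (f := fun j => theta (φ j)) (finite_range _).bddAbove j

lemma exists_theta_eq_thetaMax [Nonempty (Fin N)] (φ : Fin N → ℂ → ℂ) :
    ∃ j, theta (φ j) = thetaMax φ :=
  exists_eq_ciSup_of_finite

lemma hasNegativeSpectrum_of_forall [Nonempty (Fin N)] {φ : Fin N → ℂ → ℂ}
    (h : ∀ j, ∀ t > theta (φ j), bInf (φ j) t < 0) :
    HasNegativeSpectrum φ := by
  intro t ht
  obtain ⟨j, hj⟩ := exists_eq_ciSup_of_finite (f := fun j => betaInf (φ j) t)
  rw [bInfMax, betaInfMax, ← hj]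
  exact h j t ((theta_le_thetaMax φ j).trans_lt ht)

end Maxima

end Tract

end

theorem mainTheorem2_general {f : ℂ → ℂ} {R α : ℝ} {N : ℕ} {Ω : Fin N → Set ℂ}
    {φ : Fin N → ℂ → ℂ} {J : Set ℂ} (hN : 0 < N) (hα : 0 < α) (hα1 : α ≤ 1)
    (hH : Tract.HasHolderTracts f α) (hR : 1 ≤ R) (hΩ : ∀ j, Ω j ∈ Tract.tracts f R)
    (hφ : ∀ j, Tract.IsTractMap f R (Ω j) (φ j))
    (htend : ∀ j, Filter.Tendsto (fun T : ℝ => ‖φ j T‖) Filter.atTop Filter.atTop)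
    (hJ : ∀ E, Tract.IsSensitiveSet f E → E ⊆ J) :
    Tract.HasNegativeSpectrum φ ∧
    1 ≤ Tract.thetaMax φ ∧
    ENNReal.ofReal (Tract.thetaMax φ) ≤ dimH (Tract.radial f J) ∧
    dimH (Tract.radial f J) ≤ 2 ∧
    (1 / 2 < α → Tract.thetaMax φ < 2) := by
  have : Nonempty (Fin N) := ⟨⟨0, hN⟩⟩
  have hreg : ∀ j, ∃ x C T₁, Tract.RegularTract (φ j) α x C T₁ := fun j =>
    (hφ j).exists_regularTract (hΩ j) (one_pos.trans_le hR) hα hα1 hH (htend j)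
  obtain ⟨j, hj⟩ := Tract.exists_theta_eq_thetaMax φ
  obtain ⟨x, C, T₁, h⟩ := hreg j
  refine ⟨Tract.hasNegativeSpectrum_of_forall fun i t ht => ?_, ?_, ?_, Tract.dimH_le_two _, ?_⟩
  · obtain ⟨_, _, _, hi⟩ := hreg i
    exact hi.bInf_neg_of_theta_lt hα ht
  · exact hj ▸ h.one_le_theta hα
  · exact hj ▸ h.theta_le_dimH_radial hα hR (hφ j).eq_exp hJ
  · exact fun hα2 => hj ▸ (h.theta_le_inv hα).trans_lt
      ((inv_lt_comm₀ hα two_pos).2 (by rwa [← one_div]))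

theorem mainTheorem2 :
    (∀ (m : Tract.Model) (α : ℝ), 0 < α → α ≤ 1 → Tract.HasHolderTracts m.toFun α →
      Tract.HasNegativeSpectrum m.φ ∧
      1 ≤ Tract.thetaMax m.φ ∧
      ENNReal.ofReal (Tract.thetaMax m.φ) ≤ m.hypDim ∧
      m.hypDim ≤ 2 ∧
      (1 / 2 < α → Tract.thetaMax m.φ < 2)) ∧
    (∀ (f : ℂ → ℂ) (α : ℝ), Tract.ClassB f → 0 < α → α ≤ 1 → Tract.HasHolderTracts f α →
      ∀ (R : ℝ) (N : ℕ) (Ω : Fin N → Set ℂ) (φ : Fin N → ℂ → ℂ), 1 ≤ R →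
        Tract.IsTractSystem f R Ω φ →
        Tract.HasNegativeSpectrum φ ∧
        1 ≤ Tract.thetaMax φ ∧
        ENNReal.ofReal (Tract.thetaMax φ) ≤ Tract.hypDim f ∧
        Tract.hypDim f ≤ 2 ∧
        (1 / 2 < α → Tract.thetaMax φ < 2)) := by
  refine ⟨fun m α hα hα1 hH => ?_, fun f α hf hα hα1 hH R N Ω φ hR hsys => ?_⟩
  · exact mainTheorem2_general m.N_pos hα hα1 hH le_rfl m.mem_tracts m.isTractMap m.tendsto_norm
      fun E hE => hE.one_lt
  · have hcont : Continuous f := hf.entire.continuous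
    exact mainTheorem2_general (hsys.pos_of_exists_lt_norm (hf.exists_lt_norm R)) hα hα1 hH hR
      (fun j => hsys.range_eq ▸ Set.mem_range_self j) hsys.isTractMap
      (fun j => (hsys.isTractMap j).tendsto_norm (one_pos.trans_le hR) hcont)
      fun E hE => hE.subset_julia hcont
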